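/- **Online Generalized Scheduling.** There are $m\ge 2$ machines and $n\ge 2$ jobs, and each job has at most $r\ge 1$ ways of being scheduled on a given machine. Known up front are $m,n,r$, a norm $\|\cdot\|_i$ on $\mathbb{R}^{nr}$ for every machine $i\in[m]$, and an aggregation function $f$ on $\mathbb{R}^m$. The jobs arrive one at a time. When job $j$ arrives, it reveals the loads $p_{ijk}\in\mathbb{R}_{\ge 0}\cup\{\infty\}$ it incurs when it is scheduled on machine $i$ in way $k$ (where $p_{ijk}=\infty$ means that this way is not available), and it has to be assigned immediately and irrevocably to one machine in one way. For an allocation $x$ of all jobs ($x_{ijk}\in\{0,1\}$, $\sum_{i,k}x_{ijk}=1$ for all $j$) let $\Lambda_i(x)=\|(x_{ijk}p_{ijk})_{j,k}\|_i$. The cost of $x$ is $f(\Lambda(x))$, or $\infty$ if $x$ uses an unavailable way, and $\mathrm{OPT}$ is the minimum cost of an allocation. A randomized online algorithm is $\rho$-competitive if on every fixed input its expected cost is at most $\rho\cdot\mathrm{OPT}$. A monotone symmetric norm on $\mathbb{R}^d$ is a norm that is invariant under permutations of the coordinates and monotone on $\mathbb{R}^d_{\ge 0}$. **Theorem.** There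 is an absolute constant $C>0$ such that the following holds for all $m,n\ge 2$, all $r\ge 1$ and all monotone symmetric machine norms $\|\cdot\|_1,\dots,\|\cdot\|_m$ on $\mathbb{R}^{nr}$. 1. If $f$ is a monotone symmetric norm on $\mathbb{R}^m$, then there is a $C\log^2 m\,\log n$-competitive randomized online algorithm. 2. If $f$ is the $\ell_p$ norm on $\mathbb{R}^m$ for some $p\in[1,\infty]$, or the Top-$k$ norm on $\mathbb{R}^m$ (the sum of the $k$ largest absolute values of coordinates) for some $1\le k\le m$, then there is a $C\log m\,\log n$-competitive randomized online algorithm. -/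

import Mathlib

open scoped ENNReal

noncomputable section

namespace GenSched

/-- A monotone symmetric norm on `ℝ^ι`: a norm on the vector space `ι → ℝ` that is monotone on the
nonnegative orthant and invariant under permutations of the coordinates. -/
structure IsMonotoneSymmetricNorm {ι : Type} (N : (ι → ℝ) → ℝ) : Prop where
  add_le : ∀ x y : ι → ℝ, N (x + y) ≤ N x + N y
  smul : ∀ (a : ℝ) (x : ι → ℝ), N (a • x) = |a| * N x
  definite : ∀ x : ι → ℝ, N x = 0 → x = 0
  monotone : ∀ x y : ι → ℝ, 0 ≤ x → x ≤ y → N x ≤ N y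
  symmetric : ∀ (σ : Equiv.Perm ι) (x : ι → ℝ), N (x ∘ σ) = N x

/-- The `ℓ_p` norm on `ℝ^m`, where `1 ≤ p ≤ ∞` in all uses. -/
def ellNorm (m : ℕ) (p : ℝ≥0∞) (x : Fin m → ℝ) : ℝ :=
  ‖(WithLp.toLp p x : PiLp p (fun _ : Fin m => ℝ))‖

/-- The Top-`k` norm on `ℝ^m`: the sum of the `k` largest absolute values of coordinates, where
`1 ≤ k ≤ m` in all uses. -/
def topKNorm (m k : ℕ) (x : Fin m → ℝ) : ℝ :=
  ⨆ S : {S : Finset (Fin m) // S.card = k}, ∑ i ∈ S.1, |x i|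

/-- What is revealed when a job arrives: the load `ℓ i k` that the job incurs when it is scheduled
on machine `i` in way `k`. The value `∞` means that this way is not available on this machine. -/
abbrev Job (m r : ℕ) : Type := Fin m → Fin r → ℝ≥0∞

/-- The sequence of the `n` jobs in the order of arrival. -/
abbrev JobSeq (m n r : ℕ) : Type := Fin n → Job m r

/-- An allocation of all the jobs: job `j` goes to machine `(x j).1` in way `(x j).2`. -/
abbrev Allocation (m n r : ℕ) : Type := Fin n → Fin m × Fin r

section Cost

variable {m n r : ℕ}

/-- The vector `(x_{ijk} p_{ijk})_{j,k}` of the loads put on machine `i`. -/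
def machineVector (p : JobSeq m n r) (x : Allocation m n r) (i : Fin m) : Fin n × Fin r → ℝ :=
  fun jk => if x jk.1 = (i, jk.2) then (p jk.1 i jk.2).toReal else 0

/-- The vector `Λ(x)` of the total loads of the machines. -/
def loadVector (N : Fin m → (Fin n × Fin r → ℝ) → ℝ) (p : JobSeq m n r)
    (x : Allocation m n r) : Fin m → ℝ :=
  fun i => N i (machineVector p x i)

/-- The objective `f (Λ(x))`; it is `∞` if `x` uses a way that is not available. -/
def cost (f : (Fin m → ℝ) → ℝ) (N : Fin m → (Fin n × Fin r → ℝ) → ℝ) (p : JobSeq m n r)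
    (x : Allocation m n r) : ℝ≥0∞ :=
  open Classical in
  if ∀ j, p j (x j).1 (x j).2 ≠ ∞ then ENNReal.ofReal (f (loadVector N p x)) else ∞

/-- The offline optimum. -/
def opt (f : (Fin m → ℝ) → ℝ) (N : Fin m → (Fin n × Fin r → ℝ) → ℝ) (p : JobSeq m n r) : ℝ≥0∞ :=
  ⨅ x : Allocation m n r, cost f N p x

end Cost

/-- A deterministic online algorithm: the irrevocable decision for job `j` depends only on the jobs
that have arrived up to and including `j`. -/
structure OnlineAlgorithm (m n r : ℕ) where
  assign : JobSeq m n r → Allocation m n r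
  online : ∀ (p q : JobSeq m n r) (j : Fin n), (∀ j' ≤ j, p j' = q j') → assign p j = assign q j

/-- There is a `ρ`-competitive randomized online algorithm for the aggregation function `f` and the
machine norms `N`, which are known up front. A randomized algorithm is a probability distribution
`P` on deterministic online algorithms, and on every job sequence its expected cost is at most `ρ`
times the offline optimum. -/
def HasCompetitiveAlgorithm {m n r : ℕ} (f : (Fin m → ℝ) → ℝ)
    (N : Fin m → (Fin n × Fin r → ℝ) → ℝ) (ρ : ℝ) : Prop :=
  ∃ P : PMF (OnlineAlgorithm m n r), ∀ p : JobSeq m n r,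
    ∑' A : OnlineAlgorithm m n r, P A * cost f N p (A.assign p) ≤ ENNReal.ofReal ρ * opt f N p

end GenSched

end

/-! Restarting whenever the optimum of the jobs seen so far passes a power of two makes a bound `G`
of the order of the optimum available. The aggregation `f` is linearised (`Discretization`): a
machine with a dyadic load target is a unit with a price. Every allocation of cost at most `G`
respects targets of total price at most `K`, and conversely the prices control `f` when each unit is
used at a fraction of at most `1`. `K` is the number of levels, of order `log m`, for a general
norm, but `2` for `ℓ_p` and Top-`k`; only here do the two parts of the theorem differ.

A machine norm is linearised by classes `l < D`, where `D` is about `log₂ n`. A load fits class `l`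
of a unit with target `T` if `2 ^ l` copies of it have norm at most `T`. By subadditivity, the jobs
of class `l` contribute at most `T` times (`2 ^ (-l)` per job, plus `1` once for a class `l ≥ 1`),
see `norm_le_of_class`. Conversely, a vector of norm at most `T` has fewer than `2 ^ (l + 1)`
entries that do not fit class `l + 1` (`card_lt_of_class`), so a reference solution puts load at
most `2 * D` on a unit.

What remains is an online covering problem with opening costs. Fractional openings `y u` of the
cheapest eligible units are raised multiplicatively, and the growth of `log y` charges the price
bounds `lam` of the requests to the reference solution (`sum_selPrice_le`). Independent thresholds
round the openings of the groups `(u, l)`. A request goes as close as possible below its best class: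
going down `g` classes costs a factor `2 ^ g`, but is needed with probability at most `4 ^ (-g)`, so
the expected cost is at most `2 * lam`.

By `totalLoad_bounds` every unit has load `O(D log M)` for every outcome of the thresholds, and the
expected total price of the loads is `O(D log M * K)`. Dividing by the pointwise bound yields
fractions in `[0, 1]`, to which the discretization applies (`agg_phaseVector_le`). Phases add up
geometrically, and the ratio is of order `K * log m * log n`. -/

open scoped ENNReal
open Finset

namespace GenSched

set_option linter.unusedSectionVars false

/-! ### Selection of cheap units for a request -/

section Units

variable {U : Type} [Fintype U] [DecidableEq U]

/-- A request: it may be served by any unit `u ∈ elig`, in one of the classes `0, …, lev u`. -/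
structure Request (U : Type) where
  elig : Finset U
  lev : U → ℕ

/-- Units are added by increasing price until their weight reaches `2`, but never beyond the
smallest cap. As single weights are at most `2`, the total stays at most `4`, and a unit of weight
`2` can only complete the set, so none is cheaper than `lam`. In the application `cap` is the price
of class `0`. -/
theorem exists_selection (E : Finset U) (hE : E.Nonempty) (pr w cap : U → ℝ)
    (hw0 : ∀ u ∈ E, 0 ≤ w u) (hw2 : ∀ u ∈ E, w u ≤ 2) (hpr : ∀ u ∈ E, 0 < pr u)
    (hcap : ∀ u ∈ E, pr u ≤ cap u) :
    ∃ P ⊆ E, ∃ lam : ℝ, P.Nonempty ∧ 0 < lam ∧ (∀ u ∈ P, pr u ≤ lam) ∧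
      (∀ u ∈ E, u ∉ P → lam ≤ pr u) ∧ (∀ u ∈ E, lam ≤ cap u) ∧
      (∀ u ∈ E, 2 ≤ w u → lam ≤ pr u) ∧ ∑ u ∈ P, w u ≤ 4 ∧
      (2 ≤ ∑ u ∈ P, w u ∨ ∃ u ∈ P, cap u = lam) := by
  obtain ⟨u0, hu0, hmin⟩ := E.exists_min_image cap hE
  set Q := E.filter (fun u => pr u ≤ cap u0) with hQ
  have hQE : Q ⊆ E := filter_subset _ _
  have hu0Q : u0 ∈ Q := by simp [hQ, hu0, hcap u0 hu0]
  by_cases hs : ∑ u ∈ Q, w u < 2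
  · refine ⟨Q, hQE, cap u0, ⟨u0, hu0Q⟩, (hpr u0 hu0).trans_le (hcap u0 hu0), ?_, ?_, hmin, ?_,
      by linarith, Or.inr ⟨u0, hu0Q, rfl⟩⟩
    · intro u hu; exact (mem_filter.1 hu).2
    · intro u hu hn
      by_contra h
      exact hn (mem_filter.2 ⟨hu, by linarith⟩)
    · intro u hu h2
      by_contra h
      have huQ : u ∈ Q := mem_filter.2 ⟨hu, by linarith⟩
      have := single_le_sum (f := w) (fun v hv => hw0 v (hQE hv)) huQ
      linarith
  · push Not at hs
    -- `F` consists of the initial segments of `Q` by price with enough weight. A smallest one drops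
    -- below weight `2` once its most expensive unit is removed.
    set F := Q.powerset.filter
      (fun P => 2 ≤ ∑ u ∈ P, w u ∧ ∀ u ∈ P, ∀ v ∈ Q, v ∉ P → pr u ≤ pr v) with hF
    have hFn : F.Nonempty := ⟨Q, by
      simp only [hF, mem_filter, mem_powerset, subset_refl, true_and]
      exact ⟨hs, fun u _ v hv hn => absurd hv hn⟩⟩
    obtain ⟨P, hP, hPmin⟩ := F.exists_min_image (fun P => P.card) hFn
    simp only [hF, mem_filter, mem_powerset] at hP
    obtain ⟨hPQ, hP2, hPlow⟩ := hP
    have hPn : P.Nonempty := by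
      by_contra h
      rw [not_nonempty_iff_eq_empty] at h
      simp [h] at hP2
      linarith
    obtain ⟨u1, hu1, hmax⟩ := P.exists_max_image pr hPn
    have hlt : ∑ u ∈ P.erase u1, w u < 2 := by
      by_contra h
      push Not at h
      have : P.erase u1 ∈ F := by
        simp only [hF, mem_filter, mem_powerset]
        refine ⟨(erase_subset _ _).trans hPQ, h, ?_⟩
        intro u hu v hv hn
        have hu' := mem_of_mem_erase hu
        by_cases hvP : v ∈ P
        · have : v = u1 := by
            by_contra hne
            exact hn (mem_erase.2 ⟨hne, hvP⟩)
          rw [this]; exact hmax u hu'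
        · exact hPlow u hu' v hv hvP
      have h1 := hPmin _ this
      have h2 := card_erase_lt_of_mem hu1
      omega
    have hu1E : u1 ∈ E := hQE (hPQ hu1)
    have hsum : ∑ u ∈ P.erase u1, w u + w u1 = ∑ u ∈ P, w u := sum_erase_add _ _ hu1
    have hle0 : pr u1 ≤ cap u0 := (mem_filter.1 (hPQ hu1)).2
    refine ⟨P, hPQ.trans hQE, pr u1, hPn, hpr u1 hu1E, hmax, ?_, ?_, ?_, ?_, Or.inl hP2⟩
    · intro u hu hn
      by_cases huQ : u ∈ Q
      · exact hPlow u1 hu1 u huQ hn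
      · by_contra h
        exact huQ (mem_filter.2 ⟨hu, by linarith⟩)
    · intro u hu; exact hle0.trans (hmin u hu)
    · intro u hu h2
      by_cases huP : u ∈ P
      · by_cases hne : u = u1
        · rw [hne]
        · have := single_le_sum (f := w) (s := P.erase u1)
            (fun v hv => hw0 v (hQE (hPQ (mem_of_mem_erase hv)))) (mem_erase.2 ⟨hne, huP⟩)
          linarith
      · by_cases huQ : u ∈ Q
        · exact hPlow u1 hu1 u huQ huP
        · by_contra h
          exact huQ (mem_filter.2 ⟨hu, by linarith⟩)
    · have := hw2 u1 hu1E
      linarith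

/-- The weight of a unit with fractional opening `y`. -/
noncomputable def fracWeight (y : ℝ) : ℝ := if y < 1 then y else 2

/-- The price of serving a request by unit `u` in its best class. -/
noncomputable def unitPrice (c : U → ℝ) (e : Request U) (y : U → ℝ) (u : U) : ℝ :=
  c u / 2 ^ e.lev u * max 1 (y u)

/-- `P` is the set of the cheapest units that together have enough weight, and `lam` bounds their
prices. -/
structure IsSelection (c : U → ℝ) (e : Request U) (y : U → ℝ) (P : Finset U) (lam : ℝ) : Prop where
  subset : P ⊆ e.elig
  nonempty : P.Nonempty
  pos : 0 < lam
  le_lam : ∀ u ∈ P, unitPrice c e y u ≤ lam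
  lam_le : ∀ u ∈ e.elig, u ∉ P → lam ≤ unitPrice c e y u
  lam_le_cap : ∀ u ∈ e.elig, lam ≤ c u * max 1 (y u)
  lam_le_of_full : ∀ u ∈ e.elig, 1 ≤ y u → lam ≤ unitPrice c e y u
  sum_le : ∑ u ∈ P, fracWeight (y u) ≤ 4
  cover : 2 ≤ ∑ u ∈ P, fracWeight (y u) ∨ ∃ u ∈ P, c u * max 1 (y u) = lam

theorem fracWeight_nonneg {y : ℝ} (h : 0 ≤ y) : 0 ≤ fracWeight y := by
  unfold fracWeight; split_ifs <;> linarith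

theorem unitPrice_pos {c : U → ℝ} (hc : ∀ u, 0 < c u) (e : Request U) (y : U → ℝ) (u : U) :
    0 < unitPrice c e y u := by
  unfold unitPrice
  have := hc u
  have : 0 < max 1 (y u) := lt_max_of_lt_left one_pos
  positivity

theorem exists_isSelection {c : U → ℝ} (hc : ∀ u, 0 < c u) (e : Request U) (he : e.elig.Nonempty)
    {y : U → ℝ} (hy : ∀ u, 0 ≤ y u) : ∃ P lam, IsSelection c e y P lam := by
  obtain ⟨P, hP, lam, h1, h2, h3, h4, h5, h6, h7, h8⟩ := exists_selection e.elig he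
    (unitPrice c e y) (fun u => fracWeight (y u)) (fun u => c u * max 1 (y u))
    (fun u _ => fracWeight_nonneg (hy u))
    (fun u _ => by unfold fracWeight; split_ifs <;> linarith)
    (fun u _ => unitPrice_pos hc e y u)
    (fun u _ => by
      unfold unitPrice
      have := hc u
      gcongr
      exact div_le_self this.le (one_le_pow₀ (by norm_num)))
  refine ⟨P, lam, hP, h1, h2, h3, h4, h5, fun u hu h => h6 u hu ?_, h7, h8⟩
  unfold fracWeight
  rw [if_neg (not_lt.2 h)]

open Classical in
/-- The set of units selected for a request, with the bound for their prices. -/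
noncomputable def selection (c : U → ℝ) (e : Request U) (y : U → ℝ) : Finset U × ℝ :=
  if h : ∃ s : Finset U × ℝ, IsSelection c e y s.1 s.2 then h.choose else (∅, 0)

theorem selection_spec {c : U → ℝ} (hc : ∀ u, 0 < c u) (e : Request U) (he : e.elig.Nonempty)
    {y : U → ℝ} (hy : ∀ u, 0 ≤ y u) :
    IsSelection c e y (selection c e y).1 (selection c e y).2 := by
  obtain ⟨P, lam, h⟩ := exists_isSelection hc e he hy
  have h' : ∃ s : Finset U × ℝ, IsSelection c e y s.1 s.2 := ⟨(P, lam), h⟩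
  unfold selection
  rw [dif_pos h']
  exact h'.choose_spec

theorem selection_of_empty (c : U → ℝ) (e : Request U) (he : e.elig = ∅) (y : U → ℝ) :
    selection c e y = (∅, 0) := by
  unfold selection
  rw [dif_neg]
  rintro ⟨s, hs⟩
  obtain ⟨u, hu⟩ := hs.nonempty
  have := hs.subset hu
  simp [he] at this

/-- One step of the fractional algorithm. -/
noncomputable def fracStep (c : U → ℝ) (D : ℕ) (e : Request U) (y : U → ℝ) : U → ℝ := fun u =>
  if u ∈ (selection c e y).1 then
    -- The relative increase compares the price bound with the price of all `D` groups of the unit.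
    -- The `16` limits the growth of `D * ∑ c y` to a quarter of the price bound.
    y u * (1 + (selection c e y).2 / (16 * D * (c u * max 1 (y u)))) else y u

/-- The fractional openings after the first `k` requests. -/
noncomputable def frac (c : U → ℝ) (D M : ℕ) (e : ℕ → Request U) : ℕ → U → ℝ
  | 0 => fun _ => 1 / M
  | k + 1 => fracStep c D (e k) (frac c D M e k)

/-- The units selected for the `k`-th request. -/
noncomputable def selUnits (c : U → ℝ) (D M : ℕ) (e : ℕ → Request U) (k : ℕ) : Finset U :=
  (selection c (e k) (frac c D M e k)).1

/-- The bound for the prices of the units selected for the `k`-th request. -/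
noncomputable def selPrice (c : U → ℝ) (D M : ℕ) (e : ℕ → Request U) (k : ℕ) : ℝ :=
  (selection c (e k) (frac c D M e k)).2

/-! ### Competitiveness of the fractional algorithm -/

section Fractional

variable {c : U → ℝ} {D M : ℕ} {e : ℕ → Request U}

theorem frac_succ (k : ℕ) (u : U) : frac c D M e (k + 1) u =
    if u ∈ selUnits c D M e k then frac c D M e k u *
      (1 + selPrice c D M e k / (16 * D * (c u * max 1 (frac c D M e k u))))
    else frac c D M e k u := rfl

theorem frac_pos_and_selPrice_nonneg (hc : ∀ u, 0 < c u) (hM : 0 < M) (k : ℕ) :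
    (∀ u, 0 < frac c D M e k u) ∧ 0 ≤ selPrice c D M e k := by
  have key : ∀ k, (∀ u, 0 < frac c D M e k u) → 0 ≤ selPrice c D M e k := by
    intro k hk
    unfold selPrice
    rcases (e k).elig.eq_empty_or_nonempty with h | h
    · rw [selection_of_empty _ _ h]
    · exact (selection_spec hc _ h fun u => (hk u).le).pos.le
  have h0 : ∀ u, 0 < frac c D M e k u := by
    induction k with
    | zero => intro u; simp only [frac]; positivity
    | succ k ih =>
      intro u
      rw [frac_succ]
      have h1 := key k ih
      have h2 := ih u
      have h3 := hc u
      split_ifs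
      · have : 0 < max 1 (frac c D M e k u) := lt_max_of_lt_left one_pos
        positivity
      · exact h2
  exact ⟨h0, key k h0⟩

theorem frac_pos (hc : ∀ u, 0 < c u) (hM : 0 < M) (k : ℕ) (u : U) : 0 < frac c D M e k u :=
  (frac_pos_and_selPrice_nonneg hc hM k).1 u

theorem selPrice_nonneg (hc : ∀ u, 0 < c u) (hM : 0 < M) (k : ℕ) : 0 ≤ selPrice c D M e k :=
  (frac_pos_and_selPrice_nonneg hc hM k).2

theorem isSelection (hc : ∀ u, 0 < c u) (hM : 0 < M) (k : ℕ) (he : (e k).elig.Nonempty) :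
    IsSelection c (e k) (frac c D M e k) (selUnits c D M e k) (selPrice c D M e k) :=
  selection_spec hc _ he fun u => (frac_pos hc hM k u).le

theorem selUnits_of_empty (k : ℕ) (he : (e k).elig = ∅) : selUnits c D M e k = ∅ := by
  unfold selUnits; rw [selection_of_empty _ _ he]

theorem selPrice_of_empty (k : ℕ) (he : (e k).elig = ∅) : selPrice c D M e k = 0 := by
  unfold selPrice; rw [selection_of_empty _ _ he]

theorem elig_nonempty_of_mem {k : ℕ} {u : U} (h : u ∈ selUnits c D M e k) :
    (e k).elig.Nonempty := by
  rw [nonempty_iff_ne_empty]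
  intro h'
  rw [selUnits_of_empty k h'] at h
  simp at h

theorem frac_le_succ (hc : ∀ u, 0 < c u) (hM : 0 < M) (k : ℕ) (u : U) :
    frac c D M e k u ≤ frac c D M e (k + 1) u := by
  rw [frac_succ]
  have h1 := frac_pos (D := D) (e := e) hc hM k u
  have h2 := selPrice_nonneg (D := D) (e := e) hc hM k
  have h3 := hc u
  split_ifs
  · apply le_mul_of_one_le_right h1.le
    have : 0 < max 1 (frac c D M e k u) := lt_max_of_lt_left one_pos
    have : 0 ≤ selPrice c D M e k / (16 * D * (c u * max 1 (frac c D M e k u))) := by positivity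
    linarith
  · exact le_rfl

theorem frac_mono (hc : ∀ u, 0 < c u) (hM : 0 < M) (u : U) :
    Monotone fun k => frac c D M e k u :=
  monotone_nat_of_le_succ fun k => frac_le_succ hc hM k u

theorem inv_le_frac (hc : ∀ u, 0 < c u) (hM : 0 < M) (k : ℕ) (u : U) :
    1 / (M : ℝ) ≤ frac c D M e k u := by
  have := frac_mono (D := D) (e := e) hc hM u (Nat.zero_le k)
  simpa [frac] using this

/-- The relative increase of the fractional opening of a selected unit. -/
theorem selPrice_div_le (hc : ∀ u, 0 < c u) (hM : 0 < M) (hD : 0 < D) {k : ℕ} {u : U}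
    (hu : u ∈ selUnits c D M e k) :
    selPrice c D M e k / (16 * D * (c u * max 1 (frac c D M e k u))) ≤ 1 := by
  have hs := isSelection (D := D) hc hM k (elig_nonempty_of_mem hu)
  have h1 := hs.lam_le_cap u (hs.subset hu)
  have h3 := hc u
  have hm : 0 < max 1 (frac c D M e k u) := lt_max_of_lt_left one_pos
  have hD' : (1 : ℝ) ≤ D := by exact_mod_cast hD
  rw [div_le_one (by positivity)]
  have : 0 < c u * max 1 (frac c D M e k u) := by positivity
  nlinarith

/-- A selected unit raises `D * c u * y u` by `selPrice / 16` times `y / max 1 y`, which is at most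
its weight, and the selected weights sum to at most `4`. The resulting quarter is small enough for
the openings to be absorbed in `sum_selPrice_le`. -/
theorem sum_cost_frac_succ_le (hc : ∀ u, 0 < c u) (hM : 0 < M) (hD : 0 < D) (k : ℕ) :
    D * ∑ u, c u * frac c D M e (k + 1) u ≤
      D * ∑ u, c u * frac c D M e k u + selPrice c D M e k / 4 := by
  rcases (e k).elig.eq_empty_or_nonempty with h | h
  · simp [frac_succ, selUnits_of_empty k h, selPrice_of_empty k h]
  have hs := isSelection (D := D) hc hM k h
  have hD' : (0 : ℝ) < D := by exact_mod_cast hD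
  have hl := hs.pos
  have key : ∀ u, D * (c u * frac c D M e (k + 1) u) ≤ D * (c u * frac c D M e k u) +
      if u ∈ selUnits c D M e k then selPrice c D M e k / 16 * fracWeight (frac c D M e k u)
        else 0 := by
    intro u
    rw [frac_succ]
    split_ifs with hu
    · have hy := frac_pos (D := D) (e := e) hc hM k u
      set y := frac c D M e k u
      have hm : 0 < max 1 y := lt_max_of_lt_left one_pos
      have h3 := hc u
      have e1 : D * (c u * (y * (1 + selPrice c D M e k / (16 * D * (c u * max 1 y))))) =
          D * (c u * y) + selPrice c D M e k / 16 * (y / max 1 y) := by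
        field_simp
      rw [e1]
      gcongr
      rw [div_le_iff₀ hm]
      unfold fracWeight
      split_ifs with hy1
      · exact le_mul_of_one_le_right hy.le (le_max_left _ _)
      · have := le_max_right 1 y
        linarith
    · simp
  rw [mul_sum, mul_sum]
  calc ∑ u, D * (c u * frac c D M e (k + 1) u) ≤ ∑ u, (D * (c u * frac c D M e k u) +
      if u ∈ selUnits c D M e k then selPrice c D M e k / 16 * fracWeight (frac c D M e k u)
        else 0) := sum_le_sum fun u _ => key u
    _ = ∑ u, D * (c u * frac c D M e k u) + selPrice c D M e k / 16 *
        ∑ u ∈ selUnits c D M e k, fracWeight (frac c D M e k u) := by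
      rw [sum_add_distrib, sum_ite_mem, univ_inter, mul_sum]
    _ ≤ _ := by
      have := mul_le_mul_of_nonneg_left hs.sum_le (show 0 ≤ selPrice c D M e k / 16 by positivity)
      linarith

theorem sum_cost_frac_le (hc : ∀ u, 0 < c u) (hc1 : ∀ u, c u ≤ 1) (hM : 0 < M)
    (hU : Fintype.card U ≤ M) (hD : 0 < D) (k : ℕ) :
    D * ∑ u, c u * frac c D M e k u ≤ D + (∑ j ∈ range k, selPrice c D M e j) / 4 := by
  induction k with
  | zero =>
    simp only [frac, range_zero, sum_empty, zero_div, add_zero]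
    have hM' : (0 : ℝ) < M := by exact_mod_cast hM
    have : ∑ u, c u * (1 / (M : ℝ)) ≤ 1 := by
      calc ∑ u, c u * (1 / (M : ℝ)) ≤ ∑ u : U, 1 / (M : ℝ) := by
            apply sum_le_sum; intro u _
            exact mul_le_of_le_one_left (by positivity) (hc1 u)
        _ = Fintype.card U / (M : ℝ) := by simp [div_eq_mul_inv]
        _ ≤ 1 := by rw [div_le_one hM']; exact_mod_cast hU
    have hD' : (0 : ℝ) ≤ D := by positivity
    nlinarith
  | succ k ih =>
    have := sum_cost_frac_succ_le (e := e) hc hM hD k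
    rw [sum_range_succ]
    linarith

theorem half_le_log_one_add {x : ℝ} (h0 : 0 ≤ x) (h1 : x ≤ 1) : x / 2 ≤ Real.log (1 + x) := by
  have := Real.one_sub_inv_le_log_of_pos (show 0 < 1 + x by linarith)
  have h2 : x / 2 ≤ 1 - (1 + x)⁻¹ := by
    have : 1 - (1 + x)⁻¹ = x / (1 + x) := by field_simp; ring
    rw [this]
    apply div_le_div_of_nonneg_left h0 (by linarith) (by linarith)
  linarith

/-- The logarithmic progress of a selected unit. -/
theorem log_frac_succ_ge (hc : ∀ u, 0 < c u) (hM : 0 < M) (hD : 0 < D) {k : ℕ} {u : U}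
    (hu : u ∈ selUnits c D M e k) :
    Real.log (frac c D M e k u) +
      selPrice c D M e k / (32 * D * (c u * max 1 (frac c D M e k u))) ≤
      Real.log (frac c D M e (k + 1) u) := by
  rw [frac_succ, if_pos hu]
  have hy := frac_pos (D := D) (e := e) hc hM k u
  have hl := selPrice_nonneg (D := D) (e := e) hc hM k
  have h1 := selPrice_div_le hc hM hD hu
  have h3 := hc u
  have hm : 0 < max 1 (frac c D M e k u) := lt_max_of_lt_left one_pos
  have h0 : 0 ≤ selPrice c D M e k / (16 * D * (c u * max 1 (frac c D M e k u))) := by positivity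
  rw [Real.log_mul hy.ne' (by linarith)]
  have := half_le_log_one_add h0 h1
  have e1 : selPrice c D M e k / (32 * D * (c u * max 1 (frac c D M e k u))) =
      selPrice c D M e k / (16 * D * (c u * max 1 (frac c D M e k u))) / 2 := by
    rw [div_div]; ring_nf
  rw [e1]
  linarith

/-- The total load that a unit can receive from the requests for which it is selected. -/
theorem active_le (hc : ∀ u, 0 < c u) (hM : 0 < M) (hD : 0 < D) (k : ℕ) (u : U) :
    (∑ j ∈ range k, if u ∈ selUnits c D M e j then (1 / 2 : ℝ) ^ (e j).lev u else 0) ≤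
      32 * D * Real.log (M * frac c D M e k u) := by
  have hM' : (0 : ℝ) < M := by exact_mod_cast hM
  have hD' : (0 : ℝ) < D := by exact_mod_cast hD
  induction k with
  | zero => simp [frac, hM'.ne']
  | succ k ih =>
    rw [sum_range_succ]
    have hy := frac_pos (D := D) (e := e) hc hM k u
    have hy' := frac_pos (D := D) (e := e) hc hM (k + 1) u
    rw [Real.log_mul hM'.ne' hy.ne'] at ih
    rw [Real.log_mul hM'.ne' hy'.ne']
    split_ifs with hu
    · have hs := isSelection (D := D) hc hM k (elig_nonempty_of_mem hu)
      have h1 := log_frac_succ_ge hc hM hD hu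
      have h2 := hs.le_lam u hu
      have h3 := hc u
      have hm : 0 < max 1 (frac c D M e k u) := lt_max_of_lt_left one_pos
      -- `selPrice` is at least the price of `u`, which is `2 ^ (-lev u)` times `c u * max 1 (y u)`.
      -- So every selection raises `log y` by at least `2 ^ (-lev u) / (32 * D)`.
      have h4 : (1 / 2 : ℝ) ^ (e k).lev u ≤
          32 * D * (selPrice c D M e k / (32 * D * (c u * max 1 (frac c D M e k u)))) := by
        have e1 : 32 * D * (selPrice c D M e k / (32 * D * (c u * max 1 (frac c D M e k u)))) =
          selPrice c D M e k / (c u * max 1 (frac c D M e k u)) := by field_simp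
        rw [e1, le_div_iff₀ (by positivity)]
        unfold unitPrice at h2
        calc _ = c u / 2 ^ (e k).lev u * max 1 (frac c D M e k u) := by
              rw [one_div, inv_pow]; field_simp
          _ ≤ _ := h2
      nlinarith
    · have := Real.log_le_log hy (frac_le_succ (D := D) (e := e) hc hM k u)
      nlinarith

/-- The price of one request, charged to the unit that serves it in a reference solution. -/
theorem selPrice_le (hc : ∀ u, 0 < c u) (hM : 0 < M) (hD : 0 < D) {k n : ℕ} (hk : k ≤ n) {u : U}
    (hu : u ∈ (e k).elig) :
    selPrice c D M e k ≤ c u * (1 / 2) ^ (e k).lev u * (1 + frac c D M e n u) +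
      32 * D * c u * (Real.log (min (frac c D M e (k + 1) u) 2) -
        Real.log (min (frac c D M e k u) 2)) := by
  have hs := isSelection (D := D) hc hM k ⟨u, hu⟩
  have hy := frac_pos (D := D) (e := e) hc hM k u
  have hyn := frac_mono (D := D) (e := e) hc hM u hk
  have hys := frac_le_succ (D := D) (e := e) hc hM k u
  have h3 := hc u
  have hD' : (0 : ℝ) < D := by exact_mod_cast hD
  have hpr : ∀ y ≤ frac c D M e n u, 0 < y →
      c u / 2 ^ (e k).lev u * max 1 y ≤ c u * (1 / 2) ^ (e k).lev u * (1 + frac c D M e n u) := by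
    intro y hy h0
    rw [one_div, inv_pow, ← div_eq_mul_inv]
    gcongr
    apply max_le <;> linarith
  have hp := hpr _ hyn hy
  have hlog : 0 ≤ Real.log (min (frac c D M e (k + 1) u) 2) -
        Real.log (min (frac c D M e k u) 2) := by
    rw [sub_nonneg]
    apply Real.log_le_log (lt_min hy two_pos)
    exact min_le_min_right _ hys
  have hlog' : 0 ≤ 32 * D * c u * (Real.log (min (frac c D M e (k + 1) u) 2) -
        Real.log (min (frac c D M e k u) 2)) := by positivity
  -- If `u` is full or not selected, `selPrice` is at most the price of `u`, covered by the first
  -- term. If `u` is selected with `y < 1`, the growth of `log y` pays; a step at most doubles `y`,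
  -- so the truncation at `2` cuts nothing off.
  by_cases h1 : 1 ≤ frac c D M e k u
  · have := hs.lam_le_of_full u hu h1
    unfold unitPrice at this
    linarith
  · push Not at h1
    by_cases hP : u ∈ selUnits c D M e k
    · have h4 := log_frac_succ_ge hc hM hD hP
      have h5 := selPrice_div_le hc hM hD hP
      have h6 : frac c D M e (k + 1) u ≤ 2 := by
        rw [frac_succ, if_pos hP]
        nlinarith
      rw [min_eq_left h6, min_eq_left (by linarith)]
      rw [max_eq_left h1.le] at h4
      have h7 : selPrice c D M e k =
          32 * D * c u * (selPrice c D M e k / (32 * D * (c u * 1))) := by field_simp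
      have h8 : 0 ≤ c u * (1 / 2) ^ (e k).lev u * (1 + frac c D M e n u) := by
        have : 0 < frac c D M e n u := by linarith
        positivity
      have h9 : selPrice c D M e k / (32 * D * (c u * 1)) ≤
          Real.log (frac c D M e (k + 1) u) - Real.log (frac c D M e k u) := by linarith
      have h10 := mul_le_mul_of_nonneg_left h9 (show 0 ≤ 32 * D * c u by positivity)
      linarith
    · have := hs.lam_le u hu hP
      unfold unitPrice at this
      linarith

/-- Competitiveness of the fractional algorithm against a reference solution that serves request
`k` by the unit `v k`. -/
theorem sum_selPrice_le (hc : ∀ u, 0 < c u) (hc1 : ∀ u, c u ≤ 1) (hM : 2 ≤ M)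
    (hU : Fintype.card U ≤ M) (hD : 0 < D) {n : ℕ} {K : ℝ} (hK : 1 ≤ K) (v : ℕ → U)
    (V : Finset U) (hv : ∀ k < n, (e k).elig.Nonempty → v k ∈ (e k).elig ∧ v k ∈ V)
    (hV : ∑ u ∈ V, c u ≤ K)
    (hload : ∀ u, ∑ k ∈ (range n).filter (fun k => (e k).elig.Nonempty ∧ v k = u),
      (1 / 2 : ℝ) ^ (e k).lev u ≤ 2 * D) :
    ∑ k ∈ range n, selPrice c D M e k ≤ 72 * D * K * Real.log (2 * M) := by
  have hM0 : 0 < M := by omega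
  have hM' : (2 : ℝ) ≤ M := by exact_mod_cast hM
  have hD' : (1 : ℝ) ≤ D := by exact_mod_cast hD
  -- Truncation at `2` keeps the telescoping sum of each unit below `log 2 + log M`.
  set h : ℕ → U → ℝ := fun k u => Real.log (min (frac c D M e k u) 2) with hh
  have hmono : ∀ u k, h k u ≤ h (k + 1) u := by
    intro u k
    apply Real.log_le_log (lt_min (frac_pos hc hM0 k u) two_pos)
    exact min_le_min_right _ (frac_le_succ hc hM0 k u)
  have key : ∀ k ∈ range n, selPrice c D M e k ≤ ∑ u ∈ V,
      ((if (e k).elig.Nonempty ∧ v k = u then c u * (1 / 2) ^ (e k).lev u *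
        (1 + frac c D M e n u) else 0) + 32 * D * c u * (h (k + 1) u - h k u)) := by
    intro k hk
    have hnn : ∀ u ∈ V, 0 ≤ ((if (e k).elig.Nonempty ∧ v k = u then c u * (1 / 2) ^ (e k).lev u *
        (1 + frac c D M e n u) else 0) + 32 * D * c u * (h (k + 1) u - h k u)) := by
      intro u _
      have h1 := hc u
      have h2 := frac_pos (D := D) (e := e) hc hM0 n u
      have h3 : 0 ≤ h (k + 1) u - h k u := sub_nonneg.2 (hmono u k)
      split_ifs <;> positivity
    rcases (e k).elig.eq_empty_or_nonempty with he | he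
    · rw [selPrice_of_empty k he]
      exact sum_nonneg hnn
    · obtain ⟨h1, h2⟩ := hv k (mem_range.1 hk) he
      refine le_trans ?_ (single_le_sum hnn h2)
      rw [if_pos ⟨he, rfl⟩]
      exact selPrice_le hc hM0 hD (mem_range.1 hk).le h1
  have hsum := sum_le_sum key
  rw [sum_comm] at hsum
  have hu : ∀ u ∈ V, ∑ k ∈ range n,
      ((if (e k).elig.Nonempty ∧ v k = u then c u * (1 / 2) ^ (e k).lev u *
        (1 + frac c D M e n u) else 0) + 32 * D * c u * (h (k + 1) u - h k u)) ≤
      2 * D * c u + 2 * (D * (c u * frac c D M e n u)) + 32 * D * c u * Real.log (2 * M) := by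
    intro u _
    have h1 := hc u
    have h2 := frac_pos (D := D) (e := e) hc hM0 n u
    rw [sum_add_distrib, ← sum_filter, ← mul_sum, sum_range_sub (fun k => h k u), ← sum_mul,
      ← mul_sum]
    have h3 := hload u
    have h4 : h n u - h 0 u ≤ Real.log (2 * M) := by
      have h5 : h n u ≤ Real.log 2 := Real.log_le_log (lt_min h2 two_pos) (min_le_right _ _)
      have h6 : h 0 u = - Real.log M := by
        simp only [hh, frac]
        rw [min_eq_left, one_div, Real.log_inv]
        rw [div_le_iff₀ (by linarith)]; linarith
      rw [Real.log_mul (by norm_num) (by linarith), h6]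
      linarith
    have h7 : c u * (∑ k ∈ (range n).filter (fun k => (e k).elig.Nonempty ∧ v k = u),
      (1 / 2 : ℝ) ^ (e k).lev u) * (1 + frac c D M e n u) ≤
        c u * (2 * D) * (1 + frac c D M e n u) := by gcongr
    have h8 : 32 * D * c u * (h n u - h 0 u) ≤ 32 * D * c u * Real.log (2 * M) := by gcongr
    linarith
  have hsum2 := hsum.trans (sum_le_sum hu)
  rw [sum_add_distrib, sum_add_distrib, ← mul_sum, ← mul_sum, ← mul_sum, ← sum_mul, ← mul_sum]
    at hsum2
  have hlog : 1 ≤ Real.log (2 * M) := by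
    rw [Real.le_log_iff_exp_le (by linarith)]
    have := Real.exp_one_lt_d9
    linarith
  have h1 : ∑ u ∈ V, c u * frac c D M e n u ≤ ∑ u, c u * frac c D M e n u :=
    sum_le_sum_of_subset_of_nonneg (subset_univ _) fun u _ _ =>
      mul_nonneg (hc u).le (frac_pos hc hM0 n u).le
  have h2 := sum_cost_frac_le (e := e) hc hc1 hM0 hU hD n
  have h3 : D * ∑ u ∈ V, c u * frac c D M e n u ≤ D * ∑ u, c u * frac c D M e n u := by gcongr
  have h4 : 2 * D * ∑ u ∈ V, c u ≤ 2 * D * K := by gcongr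
  have h5 : 32 * D * (∑ u ∈ V, c u) * Real.log (2 * M) ≤ 32 * D * K * Real.log (2 * M) := by
    gcongr
  have hDK : (D : ℝ) ≤ D * K := by nlinarith
  have hDKl : D * K ≤ D * K * Real.log (2 * M) := by
    apply le_mul_of_one_le_right _ hlog
    positivity
  -- With `Λ` the sum of the `selPrice`, the final openings enter as `2 * (D + Λ / 4)`. Half of `Λ`
  -- moves to the left side and `2 + 2 + 32` multiples of `D * K * log (2 * M)` remain, hence the
  -- constant `72`.
  nlinarith

end Fractional

/-! ### Probabilities for uniform thresholds -/

section Counting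

theorem card_threshold_lt {M : ℕ} (y : ℝ) :
    (univ.filter fun t : Fin M => ((t : ℕ) : ℝ) < y * M).card = min M ⌈y * M⌉₊ := by
  have : (univ.filter fun t : Fin M => ((t : ℕ) : ℝ) < y * M) =
      univ.filter fun t : Fin M => (t : ℕ) < ⌈y * M⌉₊ := by
    ext t; simp [Nat.lt_ceil]
  rw [this]
  exact Fin.card_filter_val_lt

/-- Rounding `y * M` up to an integer at most doubles it, because `y * M ≥ 1`. This is one reason
for starting the openings at `1 / M`. -/
theorem card_threshold_lt_le {M : ℕ} {y : ℝ} (hy : 1 / (M : ℝ) ≤ y) (hM : 0 < M) :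
    ((univ.filter fun t : Fin M => ((t : ℕ) : ℝ) < y * M).card : ℝ) ≤ 2 * y * M := by
  have hM' : (0 : ℝ) < M := by exact_mod_cast hM
  rw [card_threshold_lt, Nat.cast_min]
  have h1 : 1 ≤ y * M := by rwa [div_le_iff₀ hM'] at hy
  have := (Nat.ceil_lt_add_one (show 0 ≤ y * M by linarith)).le
  exact (min_le_right _ _).trans (by linarith)

theorem card_threshold_ge_le {M : ℕ} {y : ℝ} (hy1 : y ≤ 1) :
    ((univ.filter fun t : Fin M => ¬ ((t : ℕ) : ℝ) < y * M).card : ℝ) ≤ (1 - y) * M := by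
  have h := card_filter_add_card_filter_not (s := (univ : Finset (Fin M)))
    (fun t : Fin M => ((t : ℕ) : ℝ) < y * M)
  rw [card_threshold_lt, card_univ, Fintype.card_fin] at h
  have h' : ((min M ⌈y * M⌉₊ : ℕ) : ℝ) +
    ((univ.filter fun t : Fin M => ¬ ((t : ℕ) : ℝ) < y * M).card : ℝ) = M := by exact_mod_cast h
  have h2 : y * M ≤ ((min M ⌈y * M⌉₊ : ℕ) : ℝ) := by
    rw [Nat.cast_min]
    apply le_min
    · have : (0 : ℝ) ≤ M := by positivity
      nlinarith
    · exact Nat.le_ceil _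
  linarith

/-- Coordinates of a uniformly random function are independent. -/
theorem card_forall_mem {V : Type} [Fintype V] [DecidableEq V] {M : ℕ} (hM : 0 < M) (T : Finset V)
    (A : V → Finset (Fin M)) :
    ((univ.filter fun t : V → Fin M => ∀ v ∈ T, t v ∈ A v).card : ℝ) =
      Fintype.card (V → Fin M) * ∏ v ∈ T, ((A v).card / M : ℝ) := by
  have hM' : (M : ℝ) ≠ 0 := by positivity
  have h1 : (univ.filter fun t : V → Fin M => ∀ v ∈ T, t v ∈ A v) =
      Fintype.piFinset fun v => if v ∈ T then A v else univ := by
    ext t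
    simp only [mem_filter, mem_univ, true_and, Fintype.mem_piFinset]
    refine forall_congr' fun v => ?_
    split_ifs with h <;> simp [h]
  rw [h1, Fintype.card_piFinset, Fintype.card_fun, Fintype.card_fin]
  push_cast
  have h2 : ∀ v, (((if v ∈ T then A v else univ).card : ℕ) : ℝ) =
      M * (if v ∈ T then ((A v).card / M : ℝ) else 1) := by
    intro v
    split_ifs
    · field_simp
    · simp
  rw [prod_congr rfl fun v _ => h2 v, prod_mul_distrib, prod_const, card_univ, prod_ite_mem,
    univ_inter]

end Counting

/-! ### Randomized rounding -/

/-- The group `l` of unit `u` has been bought, where `t` are the random thresholds and `y` is the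
fractional opening of `u`. -/
def IsOpen {D M : ℕ} (t : U × Fin D → Fin M) (y : ℝ) (u : U) (l : ℕ) : Prop :=
  ∃ h : l < D, ((t (u, ⟨l, h⟩) : ℕ) : ℝ) < y * M

/-- The request `e` can be served by a selected unit `u`, `g` classes below its best class. -/
def CanServe {D M : ℕ} (t : U × Fin D → Fin M) (e : Request U) (P : Finset U) (y : U → ℝ) (g : ℕ)
    (u : U) : Prop :=
  u ∈ P ∧ g ≤ e.lev u ∧ (e.lev u - g = 0 ∨ IsOpen t (y u) u (e.lev u - g))

open Classical in
/-- The unit and the class by which a request is served. -/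
noncomputable def serve {D M : ℕ} (c : U → ℝ) (t : U × Fin D → Fin M) (e : Request U)
    (P : Finset U) (lam : ℝ) (y Z : U → ℝ) : Option (U × ℕ) :=
  -- Such a unit may use all its groups: their number `D` is at most `D * y u` or at most the load.
  if h : ∃ u ∈ P, 1 ≤ y u ∨ (D : ℝ) ≤ Z u then some (h.choose, e.lev h.choose)
  -- Class `0` needs no opening and here costs at most `lam`. If this rule does not apply either,
  -- the selected openings sum to at least `2`.
  else if h : ∃ u ∈ P, c u * max 1 (y u) = lam then some (h.choose, 0)
  -- The least possible shift is taken. For nonempty `P` one exists, since class `0` is always open.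
  else if h : ∃ g, ∃ u, CanServe t e P y g u then
    some ((Nat.find_spec h).choose, e.lev (Nat.find_spec h).choose - Nat.find h)
  else none

/-- The three ways in which a request is served. -/
theorem serve_cases {D M : ℕ} (c : U → ℝ) (t : U × Fin D → Fin M) (e : Request U)
    {P : Finset U} (hP : P.Nonempty) (lam : ℝ) (y Z : U → ℝ) :
    ∃ u ∈ P, ∃ l ≤ e.lev u, serve c t e P lam y Z = some (u, l) ∧
      (((1 ≤ y u ∨ (D : ℝ) ≤ Z u) ∧ l = e.lev u) ∨
      ((∀ u ∈ P, y u < 1 ∧ Z u < D) ∧ c u * max 1 (y u) = lam ∧ l = 0) ∨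
      ((∀ u ∈ P, y u < 1 ∧ Z u < D) ∧ (∀ u ∈ P, c u * max 1 (y u) ≠ lam) ∧
        (l = 0 ∨ IsOpen t (y u) u l) ∧
        ∃ g, l = e.lev u - g ∧ g ≤ e.lev u ∧ ∀ g' < g, ∀ u', ¬ CanServe t e P y g' u')) := by
  classical
  unfold serve
  by_cases h1 : ∃ u ∈ P, 1 ≤ y u ∨ (D : ℝ) ≤ Z u
  · rw [dif_pos h1]
    exact ⟨h1.choose, h1.choose_spec.1, _, le_rfl, rfl, Or.inl ⟨h1.choose_spec.2, rfl⟩⟩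
  · rw [dif_neg h1]
    have h1' : ∀ u ∈ P, y u < 1 ∧ Z u < D := by
      intro u hu
      by_contra h
      apply h1
      refine ⟨u, hu, ?_⟩
      by_contra h'
      push Not at h'
      exact h h'
    by_cases h2 : ∃ u ∈ P, c u * max 1 (y u) = lam
    · rw [dif_pos h2]
      exact ⟨h2.choose, h2.choose_spec.1, _, Nat.zero_le _, rfl,
        Or.inr (Or.inl ⟨h1', h2.choose_spec.2, rfl⟩)⟩
    · rw [dif_neg h2]
      have h3 : ∃ g, ∃ u, CanServe t e P y g u := by
        obtain ⟨u, hu⟩ := hP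
        exact ⟨e.lev u, u, hu, le_rfl, Or.inl (Nat.sub_self _)⟩
      rw [dif_pos h3]
      have hs := (Nat.find_spec h3).choose_spec
      refine ⟨_, hs.1, _, Nat.sub_le _ _, rfl, Or.inr (Or.inr ⟨h1', ?_, hs.2.2, _, rfl, hs.2.1, ?_⟩)⟩
      · intro u hu h
        exact h2 ⟨u, hu, h⟩
      · intro g' hg' u' hu'
        exact Nat.find_min h3 hg' ⟨u', hu'⟩

/-- The load that a served request puts on a unit. -/
noncomputable def useLoad (o : Option (U × ℕ)) (u : U) : ℝ :=
  o.elim 0 fun v => if v.1 = u then (1 / 2) ^ v.2 else 0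

/-- The loads of the units after the first `k` requests. -/
noncomputable def loads {D M : ℕ} (c : U → ℝ) (t : U × Fin D → Fin M) (e : ℕ → Request U) :
    ℕ → U → ℝ
  | 0 => fun _ => 0
  | k + 1 => fun u => loads c t e k u +
      useLoad (serve c t (e k) (selUnits c D M e k) (selPrice c D M e k) (frac c D M e k)
        (loads c t e k)) u

/-- The unit and the class by which the `k`-th request is served. -/
noncomputable def served {D M : ℕ} (c : U → ℝ) (t : U × Fin D → Fin M) (e : ℕ → Request U)
    (k : ℕ) : Option (U × ℕ) :=
  serve c t (e k) (selUnits c D M e k) (selPrice c D M e k) (frac c D M e k) (loads c t e k)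

/-- The classes `l ≥ 1` of the unit `u` that serve some of the first `n` requests. -/
noncomputable def usedClasses {D M : ℕ} (c : U → ℝ) (t : U × Fin D → Fin M) (e : ℕ → Request U)
    (n : ℕ) (u : U) : Finset (Fin D) :=
  open Classical in univ.filter fun l => 1 ≤ (l : ℕ) ∧ ∃ k < n, served c t e k = some (u, (l : ℕ))

/-! ### Loads and expected costs of the rounded solution -/

section Integral

variable {c : U → ℝ} {D M : ℕ} {t : U × Fin D → Fin M} {e : ℕ → Request U}

theorem useLoad_nonneg (o : Option (U × ℕ)) (u : U) : 0 ≤ useLoad o u := by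
  unfold useLoad
  cases o with
  | none => simp
  | some v => simp only [Option.elim_some]; split_ifs <;> positivity

theorem useLoad_some (v : U × ℕ) (u : U) :
    useLoad (some v) u = if v.1 = u then (1 / 2) ^ v.2 else 0 := rfl

theorem loads_succ (k : ℕ) (u : U) :
    loads c t e (k + 1) u = loads c t e k u + useLoad (served c t e k) u := rfl

theorem loads_eq_sum (k : ℕ) (u : U) :
    loads c t e k u = ∑ j ∈ range k, useLoad (served c t e j) u := by
  induction k with
  | zero => simp [loads]
  | succ k ih => rw [loads_succ, sum_range_succ, ih]

theorem loads_nonneg (k : ℕ) (u : U) : 0 ≤ loads c t e k u := by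
  rw [loads_eq_sum]; exact sum_nonneg fun _ _ => useLoad_nonneg _ _

theorem loads_mono (u : U) : Monotone fun k => loads c t e k u :=
  monotone_nat_of_le_succ fun k => by
    rw [loads_succ]; linarith [useLoad_nonneg (served c t e k) u]

theorem served_of_empty (k : ℕ) (he : (e k).elig = ∅) : served c t e k = none := by
  unfold served serve
  rw [selUnits_of_empty k he]
  simp [CanServe]

/-- The decision for a request depends only on the requests up to this one. -/
theorem served_congr {e e' : ℕ → Request U} {k : ℕ} (h : ∀ j ≤ k, e j = e' j) :
    served c t e k = served c t e' k := by
  have hfrac : ∀ j ≤ k, frac c D M e j = frac c D M e' j := by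
    intro j hj
    induction j with
    | zero => rfl
    | succ j ih =>
      simp only [frac]
      rw [ih (by omega), h j (by omega)]
  have hserve : ∀ j ≤ k, ∀ Z, serve c t (e j) (selUnits c D M e j) (selPrice c D M e j)
      (frac c D M e j) Z = serve c t (e' j) (selUnits c D M e' j) (selPrice c D M e' j)
      (frac c D M e' j) Z := by
    intro j hj Z
    simp only [selUnits, selPrice]
    rw [hfrac j hj, h j hj]
  have hloads : ∀ j ≤ k, loads c t e j = loads c t e' j := by
    intro j hj
    induction j with
    | zero => rfl
    | succ j ih =>
      simp only [loads]
      rw [hserve j (by omega), ih (by omega)]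
  unfold served
  rw [hserve k le_rfl, hloads k le_rfl]

theorem served_cases (hc : ∀ u, 0 < c u) (hM : 0 < M) {k : ℕ} (he : (e k).elig.Nonempty) :
    ∃ u ∈ selUnits c D M e k, ∃ l ≤ (e k).lev u, served c t e k = some (u, l) ∧
      (((1 ≤ frac c D M e k u ∨ (D : ℝ) ≤ loads c t e k u) ∧ l = (e k).lev u) ∨
      ((∀ u ∈ selUnits c D M e k, frac c D M e k u < 1 ∧ loads c t e k u < D) ∧
        c u * max 1 (frac c D M e k u) = selPrice c D M e k ∧ l = 0) ∨
      ((∀ u ∈ selUnits c D M e k, frac c D M e k u < 1 ∧ loads c t e k u < D) ∧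
        (∀ u ∈ selUnits c D M e k, c u * max 1 (frac c D M e k u) ≠ selPrice c D M e k) ∧
        (l = 0 ∨ IsOpen t (frac c D M e k u) u l) ∧
        ∃ g, l = (e k).lev u - g ∧ g ≤ (e k).lev u ∧
          ∀ g' < g, ∀ u', ¬ CanServe t (e k) (selUnits c D M e k) (frac c D M e k) g' u')) :=
  serve_cases c t (e k) (isSelection hc hM k he).nonempty _ _ _

theorem served_spec (hc : ∀ u, 0 < c u) (hM : 0 < M) {k : ℕ} (he : (e k).elig.Nonempty) :
    ∃ u ∈ (e k).elig, ∃ l ≤ (e k).lev u, served c t e k = some (u, l) := by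
  obtain ⟨u, hu, l, hl, h, -⟩ := served_cases (t := t) hc hM he
  exact ⟨u, (isSelection hc hM k he).subset hu, l, hl, h⟩

/-- The load of every unit is bounded. -/
theorem loads_le (hc : ∀ u, 0 < c u) (hM : 0 < M) (n : ℕ) (u : U) :
    loads c t e n u ≤ D + 1 +
      ∑ j ∈ range n, if u ∈ selUnits c D M e j then (1 / 2 : ℝ) ^ (e j).lev u else 0 := by
  induction n with
  | zero => simp only [loads, range_zero, sum_empty]; positivity
  | succ n ih =>
    rw [loads_succ, sum_range_succ]
    have hnn : (0 : ℝ) ≤ ∑ j ∈ range n,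
        if u ∈ selUnits c D M e j then (1 / 2 : ℝ) ^ (e j).lev u else 0 :=
      sum_nonneg fun _ _ => by split_ifs <;> positivity
    have hnn' : (0 : ℝ) ≤ if u ∈ selUnits c D M e n then (1 / 2 : ℝ) ^ (e n).lev u else 0 := by
      split_ifs <;> positivity
    rcases (e n).elig.eq_empty_or_nonempty with he | he
    · rw [served_of_empty n he]
      simp only [useLoad, Option.elim_none]
      linarith
    · obtain ⟨v, hv, l, hl, h, hcase⟩ := served_cases (t := t) hc hM he
      rw [h, useLoad_some]
      by_cases hvu : v = u
      · subst hvu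
        rw [if_pos rfl]
        -- The last two rules of `serve` act only while the load is below `D` and add at most `1`.
        -- Requests under the first rule add `2 ^ (-lev v)`, which is counted in the sum.
        have hsmall : loads c t e n v < D → loads c t e n v + (1 / 2 : ℝ) ^ l ≤ D + 1 := by
          intro h
          have : (1 / 2 : ℝ) ^ l ≤ 1 := pow_le_one₀ (by norm_num) (by norm_num)
          linarith
        rcases hcase with ⟨_, rfl⟩ | ⟨h1, _⟩ | ⟨h1, _⟩
        · rw [if_pos hv]; linarith
        · have := hsmall (h1 v hv).2
          simp only; linarith
        · have := hsmall (h1 v hv).2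
          simp only; linarith
      · simp only [hvu, if_false]; linarith

/-- The number of bought classes of a unit. -/
theorem card_usedClasses_le (hc : ∀ u, 0 < c u) (hM : 0 < M) (n : ℕ) (u : U) :
    ((usedClasses c t e n u).card : ℝ) ≤ D * frac c D M e n u + loads c t e n u +
      ∑ l : Fin D, if ((t (u, l) : ℕ) : ℝ) < frac c D M e n u * M then (1 : ℝ) else 0 := by
  classical
  have hy := frac_pos (D := D) (e := e) hc hM n u
  have hZ := loads_nonneg (c := c) (t := t) (e := e) n u
  have hnn : (0 : ℝ) ≤ ∑ l : Fin D,
      if ((t (u, l) : ℕ) : ℝ) < frac c D M e n u * M then (1 : ℝ) else 0 :=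
    sum_nonneg fun _ _ => by split_ifs <;> norm_num
  have hD : ((usedClasses c t e n u).card : ℝ) ≤ D := by
    have := card_le_univ (usedClasses c t e n u)
    rw [Fintype.card_fin] at this
    exact_mod_cast this
  have hDy : 0 ≤ D * frac c D M e n u := by positivity
  by_cases h1 : 1 ≤ frac c D M e n u
  · have : (D : ℝ) ≤ D * frac c D M e n u := le_mul_of_one_le_right (by positivity) h1
    linarith
  by_cases h2 : (D : ℝ) ≤ loads c t e n u
  · linarith
  -- If `y u < 1` and the load is below `D` at the end, this held at all times by monotonicity. So
  -- each used class `l ≥ 1` came from an open group, and open groups stay open as `y` grows.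
  have hsub : usedClasses c t e n u ⊆
      univ.filter fun l : Fin D => ((t (u, l) : ℕ) : ℝ) < frac c D M e n u * M := by
    intro l hl
    simp only [usedClasses, mem_filter, mem_univ, true_and] at hl ⊢
    obtain ⟨hl1, k, hk, hs⟩ := hl
    have hky := frac_mono (D := D) (e := e) hc hM u hk.le
    have hkZ := loads_mono (c := c) (t := t) (e := e) u hk.le
    have he : (e k).elig.Nonempty := by
      rw [nonempty_iff_ne_empty]
      intro he
      rw [served_of_empty k he] at hs
      simp at hs
    obtain ⟨v, hv, l', hl', h, hcase⟩ := served_cases (t := t) hc hM he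
    rw [h] at hs
    simp only [Option.some.injEq, Prod.mk.injEq] at hs
    obtain ⟨rfl, rfl⟩ := hs
    rcases hcase with ⟨h3, _⟩ | ⟨_, _, h3⟩ | ⟨_, _, h3, _⟩
    · exfalso
      rcases h3 with h3 | h3
      · exact h1 (h3.trans hky)
      · exact h2 (h3.trans hkZ)
    · omega
    · rcases h3 with h3 | ⟨_, h3⟩
      · omega
      · refine lt_of_lt_of_le h3 ?_
        have hM' : (0 : ℝ) ≤ M := by positivity
        exact mul_le_mul_of_nonneg_right hky hM'
  have h3 : ((usedClasses c t e n u).card : ℝ) ≤ ∑ l : Fin D,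
      if ((t (u, l) : ℕ) : ℝ) < frac c D M e n u * M then (1 : ℝ) else 0 := by
    rw [sum_boole]
    exact_mod_cast card_le_card hsub
  linarith

/-- The cost of serving a request. -/
noncomputable def useCost (c : U → ℝ) (o : Option (U × ℕ)) : ℝ := ∑ u, c u * useLoad o u

theorem useCost_some (v : U × ℕ) : useCost c (some v) = c v.1 * (1 / 2) ^ v.2 := by
  unfold useCost
  simp [useLoad_some]

/-- No unit of `P` can serve the request at one of the first `g` shifts. -/
def Misses (t : U × Fin D → Fin M) (e : Request U) (P : Finset U) (y : U → ℝ) (g : ℕ) : Prop :=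
  ∀ g' < g, ∀ u, ¬ CanServe t e P y g' u

-- The shift `g` multiplies the price of the best class by `2 ^ g`, and its term occurs in the sum
-- because all smaller shifts were missed. The first two rules of `serve` cost at most `selPrice`.
-- The loads depend on the thresholds in a complicated way, but in this bound only `Misses` does,
-- since the fractional state is deterministic.
open Classical in
theorem useCost_served_le (hc : ∀ u, 0 < c u) (hM : 0 < M) (k : ℕ)
    (hlev : ∀ u ∈ (e k).elig, (e k).lev u < D) :
    useCost c (served c t e k) ≤ selPrice c D M e k * (1 + ∑ g ∈ Ico 1 D,
      if (2 ≤ ∑ u ∈ selUnits c D M e k, frac c D M e k u ∧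
          ∀ u ∈ selUnits c D M e k, frac c D M e k u < 1) ∧
        Misses t (e k) (selUnits c D M e k) (frac c D M e k) g then (2 : ℝ) ^ g else 0) := by
  have hnn : (0 : ℝ) ≤ ∑ g ∈ Ico 1 D,
      if (2 ≤ ∑ u ∈ selUnits c D M e k, frac c D M e k u ∧
          ∀ u ∈ selUnits c D M e k, frac c D M e k u < 1) ∧
        Misses t (e k) (selUnits c D M e k) (frac c D M e k) g then (2 : ℝ) ^ g else 0 :=
    sum_nonneg fun _ _ => by split_ifs <;> positivity
  rcases (e k).elig.eq_empty_or_nonempty with he | he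
  · rw [served_of_empty k he, selPrice_of_empty k he]
    simp [useCost, useLoad]
  obtain ⟨u, hu, l, hl, h, hcase⟩ := served_cases (t := t) hc hM he
  have hs := isSelection (D := D) hc hM k he
  have hlam := hs.pos
  have hcu := hc u
  rw [h, useCost_some]
  have hpr : c u * (1 / 2) ^ (e k).lev u ≤ selPrice c D M e k := by
    refine le_trans ?_ (hs.le_lam u hu)
    unfold unitPrice
    rw [one_div, inv_pow, ← div_eq_mul_inv]
    exact le_mul_of_one_le_right (by positivity) (le_max_left _ _)
  have h0 : selPrice c D M e k ≤ selPrice c D M e k * (1 + ∑ g ∈ Ico 1 D,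
      if (2 ≤ ∑ u ∈ selUnits c D M e k, frac c D M e k u ∧
          ∀ u ∈ selUnits c D M e k, frac c D M e k u < 1) ∧
        Misses t (e k) (selUnits c D M e k) (frac c D M e k) g then (2 : ℝ) ^ g else 0) :=
    le_mul_of_one_le_right hlam.le (by linarith)
  rcases hcase with ⟨_, rfl⟩ | ⟨_, h2, rfl⟩ | ⟨h1, h2, _, g, rfl, hg, hmiss⟩
  · exact hpr.trans h0
  · refine le_trans ?_ h0
    rw [← h2, pow_zero]
    gcongr
    exact le_max_left _ _
  · have hpow : (1 / 2 : ℝ) ^ ((e k).lev u - g) = (1 / 2) ^ (e k).lev u * 2 ^ g := by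
      have : (1 / 2 : ℝ) ^ (e k).lev u = (1 / 2) ^ ((e k).lev u - g) * (1 / 2) ^ g := by
        rw [← pow_add]; congr 1; omega
      rw [this, mul_assoc, ← mul_pow]
      norm_num
    rw [hpow]
    rcases Nat.eq_zero_or_pos g with rfl | hgpos
    · simpa using hpr.trans h0
    · have hgD : g ∈ Ico 1 D := by
        have := hlev u (hs.subset hu)
        simp; omega
      have hcond : (2 ≤ ∑ u ∈ selUnits c D M e k, frac c D M e k u ∧
          ∀ u ∈ selUnits c D M e k, frac c D M e k u < 1) ∧
        Misses t (e k) (selUnits c D M e k) (frac c D M e k) g := by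
        refine ⟨⟨?_, fun u hu => (h1 u hu).1⟩, hmiss⟩
        rcases hs.cover with h3 | ⟨u', hu', h3⟩
        · rw [sum_congr rfl fun u hu => ?_] at h3
          · exact h3
          · unfold fracWeight
            rw [if_pos (h1 u hu).1]
        · exact absurd h3 (h2 u' hu')
      have h3 := single_le_sum (f := fun g =>
        if (2 ≤ ∑ u ∈ selUnits c D M e k, frac c D M e k u ∧
          ∀ u ∈ selUnits c D M e k, frac c D M e k u < 1) ∧
        Misses t (e k) (selUnits c D M e k) (frac c D M e k) g then (2 : ℝ) ^ g else 0)
        (fun g _ => by split_ifs <;> positivity) hgD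
      simp only [if_pos hcond] at h3
      calc c u * ((1 / 2) ^ (e k).lev u * 2 ^ g) = c u * (1 / 2) ^ (e k).lev u * 2 ^ g := by ring
        _ ≤ selPrice c D M e k * 2 ^ g := by gcongr
        _ ≤ _ := by gcongr; linarith

open Classical in
/-- Missing all the first `g` shifts is exponentially unlikely. -/
theorem card_misses_le (hM : 0 < M) (e : Request U) (P : Finset U) (y : U → ℝ)
    (hlev : ∀ u ∈ P, e.lev u < D) (hy1 : ∀ u ∈ P, y u < 1) (hy2 : 2 ≤ ∑ u ∈ P, y u)
    (g : ℕ) :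
    ((univ.filter fun t : U × Fin D → Fin M => Misses t e P y g).card : ℝ) ≤
      Fintype.card (U × Fin D → Fin M) * (1 / 4) ^ g := by
  have hM' : (0 : ℝ) < M := by exact_mod_cast hM
  -- For such a `u`, class `0` lies within the first `g` shifts, so they cannot all be missed.
  by_cases hbig : ∃ u ∈ P, e.lev u < g
  · obtain ⟨u, hu, hug⟩ := hbig
    have : (univ.filter fun t : U × Fin D → Fin M => Misses t e P y g) = ∅ := by
      rw [filter_eq_empty_iff]
      intro t _ hm
      exact hm _ hug u ⟨hu, le_rfl, Or.inl (Nat.sub_self _)⟩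
    rw [this]
    simp only [card_empty, Nat.cast_zero]
    positivity
  push Not at hbig
  -- A miss forces the `g` groups with classes in `(lev u - g, lev u]` to be closed for every `u ∈
  -- P`. By independence this has probability at most `∏ (1 - y u) ^ g ≤ exp (-g * ∑ y u) ≤ exp (-2
  -- * g)`.
  set T : Finset (U × Fin D) := univ.filter fun v =>
    v.1 ∈ P ∧ e.lev v.1 - g < (v.2 : ℕ) ∧ (v.2 : ℕ) ≤ e.lev v.1 with hT
  set A : U × Fin D → Finset (Fin M) := fun v =>
    univ.filter fun s : Fin M => ¬ ((s : ℕ) : ℝ) < y v.1 * M with hA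
  have hsub : (univ.filter fun t : U × Fin D → Fin M => Misses t e P y g) ⊆
      univ.filter fun t : U × Fin D → Fin M => ∀ v ∈ T, t v ∈ A v := by
    intro t ht
    simp only [mem_filter, mem_univ, true_and, hT, hA] at ht ⊢
    rintro ⟨u, l⟩ ⟨hu, hl1, hl2⟩ hlt
    simp only at hu hl1 hl2 hlt
    refine ht (e.lev u - l) (by omega) u ⟨hu, Nat.sub_le _ _, Or.inr ?_⟩
    have hle : e.lev u - (e.lev u - (l : ℕ)) = l := by omega
    rw [hle]
    exact ⟨l.2, hlt⟩
  have h1 : ((univ.filter fun t : U × Fin D → Fin M => Misses t e P y g).card : ℝ) ≤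
      (univ.filter fun t : U × Fin D → Fin M => ∀ v ∈ T, t v ∈ A v).card := by
    exact_mod_cast card_le_card hsub
  refine h1.trans ?_
  rw [card_forall_mem hM]
  gcongr
  have h2 : ∀ v ∈ T, ((A v).card / M : ℝ) ≤ Real.exp (- y v.1) := by
    intro v hv
    have hvP : v.1 ∈ P := (mem_filter.1 hv).2.1
    rw [div_le_iff₀ hM']
    refine (card_threshold_ge_le (hy1 _ hvP).le).trans ?_
    gcongr
    have := Real.add_one_le_exp (- y v.1)
    linarith
  have h3 : ∏ v ∈ T, ((A v).card / M : ℝ) ≤ ∏ v ∈ T, Real.exp (- y v.1) :=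
    prod_le_prod (fun v _ => by positivity) h2
  refine h3.trans ?_
  rw [← Real.exp_sum, sum_neg_distrib]
  have h4 : ∑ v ∈ T, y v.1 = g * ∑ u ∈ P, y u := by
    have e1 : T = P.biUnion fun u => (univ.filter fun l : Fin D =>
        e.lev u - g < (l : ℕ) ∧ (l : ℕ) ≤ e.lev u).image fun l => (u, l) := by
      ext ⟨u, l⟩
      simp only [hT, mem_filter, mem_univ, true_and, mem_biUnion, mem_image, Prod.mk.injEq]
      constructor
      · rintro ⟨h1, h2, h3⟩; exact ⟨u, h1, l, ⟨h2, h3⟩, rfl, rfl⟩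
      · rintro ⟨u', h1, l', ⟨h2, h3⟩, rfl, rfl⟩; exact ⟨h1, h2, h3⟩
    rw [e1, sum_biUnion]
    · rw [mul_sum]
      apply sum_congr rfl
      intro u hu
      rw [sum_image (by intro a _ b _ h; simpa using h)]
      simp only [sum_const, nsmul_eq_mul]
      congr 1
      have hul := hlev u hu
      have hug := hbig u hu
      have e2 : (univ.filter fun l : Fin D => e.lev u - g < (l : ℕ) ∧ (l : ℕ) ≤ e.lev u) =
          Ioc (⟨e.lev u - g, by omega⟩ : Fin D) ⟨e.lev u, hul⟩ := by
        ext l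
        simp [Fin.lt_def, Fin.le_def]
      rw [e2, Fin.card_Ioc]
      simp only
      congr 1
      omega
    · intro u _ u' _ hne
      simp only [Function.onFun]
      rw [disjoint_left]
      rintro ⟨a, l⟩ h1 h2
      simp only [mem_image, Prod.mk.injEq] at h1 h2
      obtain ⟨_, _, rfl, _⟩ := h1
      obtain ⟨_, _, h, _⟩ := h2
      exact hne h.symm
  rw [h4]
  have h5 : Real.exp (-(g * ∑ u ∈ P, y u)) ≤ Real.exp (g * (-2)) := by
    apply Real.exp_le_exp.2
    have : (0 : ℝ) ≤ g := by positivity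
    nlinarith
  refine h5.trans ?_
  rw [Real.exp_nat_mul]
  gcongr
  rw [Real.exp_neg, one_div]
  apply inv_anti₀ (by norm_num)
  have h6 := Real.add_one_le_exp (1 : ℝ)
  have h7 : Real.exp 2 = Real.exp 1 * Real.exp 1 := by rw [← Real.exp_add]; norm_num
  rw [h7]
  nlinarith

/-- A shift `g ≥ 1` contributes at most `2 ^ g * 4 ^ (-g)`; these terms sum to at most `1`, and the
best class itself accounts for the other `1`. -/
theorem sum_useCost_served_le (hc : ∀ u, 0 < c u) (hM : 0 < M) (k : ℕ)
    (hlev : ∀ u ∈ (e k).elig, (e k).lev u < D) :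
    ∑ t : U × Fin D → Fin M, useCost c (served c t e k) ≤
      Fintype.card (U × Fin D → Fin M) * (2 * selPrice c D M e k) := by
  classical
  have hlam := selPrice_nonneg (D := D) (e := e) hc hM k
  refine (sum_le_sum fun t _ => useCost_served_le hc hM k hlev).trans ?_
  rw [← mul_sum, sum_add_distrib, sum_comm]
  simp only [sum_const, card_univ, nsmul_eq_mul, mul_one]
  have key : ∀ g ∈ Ico 1 D, (∑ t : U × Fin D → Fin M,
      if (2 ≤ ∑ u ∈ selUnits c D M e k, frac c D M e k u ∧
          ∀ u ∈ selUnits c D M e k, frac c D M e k u < 1) ∧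
        Misses t (e k) (selUnits c D M e k) (frac c D M e k) g then (2 : ℝ) ^ g else 0) ≤
      Fintype.card (U × Fin D → Fin M) * (1 / 2) ^ g := by
    intro g _
    by_cases h : 2 ≤ ∑ u ∈ selUnits c D M e k, frac c D M e k u ∧
          ∀ u ∈ selUnits c D M e k, frac c D M e k u < 1
    · simp only [and_iff_right h]
      rw [← sum_filter, sum_const, nsmul_eq_mul]
      have hlev' : ∀ u ∈ selUnits c D M e k, (e k).lev u < D := by
        intro u hu
        exact hlev u ((isSelection hc hM k (elig_nonempty_of_mem hu)).subset hu)
      have h1 := card_misses_le (D := D) hM (e k) _ _ hlev' h.2 h.1 g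
      calc _ ≤ Fintype.card (U × Fin D → Fin M) * (1 / 4) ^ g * (2 : ℝ) ^ g := by gcongr
        _ = _ := by rw [mul_assoc, ← mul_pow]; norm_num
    · simp only [h, false_and, if_false, sum_const_zero]
      positivity
  have hgeo : ∑ g ∈ Ico 1 D, (1 / 2 : ℝ) ^ g ≤ 1 := by
    rcases Nat.eq_zero_or_pos D with rfl | hD
    · simp
    · have h1 := sum_range_add_sum_Ico (fun g => (1 / 2 : ℝ) ^ g) (show 1 ≤ D from hD)
      rw [sum_range_one, pow_zero] at h1
      have h2 := sum_geometric_two_le D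
      linarith
  have h2 := sum_le_sum key
  rw [← mul_sum] at h2
  have h3 : (Fintype.card (U × Fin D → Fin M) : ℝ) * ∑ g ∈ Ico 1 D, (1 / 2 : ℝ) ^ g ≤
      Fintype.card (U × Fin D → Fin M) * 1 := by gcongr
  nlinarith

theorem sum_isOpen_le (hM : 0 < M) {y : ℝ} (hy : 1 / (M : ℝ) ≤ y) (u : U) :
    ∑ t : U × Fin D → Fin M, ∑ l : Fin D,
      (if ((t (u, l) : ℕ) : ℝ) < y * M then (1 : ℝ) else 0) ≤
      Fintype.card (U × Fin D → Fin M) * (2 * (D * y)) := by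
  have hM' : (0 : ℝ) < M := by exact_mod_cast hM
  rw [sum_comm]
  have key : ∀ l : Fin D, ∑ t : U × Fin D → Fin M,
      (if ((t (u, l) : ℕ) : ℝ) < y * M then (1 : ℝ) else 0) ≤
      Fintype.card (U × Fin D → Fin M) * (2 * y) := by
    intro l
    rw [sum_boole]
    have h := card_forall_mem hM {(u, l)} fun _ : U × Fin D =>
      univ.filter fun s : Fin M => ((s : ℕ) : ℝ) < y * M
    simp only [mem_singleton, forall_eq, mem_filter, mem_univ, true_and, prod_singleton] at h
    rw [h]
    gcongr
    rw [div_le_iff₀ hM']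
    exact card_threshold_lt_le hy hM
  refine (sum_le_sum fun l _ => key l).trans ?_
  simp only [sum_const, card_univ, Fintype.card_fin, nsmul_eq_mul]
  apply le_of_eq; ring

/-- The total load of a unit, including the bought classes. -/
noncomputable def totalLoad (c : U → ℝ) (t : U × Fin D → Fin M) (e : ℕ → Request U) (n : ℕ)
    (u : U) : ℝ := loads c t e n u + (usedClasses c t e n u).card

/-- The loads count twice, directly and through the number of used classes, each time with
expectation at most `2 * selPrice` per request. The openings count once for full units and twice for
the expected number of open groups. -/
theorem sum_totalLoad_le (hc : ∀ u, 0 < c u) (hM : 0 < M) (n : ℕ)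
    (hlev : ∀ k, ∀ u ∈ (e k).elig, (e k).lev u < D) :
    ∑ t : U × Fin D → Fin M, ∑ u, c u * totalLoad c t e n u ≤
      Fintype.card (U × Fin D → Fin M) *
        (4 * ∑ k ∈ range n, selPrice c D M e k + 3 * (D * ∑ u, c u * frac c D M e n u)) := by
  have hZ : ∑ t : U × Fin D → Fin M, ∑ u, c u * loads c t e n u ≤
      Fintype.card (U × Fin D → Fin M) * (2 * ∑ k ∈ range n, selPrice c D M e k) := by
    have e1 : ∀ t : U × Fin D → Fin M, ∑ u, c u * loads c t e n u =
        ∑ k ∈ range n, useCost c (served c t e k) := by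
      intro t
      simp only [loads_eq_sum, useCost, mul_sum]
      rw [sum_comm]
    rw [sum_congr rfl fun t _ => e1 t, sum_comm]
    refine (sum_le_sum fun k _ => sum_useCost_served_le hc hM k (hlev k)).trans ?_
    rw [mul_sum, mul_sum]
  have hO : ∑ t : U × Fin D → Fin M, ∑ u, c u * ∑ l : Fin D,
      (if ((t (u, l) : ℕ) : ℝ) < frac c D M e n u * M then (1 : ℝ) else 0) ≤
      Fintype.card (U × Fin D → Fin M) * (2 * (D * ∑ u, c u * frac c D M e n u)) := by
    rw [sum_comm]
    have h : ∀ u, ∑ t : U × Fin D → Fin M, c u * ∑ l : Fin D,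
        (if ((t (u, l) : ℕ) : ℝ) < frac c D M e n u * M then (1 : ℝ) else 0) ≤
        c u * (Fintype.card (U × Fin D → Fin M) * (2 * (D * frac c D M e n u))) := by
      intro u
      rw [← mul_sum]
      have := hc u
      gcongr
      exact sum_isOpen_le hM (inv_le_frac hc hM n u) u
    refine (sum_le_sum fun u _ => h u).trans (le_of_eq ?_)
    simp only [mul_sum]
    apply sum_congr rfl; intro u _; ring
  have hX : ∀ t : U × Fin D → Fin M, ∑ u, c u * totalLoad c t e n u ≤
      2 * ∑ u, c u * loads c t e n u + D * ∑ u, c u * frac c D M e n u +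
      ∑ u, c u * ∑ l : Fin D,
      (if ((t (u, l) : ℕ) : ℝ) < frac c D M e n u * M then (1 : ℝ) else 0) := by
    intro t
    rw [mul_sum, mul_sum, ← sum_add_distrib, ← sum_add_distrib]
    apply sum_le_sum
    intro u _
    have h1 := card_usedClasses_le (t := t) (e := e) hc hM n u
    have h2 := mul_le_mul_of_nonneg_left h1 (hc u).le
    unfold totalLoad
    linarith
  refine (sum_le_sum fun t _ => hX t).trans ?_
  rw [sum_add_distrib, sum_add_distrib, ← mul_sum, sum_const, card_univ, nsmul_eq_mul]
  nlinarith

theorem log_two_mul_le {M : ℕ} (hM : 2 ≤ M) : Real.log (2 * M) ≤ 2 * Real.log M := by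
  have hM' : (2 : ℝ) ≤ M := by exact_mod_cast hM
  rw [Real.log_mul (by norm_num) (by linarith)]
  have := Real.log_le_log two_pos hM'
  linarith

/-- Guarantees of the randomized algorithm against a reference solution that serves request `k` by
the unit `v k`. -/
theorem totalLoad_bounds (hc0 : ∀ u, 1 / (M : ℝ) ≤ c u) (hc1 : ∀ u, c u ≤ 1) (hM : 2 ≤ M)
    (hU : Fintype.card U ≤ M) (hD : 0 < D) {n : ℕ} {K : ℝ} (hK : 1 ≤ K) (hKM : K ≤ M)
    (hlev : ∀ k, ∀ u ∈ (e k).elig, (e k).lev u < D) (v : ℕ → U)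
    (V : Finset U) (hv : ∀ k < n, (e k).elig.Nonempty → v k ∈ (e k).elig ∧ v k ∈ V)
    (hV : ∑ u ∈ V, c u ≤ K)
    (hload : ∀ u, ∑ k ∈ (range n).filter (fun k => (e k).elig.Nonempty ∧ v k = u),
      (1 / 2 : ℝ) ^ (e k).lev u ≤ 2 * D) :
    (∀ t : U × Fin D → Fin M, ∀ u, totalLoad c t e n u ≤ 1000 * D * Real.log M) ∧
    ∑ t : U × Fin D → Fin M, ∑ u, c u * totalLoad c t e n u ≤
      Fintype.card (U × Fin D → Fin M) * (1000 * D * Real.log M * K) := by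
  have hM0 : 0 < M := by omega
  have hM' : (2 : ℝ) ≤ M := by exact_mod_cast hM
  have hMpos : (0 : ℝ) < M := by linarith
  have hc : ∀ u, 0 < c u := fun u => lt_of_lt_of_le (by positivity) (hc0 u)
  have hD' : (1 : ℝ) ≤ D := by exact_mod_cast hD
  have hlam := sum_selPrice_le (e := e) hc hc1 hM hU hD hK v V hv hV hload
  have hPhi := sum_cost_frac_le (e := e) hc hc1 hM0 hU hD n
  have hlog2 := log_two_mul_le hM
  have hlogM : 1 / 2 ≤ Real.log M := by
    have h1 := Real.log_le_log two_pos hM'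
    have := Real.log_two_gt_d9
    linarith
  have hDK : (D : ℝ) ≤ 2 * (D * K * Real.log M) := by nlinarith [mul_nonneg (show (0 : ℝ) ≤ D by positivity) (show 0 ≤ K by linarith), mul_le_mul hK hlogM (by norm_num) (by linarith)]
  have hlam' : ∑ k ∈ range n, selPrice c D M e k ≤ 144 * (D * K * Real.log M) := by
    have : 72 * D * K * Real.log (2 * M) ≤ 72 * D * K * (2 * Real.log M) := by gcongr
    linarith
  have hPhi' : D * ∑ u, c u * frac c D M e n u ≤ 38 * (D * K * Real.log M) := by linarith
  constructor
  · intro t u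
    have h1 := loads_le (t := t) (e := e) hc hM0 n u
    have h2 := active_le (e := e) hc hM0 hD n u
    have h3 : ((usedClasses c t e n u).card : ℝ) ≤ D := by
      have := card_le_univ (usedClasses c t e n u)
      rw [Fintype.card_fin] at this
      exact_mod_cast this
    have hy := frac_pos (D := D) (e := e) hc hM0 n u
    have h4 : c u * frac c D M e n u ≤ ∑ u, c u * frac c D M e n u :=
      single_le_sum (f := fun u => c u * frac c D M e n u)
        (fun u _ => mul_nonneg (hc u).le (frac_pos hc hM0 n u).le) (mem_univ u)
    have h5 : c u * frac c D M e n u ≤ 38 * (K * Real.log M) := by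
      have h6 : D * (c u * frac c D M e n u) ≤ D * (38 * (K * Real.log M)) := by
        calc _ ≤ D * ∑ u, c u * frac c D M e n u := by gcongr
          _ ≤ _ := by linarith
      exact le_of_mul_le_mul_left h6 (by linarith)
    have h7 : frac c D M e n u ≤ 38 * (K * Real.log M) * M := by
      have h8 : 1 / (M : ℝ) * frac c D M e n u ≤ 38 * (K * Real.log M) :=
        (mul_le_mul_of_nonneg_right (hc0 u) hy.le).trans h5
      rw [one_div, inv_mul_le_iff₀ hMpos] at h8
      linarith
    have hlogle : Real.log M ≤ M := (Real.log_le_sub_one_of_pos hMpos).trans (by linarith)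
    -- Prices of at least `1 / M` keep the openings polynomial in `M`, so `log (M * y)` is of order
    -- `log M`. Here `38 ≤ 64 = 2 ^ 6 ≤ M ^ 6`, while `K` and `log M` are at most `M`.
    have h9 : M * frac c D M e n u ≤ (M : ℝ) ^ 10 := by
      calc M * frac c D M e n u ≤ M * (38 * (K * Real.log M) * M) := by gcongr
        _ ≤ M * (64 * (M * M) * M) := by gcongr; norm_num
        _ = 2 ^ 6 * (M : ℝ) ^ 4 := by ring
        _ ≤ (M : ℝ) ^ 6 * (M : ℝ) ^ 4 := by gcongr
        _ = _ := by ring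
    have h10 : Real.log (M * frac c D M e n u) ≤ 10 * Real.log M := by
      refine (Real.log_le_log (by positivity) h9).trans ?_
      rw [Real.log_pow]; norm_num
    have h11 : 32 * D * Real.log (M * frac c D M e n u) ≤ 32 * D * (10 * Real.log M) := by
      gcongr
    have h12 : (D : ℝ) ≤ 2 * (D * Real.log M) := by nlinarith
    unfold totalLoad
    linarith
  · refine (sum_totalLoad_le (e := e) hc hM0 n hlev).trans ?_
    gcongr
    have h0 : 0 ≤ D * K * Real.log M := by positivity
    linarith

end Integral

end Units

/-! ### Monotone symmetric norms and indicator vectors -/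

section Norm

variable {ι : Type} {N : (ι → ℝ) → ℝ}

namespace IsMonotoneSymmetricNorm

theorem map_zero (h : IsMonotoneSymmetricNorm N) : N 0 = 0 := by
  have := h.smul 0 0
  simpa using this

theorem nonneg (h : IsMonotoneSymmetricNorm N) (x : ι → ℝ) : 0 ≤ N x := by
  have h1 := h.add_le x (-x)
  have h2 := h.smul (-1) x
  rw [add_neg_cancel, h.map_zero] at h1
  simp only [neg_smul, one_smul, abs_neg, abs_one, one_mul] at h2
  linarith

theorem smul_of_nonneg (h : IsMonotoneSymmetricNorm N) {a : ℝ} (ha : 0 ≤ a) (x : ι → ℝ) :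
    N (a • x) = a * N x := by
  rw [h.smul, abs_of_nonneg ha]

theorem sum_le (h : IsMonotoneSymmetricNorm N) {κ : Type*} (s : Finset κ) (x : κ → ι → ℝ) :
    N (∑ k ∈ s, x k) ≤ ∑ k ∈ s, N (x k) := by
  classical
  induction s using Finset.induction_on with
  | empty => simp [h.map_zero]
  | insert a s ha ih =>
    rw [sum_insert ha, sum_insert ha]
    exact (h.add_le _ _).trans (by gcongr)

end IsMonotoneSymmetricNorm

variable [Fintype ι] [DecidableEq ι]

/-- The indicator vector of a set. -/
def indicatorVec (A : Finset ι) : ι → ℝ := fun x => if x ∈ A then 1 else 0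

theorem indicatorVec_nonneg (A : Finset ι) : 0 ≤ indicatorVec A := by
  intro x
  simp only [indicatorVec, Pi.zero_apply]
  split_ifs <;> norm_num

theorem norm_indicatorVec_congr (h : IsMonotoneSymmetricNorm N) {A B : Finset ι}
    (hAB : A.card = B.card) : N (indicatorVec A) = N (indicatorVec B) := by
  have e : {x // x ∈ A} ≃ {x // x ∈ B} := Finset.equivOfCardEq hAB
  set σ : Equiv.Perm ι := e.extendSubtype with hσ
  have h1 : indicatorVec B ∘ σ = indicatorVec A := by
    funext x
    simp only [indicatorVec, Function.comp_apply]
    by_cases hx : x ∈ A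
    · rw [if_pos hx, if_pos (e.extendSubtype_mem x hx)]
    · rw [if_neg hx, if_neg (e.extendSubtype_not_mem x hx)]
  rw [← h1, h.symmetric]

/-- The norm of the indicator vectors of the sets of size `b`. -/
noncomputable def fund (N : (ι → ℝ) → ℝ) (b : ℕ) : ℝ :=
  open Classical in
  -- Beyond the dimension the value is `0`, hence the cardinality bounds in the lemmas on
  -- monotonicity and subadditivity.
  if h : ∃ A : Finset ι, A.card = b then N (indicatorVec h.choose) else 0

theorem norm_indicatorVec (h : IsMonotoneSymmetricNorm N) (A : Finset ι) :
    N (indicatorVec A) = fund N A.card := by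
  have hA : ∃ B : Finset ι, B.card = A.card := ⟨A, rfl⟩
  unfold fund
  rw [dif_pos hA]
  exact norm_indicatorVec_congr h hA.choose_spec.symm

theorem fund_nonneg (h : IsMonotoneSymmetricNorm N) (b : ℕ) : 0 ≤ fund N b := by
  unfold fund
  split_ifs
  · exact h.nonneg _
  · exact le_rfl

theorem fund_pos (h : IsMonotoneSymmetricNorm N) {b : ℕ} (hb : 0 < b)
    (hbι : b ≤ Fintype.card ι) : 0 < fund N b := by
  obtain ⟨A, -, hA⟩ := exists_subset_card_eq (s := (univ : Finset ι)) (n := b) (by rwa [card_univ])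
  rw [← hA, ← norm_indicatorVec h]
  refine lt_of_le_of_ne (h.nonneg _) fun h0 => ?_
  have := h.definite _ h0.symm
  obtain ⟨x, hx⟩ := card_pos.1 (hA ▸ hb)
  have h1 := congrFun this x
  simp [indicatorVec, hx] at h1

theorem norm_indicatorVec_mono (h : IsMonotoneSymmetricNorm N) {A B : Finset ι}
    (hAB : A ⊆ B) : N (indicatorVec A) ≤ N (indicatorVec B) := by
  apply h.monotone _ _ (indicatorVec_nonneg A)
  intro x
  simp only [indicatorVec]
  by_cases hx : x ∈ A
  · rw [if_pos hx, if_pos (hAB hx)]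
  · rw [if_neg hx]; split_ifs <;> norm_num

theorem fund_mono (h : IsMonotoneSymmetricNorm N) {a b : ℕ} (hab : a ≤ b)
    (hb : b ≤ Fintype.card ι) : fund N a ≤ fund N b := by
  obtain ⟨B, -, hB⟩ := exists_subset_card_eq (s := (univ : Finset ι)) (n := b) (by rwa [card_univ])
  obtain ⟨A, hAB, hA⟩ := exists_subset_card_eq (s := B) (n := a) (by omega)
  rw [← hA, ← hB, ← norm_indicatorVec h, ← norm_indicatorVec h]
  exact norm_indicatorVec_mono h hAB

theorem fund_add_le (h : IsMonotoneSymmetricNorm N) {a b : ℕ} (hab : a + b ≤ Fintype.card ι) :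
    fund N (a + b) ≤ fund N a + fund N b := by
  obtain ⟨C, -, hC⟩ := exists_subset_card_eq (s := (univ : Finset ι)) (n := a + b) (by rwa [card_univ])
  obtain ⟨A, hAC, hA⟩ := exists_subset_card_eq (s := C) (n := a) (by omega)
  have hB : (C \ A).card = b := by rw [card_sdiff_of_subset hAC]; omega
  rw [← hC, ← hA, ← hB, ← norm_indicatorVec h, ← norm_indicatorVec h, ← norm_indicatorVec h]
  have : indicatorVec C = indicatorVec A + indicatorVec (C \ A) := by
    funext x
    simp only [indicatorVec, Pi.add_apply, mem_sdiff]
    by_cases h1 : x ∈ A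
    · simp [h1, hAC h1]
    · simp [h1]
  rw [this]
  exact h.add_le _ _

/-- Subadditivity over blocks of size `b`. The `+ 1` for an incomplete block becomes the one-time
cost of using a class. -/
theorem fund_le_div_add_one (h : IsMonotoneSymmetricNorm N) {b : ℕ} (hb : 0 < b)
    (hbι : b ≤ Fintype.card ι) (k : ℕ) (hk : k ≤ Fintype.card ι) :
    fund N k ≤ (k / b + 1 : ℝ) * fund N b := by
  have hf := fund_nonneg h b
  have hb' : (0 : ℝ) < b := by exact_mod_cast hb
  induction k using Nat.strong_induction_on with
  | _ k ih =>
    by_cases hkb : k ≤ b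
    · refine (fund_mono h hkb hbι).trans (le_mul_of_one_le_left hf ?_)
      have : (0 : ℝ) ≤ k / b := by positivity
      linarith
    · have h1 := ih (k - b) (by omega) (by omega)
      have h2 := fund_add_le h (a := b) (b := k - b) (by omega)
      rw [Nat.add_sub_cancel' (by omega)] at h2
      refine h2.trans ?_
      have h3 : ((k - b : ℕ) : ℝ) / b = k / b - 1 := by
        rw [Nat.cast_sub (by omega), sub_div, div_self hb'.ne']
      rw [h3] at h1
      linarith

theorem fund_le_mul (h : IsMonotoneSymmetricNorm N) (k : ℕ) (hk : k ≤ Fintype.card ι) :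
    fund N k ≤ k * fund N 1 := by
  induction k with
  | zero =>
    have : fund N 0 = 0 := by
      have h1 := norm_indicatorVec h (∅ : Finset ι)
      rw [card_empty] at h1
      rw [← h1]
      have : (indicatorVec (∅ : Finset ι)) = 0 := by funext x; simp [indicatorVec]
      rw [this, h.map_zero]
    simp [this]
  | succ k ih =>
    have h1 := fund_add_le h hk
    have h2 := ih (by omega)
    push_cast
    linarith

/-- A vector supported on `B` all of whose entries fit into class `l` for the target `T`. -/
theorem norm_le_of_class (h : IsMonotoneSymmetricNorm N) {T : ℝ} {l : ℕ}
    (hl : 2 ^ l ≤ Fintype.card ι) (w : ι → ℝ) (B : Finset ι) (hw : ∀ x, 0 ≤ w x)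
    (hwB : ∀ x, x ∉ B → w x = 0) (hwT : ∀ x ∈ B, w x * fund N (2 ^ l) ≤ T) :
    N w ≤ T * (B.card * (1 / 2) ^ l + if 1 ≤ l ∧ B.Nonempty then 1 else 0) := by
  have hf := fund_pos h (Nat.two_pow_pos l) hl
  rcases B.eq_empty_or_nonempty with rfl | hB
  · have : w = 0 := funext fun x => hwB x (by simp)
    simp [this, h.map_zero]
  have hT : 0 ≤ T := by
    obtain ⟨x, hx⟩ := hB
    exact (mul_nonneg (hw x) hf.le).trans (hwT x hx)
  have h1 : N w ≤ T / fund N (2 ^ l) * fund N B.card := by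
    rw [← norm_indicatorVec h, ← h.smul_of_nonneg (by positivity)]
    apply h.monotone _ _ (fun x => hw x)
    intro x
    simp only [Pi.smul_apply, indicatorVec, smul_eq_mul]
    by_cases hx : x ∈ B
    · rw [if_pos hx, mul_one, le_div_iff₀ hf]; exact hwT x hx
    · rw [if_neg hx, hwB x hx]; simp
  have hBc : B.card ≤ Fintype.card ι := card_le_univ B
  refine h1.trans ?_
  rw [div_mul_eq_mul_div, div_le_iff₀ hf, mul_assoc]
  refine mul_le_mul_of_nonneg_left ?_ hT
  -- For `l = 0` the blocks are single coordinates and none is incomplete, so class `0` has no fixed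
  -- cost.
  by_cases hl1 : 1 ≤ l
  · rw [if_pos ⟨hl1, hB⟩]
    have := fund_le_div_add_one h (Nat.two_pow_pos l) hl _ hBc
    rw [one_div, inv_pow, ← div_eq_mul_inv]
    exact_mod_cast this
  · have h0 : l = 0 := by omega
    subst h0
    rw [if_neg (by simp)]
    have := fund_le_mul h _ hBc
    simpa using this

/-- A vector of norm at most `T` has few entries that do not fit into the next class. -/
theorem card_lt_of_class (h : IsMonotoneSymmetricNorm N) {T : ℝ} {b : ℕ} (w : ι → ℝ)
    (hw : ∀ x, 0 ≤ w x) (hN : N w ≤ T) (B : Finset ι) (hB : ∀ x ∈ B, T < w x * fund N b)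
    (hb : 0 < b) : B.card < b := by
  -- Otherwise `b` of these entries, each at least their minimum `w x0`, give norm at least `w x0 *
  -- fund N b > T`.
  by_contra hcon
  push Not at hcon
  obtain ⟨A, hAB, hA⟩ := exists_subset_card_eq hcon
  have hAn : A.Nonempty := card_pos.1 (by omega)
  obtain ⟨x0, hx0, hmin⟩ := A.exists_min_image w hAn
  have h1 : w x0 * fund N b ≤ N w := by
    rw [← hA, ← norm_indicatorVec h, ← h.smul_of_nonneg (hw x0)]
    apply h.monotone _ _
    · intro x
      exact mul_nonneg (hw x0) (indicatorVec_nonneg A x)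
    · intro x
      simp only [Pi.smul_apply, indicatorVec, smul_eq_mul]
      by_cases hx : x ∈ A
      · rw [if_pos hx, mul_one]; exact hmin x hx
      · rw [if_neg hx, mul_zero]; exact hw x
  have := hB x0 (hAB hx0)
  linarith

theorem exists_subset_largest (q : ι → ℝ) (A : Finset ι) (b : ℕ) (hb : b ≤ A.card) :
    ∃ B ⊆ A, B.card = b ∧ ∀ x ∈ B, ∀ y ∈ A, y ∉ B → q y ≤ q x := by
  induction b with
  | zero => exact ⟨∅, empty_subset _, card_empty, by simp⟩
  | succ b ih =>
    obtain ⟨B, hBA, hB, hq⟩ := ih (by omega)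
    have hne : (A \ B).Nonempty := card_pos.1 (by rw [card_sdiff_of_subset hBA]; omega)
    obtain ⟨x0, hx0, hmax⟩ := (A \ B).exists_max_image q hne
    rw [mem_sdiff] at hx0
    refine ⟨insert x0 B, insert_subset hx0.1 hBA, by rw [card_insert_of_notMem hx0.2, hB], ?_⟩
    intro x hx y hy hyn
    rw [mem_insert, not_or] at hyn
    rcases mem_insert.1 hx with rfl | hx
    · exact hmax y (mem_sdiff.2 ⟨hy, hyn.2⟩)
    · exact hq x hx y hy hyn.2

/-- The `b` largest entries are peeled off repeatedly. Entries of a later block are at most the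
average of the preceding block, and the averages add up to at most `(∑ q) / b`; `H` pays for the
first block. -/
theorem norm_le_aux (h : IsMonotoneSymmetricNorm N) {b : ℕ} (hb : 0 < b)
    (hbι : b ≤ Fintype.card ι) (q : ι → ℝ) (hq : ∀ x, 0 ≤ q x) (s : ℕ) :
    ∀ (A : Finset ι) (H : ℝ), A.card = s → 0 ≤ H → (∀ x ∈ A, q x ≤ H) →
      N (fun x => if x ∈ A then q x else 0) ≤ (H + (∑ x ∈ A, q x) / b) * fund N b := by
  have hf := fund_nonneg h b
  have hb' : (0 : ℝ) < b := by exact_mod_cast hb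
  have hsmall : ∀ (A : Finset ι) (H : ℝ), A.card ≤ b → 0 ≤ H → (∀ x ∈ A, q x ≤ H) →
      N (fun x => if x ∈ A then q x else 0) ≤ H * fund N b := by
    intro A H hA hH hqH
    refine le_trans ?_ (mul_le_mul_of_nonneg_left (fund_mono h hA hbι) hH)
    rw [← norm_indicatorVec h, ← h.smul_of_nonneg hH]
    apply h.monotone
    · intro x
      simp only [Pi.zero_apply]
      split_ifs
      · exact hq x
      · exact le_rfl
    · intro x
      simp only [Pi.smul_apply, indicatorVec, smul_eq_mul]
      split_ifs with hx
      · simpa using hqH x hx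
      · simp
  induction s using Nat.strong_induction_on with
  | _ s ih =>
    intro A H hA hH hqH
    have hsum : 0 ≤ ∑ x ∈ A, q x := sum_nonneg fun x _ => hq x
    by_cases hAb : A.card ≤ b
    · refine (hsmall A H hAb hH hqH).trans ?_
      gcongr
      have : 0 ≤ (∑ x ∈ A, q x) / b := by positivity
      linarith
    push Not at hAb
    obtain ⟨B, hBA, hB, hBq⟩ := exists_subset_largest q A b hAb.le
    have hBn : B.Nonempty := card_pos.1 (by omega)
    obtain ⟨x0, hx0, hmin⟩ := B.exists_min_image q hBn
    have hH' : q x0 ≤ (∑ x ∈ B, q x) / b := by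
      rw [le_div_iff₀ hb']
      have := card_nsmul_le_sum B q (q x0) hmin
      rw [hB, nsmul_eq_mul] at this
      linarith
    have h1 := hsmall B H hB.le hH fun x hx => hqH x (hBA hx)
    have h2 := ih (A \ B).card (by rw [card_sdiff_of_subset hBA]; omega) (A \ B) (q x0) rfl
      (hq x0) fun y hy => hBq x0 hx0 y (mem_sdiff.1 hy).1 (mem_sdiff.1 hy).2
    have h3 : (fun x => if x ∈ A then q x else 0) =
        (fun x => if x ∈ B then q x else 0) + fun x => if x ∈ A \ B then q x else 0 := by
      funext x
      simp only [Pi.add_apply, mem_sdiff]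
      by_cases hx : x ∈ B
      · simp [hx, hBA hx]
      · simp [hx]
    rw [h3]
    refine (h.add_le _ _).trans ?_
    have h4 : ∑ x ∈ A, q x = ∑ x ∈ B, q x + ∑ x ∈ A \ B, q x := by
      rw [add_comm, sum_sdiff hBA]
    have h5 : (q x0 + (∑ x ∈ A \ B, q x) / b) * fund N b ≤
        ((∑ x ∈ B, q x) / b + (∑ x ∈ A \ B, q x) / b) * fund N b := by gcongr
    rw [h4, add_div]
    linarith

/-- A vector with entries in `[0, 1]` compared with an indicator vector. -/
theorem norm_le_of_le_one (h : IsMonotoneSymmetricNorm N) {b : ℕ} (hb : 0 < b)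
    (hbι : b ≤ Fintype.card ι) (q : ι → ℝ) (hq : ∀ x, 0 ≤ q x) (hq1 : ∀ x, q x ≤ 1) :
    N q ≤ (1 + (∑ x, q x) / b) * fund N b := by
  have := norm_le_aux h hb hbι q hq _ univ 1 rfl zero_le_one fun x _ => hq1 x
  simpa using this

end Norm

/-! ### The `ℓ_p` norms -/

section EllNorm

variable {m : ℕ}

theorem ellNorm_top (x : Fin m → ℝ) : ellNorm m ∞ x = ⨆ i, |x i| := by
  unfold ellNorm
  rw [PiLp.norm_eq_ciSup]
  simp

theorem ellNorm_toReal {p : ℝ≥0∞} (hp : 1 ≤ p) (hp' : p ≠ ∞) (x : Fin m → ℝ) :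
    ellNorm m p x = (∑ i, |x i| ^ p.toReal) ^ (1 / p.toReal) := by
  unfold ellNorm
  rw [PiLp.norm_eq_sum (ENNReal.toReal_pos (by positivity) hp')]
  simp

theorem isMonotoneSymmetricNorm_ellNorm (hm : 0 < m) {p : ℝ≥0∞} (hp : 1 ≤ p) :
    IsMonotoneSymmetricNorm (ellNorm m p) := by
  have : Fact (1 ≤ p) := ⟨hp⟩
  have : Nonempty (Fin m) := ⟨⟨0, hm⟩⟩
  constructor
  · intro x y
    exact norm_add_le (WithLp.toLp p x : PiLp p (fun _ : Fin m => ℝ)) (WithLp.toLp p y)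
  · intro a x
    have := norm_smul a (WithLp.toLp p x : PiLp p (fun _ : Fin m => ℝ))
    rwa [Real.norm_eq_abs] at this
  · intro x hx
    have := norm_eq_zero.1 hx
    simpa using this
  · intro x y hx hxy
    have hxy' : ∀ i, |x i| ≤ |y i| := fun i => abs_le_abs_of_nonneg (hx i) (hxy i)
    by_cases hp' : p = ∞
    · subst hp'
      rw [ellNorm_top, ellNorm_top]
      exact ciSup_mono (Set.finite_range _).bddAbove hxy'
    · rw [ellNorm_toReal hp hp', ellNorm_toReal hp hp']
      have := ENNReal.toReal_nonneg (a := p)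
      gcongr with i
      · exact hx i
      · exact hxy i
  · intro σ x
    by_cases hp' : p = ∞
    · subst hp'
      rw [ellNorm_top, ellNorm_top]
      exact σ.iSup_comp (g := fun i => |x i|)
    · rw [ellNorm_toReal hp hp', ellNorm_toReal hp hp']
      congr 1
      exact Equiv.sum_comp σ fun i => |x i| ^ p.toReal

end EllNorm

/-! ### The Top-`k` norms -/

section TopK

variable {m k : ℕ}

theorem sum_le_topKNorm (x : Fin m → ℝ) (S : Finset (Fin m)) (hS : S.card ≤ k) (hk : k ≤ m) :
    ∑ i ∈ S, |x i| ≤ topKNorm m k x := by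
  obtain ⟨S', hSS', hS'⟩ := exists_superset_card_eq hS (by simpa using hk)
  refine (sum_le_sum_of_subset_of_nonneg hSS' fun i _ _ => abs_nonneg _).trans ?_
  exact le_ciSup (f := fun S : {S : Finset (Fin m) // S.card = k} => ∑ i ∈ S.1, |x i|)
    (Set.finite_range _).bddAbove ⟨S', hS'⟩

theorem topKNorm_le (x : Fin m → ℝ) (hk : k ≤ m) {b : ℝ}
    (h : ∀ S : Finset (Fin m), S.card = k → ∑ i ∈ S, |x i| ≤ b) : topKNorm m k x ≤ b := by
  obtain ⟨S, -, hS⟩ := exists_subset_card_eq (s := (univ : Finset (Fin m))) (n := k) (by simpa using hk)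
  have : Nonempty {S : Finset (Fin m) // S.card = k} := ⟨⟨S, hS⟩⟩
  exact ciSup_le fun S => h S.1 S.2

theorem abs_le_topKNorm (x : Fin m → ℝ) (hk1 : 1 ≤ k) (hk : k ≤ m) (i : Fin m) :
    |x i| ≤ topKNorm m k x := by
  simpa using sum_le_topKNorm x {i} (by simpa using hk1) hk

theorem isMonotoneSymmetricNorm_topKNorm (hk1 : 1 ≤ k) (hk : k ≤ m) :
    IsMonotoneSymmetricNorm (topKNorm m k) := by
  constructor
  · intro x y
    refine topKNorm_le _ hk fun S hS => ?_
    refine (sum_le_sum fun i _ => abs_add_le (x i) (y i)).trans ?_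
    rw [sum_add_distrib]
    exact add_le_add (sum_le_topKNorm x S hS.le hk) (sum_le_topKNorm y S hS.le hk)
  · intro a x
    unfold topKNorm
    rw [Real.mul_iSup_of_nonneg (abs_nonneg a)]
    congr 1
    funext S
    simp [abs_mul, mul_sum]
  · intro x hx
    funext i
    have := abs_le_topKNorm x hk1 hk i
    rw [hx] at this
    exact abs_nonpos_iff.1 this
  · intro x y hx hxy
    refine topKNorm_le _ hk fun S hS => ?_
    refine le_trans (sum_le_sum fun i _ => ?_) (sum_le_topKNorm y S hS.le hk)
    rw [abs_of_nonneg (hx i), abs_of_nonneg ((hx i).trans (hxy i))]; exact hxy i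
  · have key : ∀ (σ : Equiv.Perm (Fin m)) (x : Fin m → ℝ),
        topKNorm m k (x ∘ σ) ≤ topKNorm m k x := by
      intro σ x
      refine topKNorm_le _ hk fun S hS => ?_
      have := sum_le_topKNorm x (S.map σ.toEmbedding) (by simp [hS]) hk
      simpa using this
    intro σ x
    refine le_antisymm (key σ x) ?_
    have := key σ⁻¹ (x ∘ σ)
    have h1 : (x ∘ σ) ∘ (σ⁻¹ : Equiv.Perm (Fin m)) = x := by funext i; simp
    rwa [h1] at this

end TopK

/-! ### Dyadic load targets and their prices -/

section Discretization

/-- The load targets `2^{-t} / a` with prices `cst t` approximate the unit ball of `f`. -/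
structure Discretization {m : ℕ} (f : (Fin m → ℝ) → ℝ) (L : ℕ) (a : ℝ) (cst : Fin (L + 1) → ℝ)
    (K B : ℝ) : Prop where
  scale_pos : 0 < a
  cost_ge : ∀ t, 1 / (m : ℝ) ≤ cst t
  cost_le : ∀ t, cst t ≤ 1
  -- `cover` is applied to the loads of an offline solution, and `bound` to the loads of the
  -- algorithm divided by a uniform bound. Without `q ≤ 1` the latter would fail in general, for
  -- instance for `ℓ_∞` with prices `1 / m`.
  cover : ∀ x : Fin m → ℝ, 0 ≤ x → f x ≤ 1 → ∃ t : Fin m → Fin (L + 1),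
    (∀ i, x i ≤ (1 / 2) ^ (t i : ℕ) / a) ∧ ∑ i, cst (t i) ≤ K
  bound : ∀ q : Fin m → Fin (L + 1) → ℝ, (∀ i t, 0 ≤ q i t) → (∀ i t, q i t ≤ 1) →
    f (fun i => ∑ t, q i t * ((1 / 2) ^ (t : ℕ) / a)) ≤ B * (K + ∑ i, ∑ t, cst t * q i t)

theorem exists_level (L : ℕ) {x : ℝ} (hx : x ≤ 1) :
    ∃ t : Fin (L + 1), x ≤ (1 / 2) ^ (t : ℕ) ∧ ((t : ℕ) = L ∨ (1 / 2) ^ ((t : ℕ) + 1) < x) := by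
  classical
  set t := Nat.findGreatest (fun t => x ≤ (1 / 2 : ℝ) ^ t) L with ht
  have htL : t ≤ L := Nat.findGreatest_le L
  refine ⟨⟨t, by omega⟩, ?_, ?_⟩
  · exact Nat.findGreatest_spec (P := fun t => x ≤ (1 / 2 : ℝ) ^ t) (Nat.zero_le L) (by simpa using hx)
  · rcases htL.eq_or_lt with h | h
    · exact Or.inl h
    · right
      have := Nat.findGreatest_is_greatest (P := fun t => x ≤ (1 / 2 : ℝ) ^ t) (Nat.lt_succ_self t) h
      exact not_le.1 this

theorem half_pow_le_inv {m L : ℕ} (hm : 0 < m) (hL : m ≤ 2 ^ L) : (1 / 2 : ℝ) ^ L ≤ 1 / m := by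
  rw [one_div, inv_pow, one_div]
  have hm' : (0 : ℝ) < m := by exact_mod_cast hm
  have : (m : ℝ) ≤ 2 ^ L := by exact_mod_cast hL
  gcongr

/-- Level `t` has price `1 / b t`, where `b t` machines can carry load `2 ^ (-t) / a` at norm at
most `2`. A vector of norm at most `1` has at most `b t` coordinates on level `t`, so each of the `L
+ 1` levels costs at most `1`. Conversely, `norm_le_of_le_one` is applied to each level. -/
theorem exists_discretization {m : ℕ} (hm : 2 ≤ m) {f : (Fin m → ℝ) → ℝ}
    (h : IsMonotoneSymmetricNorm f) {L : ℕ} (hL : m ≤ 2 ^ L) :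
    ∃ a cst, Discretization f L a cst (L + 1) 2 := by
  classical
  have hcard : Fintype.card (Fin m) = m := Fintype.card_fin m
  have ha : 0 < fund f 1 := fund_pos h one_pos (by rw [hcard]; omega)
  set a := fund f 1 with ha_def
  have hm0 : (0 : ℝ) < m := by exact_mod_cast (by omega : 0 < m)
  -- The bound `2` allows for coordinates on level `t` that only exceed half of `2 ^ (-t) / a`.
  set b : ℕ → ℕ := fun t => Nat.findGreatest (fun b => (1 / 2 : ℝ) ^ t / a * fund f b ≤ 2) m with hb
  have hp1 : ∀ t : ℕ, (1 / 2 : ℝ) ^ t / a * fund f 1 ≤ 2 := by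
    intro t
    rw [div_mul_cancel₀ _ ha.ne']
    exact (pow_le_one₀ (by norm_num) (by norm_num)).trans (by norm_num)
  have hb1 : ∀ t, 1 ≤ b t := fun t =>
    Nat.le_findGreatest (P := fun b => (1 / 2 : ℝ) ^ t / a * fund f b ≤ 2) (by omega) (hp1 t)
  have hbm : ∀ t, b t ≤ m := fun t => Nat.findGreatest_le m
  have hbs : ∀ t, (1 / 2 : ℝ) ^ t / a * fund f (b t) ≤ 2 := fun t =>
    Nat.findGreatest_spec (P := fun b => (1 / 2 : ℝ) ^ t / a * fund f b ≤ 2) (by omega : 1 ≤ m) (hp1 t)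
  have hb0 : ∀ t, (0 : ℝ) < b t := fun t => by exact_mod_cast (hb1 t)
  -- The lowest level has no lower bound on its coordinates, so all `m` machines must fit; they do
  -- since `2 ^ (-L) ≤ 1 / m`.
  have hbL : b L = m := by
    refine le_antisymm (hbm L) (Nat.le_findGreatest le_rfl ?_)
    have h1 := fund_le_mul h m (by rw [hcard])
    have h2 := half_pow_le_inv (by omega) hL
    have h3 : (1 / 2 : ℝ) ^ L / a * fund f m ≤ (1 / m) / a * (m * fund f 1) := by
      have := fund_nonneg h m
      gcongr
    refine h3.trans ?_
    rw [← ha_def]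
    have : (1 / (m : ℝ)) / a * (m * a) = 1 := by field_simp
    rw [this]; norm_num
  refine ⟨a, fun t => 1 / b t, ha, ?_, ?_, ?_, ?_⟩
  · intro t
    have := hb0 t
    have : (b t : ℝ) ≤ m := by exact_mod_cast hbm t
    gcongr
  · intro t
    rw [div_le_one (hb0 t)]
    exact_mod_cast hb1 t
  · intro x hx hfx
    have hind : ∀ (S : Finset (Fin m)) (s : ℝ), 0 ≤ s → (∀ i ∈ S, s ≤ x i) →
        s * fund f S.card ≤ 1 := by
      intro S s hs hS
      rw [← norm_indicatorVec h, ← h.smul_of_nonneg hs]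
      refine le_trans (h.monotone _ _ ?_ ?_) hfx
      · intro i
        exact mul_nonneg hs (indicatorVec_nonneg S i)
      · intro i
        simp only [Pi.smul_apply, indicatorVec, smul_eq_mul]
        split_ifs with hi
        · simpa using hS i hi
        · simpa using hx i
    have hx1 : ∀ i, x i * a ≤ 1 := by
      intro i
      simpa using hind {i} (x i) (hx i) (by simp)
    choose t ht1 ht2 using fun i => exists_level L (hx1 i)
    refine ⟨t, fun i => ?_, ?_⟩
    · rw [le_div_iff₀ ha]; exact ht1 i
    · rw [← sum_fiberwise univ t]
      refine (sum_le_card_nsmul univ _ 1 ?_).trans (by simp)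
      intro s _
      have h1 : ∑ i with t i = s, 1 / (b (t i) : ℝ) = ∑ i with t i = s, 1 / (b s : ℝ) :=
        sum_congr rfl fun i hi => by rw [(mem_filter.1 hi).2]
      rw [h1, sum_const, nsmul_eq_mul, mul_one_div, div_le_one (hb0 s), Nat.cast_le]
      by_cases hs : (s : ℕ) = L
      · rw [hs, hbL]
        exact (card_le_univ _).trans hcard.le
      · refine Nat.le_findGreatest ((card_le_univ _).trans hcard.le) ?_
        have h2 := hind (univ.filter fun i => t i = s) ((1 / 2) ^ ((s : ℕ) + 1) / a)
          (by positivity) (fun i hi => by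
            have hts := (mem_filter.1 hi).2
            rw [div_le_iff₀ ha]
            have := ht2 i
            rw [hts] at this
            exact (this.resolve_left hs).le)
        rw [pow_succ] at h2
        have h3 : (1 / 2 : ℝ) ^ (s : ℕ) * (1 / 2) / a * fund f (univ.filter fun i => t i = s).card =
          (1 / 2 : ℝ) ^ (s : ℕ) / a * fund f (univ.filter fun i => t i = s).card / 2 := by ring
        rw [h3] at h2
        linarith
  · intro q hq0 hq1
    have h1 : (fun i => ∑ t, q i t * ((1 / 2) ^ (t : ℕ) / a)) =
        ∑ t : Fin (L + 1), ((1 / 2 : ℝ) ^ (t : ℕ) / a) • fun i => q i t := by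
      funext i
      simp [mul_comm]
    rw [h1]
    refine (h.sum_le _ _).trans ?_
    have h2 : ∀ t : Fin (L + 1), f (((1 / 2 : ℝ) ^ (t : ℕ) / a) • fun i => q i t) ≤
        2 * (1 + (∑ i, q i t) / b t) := by
      intro t
      rw [h.smul_of_nonneg (by positivity)]
      have h3 := norm_le_of_le_one h (hb1 t) (by rw [hcard]; exact hbm t) (fun i => q i t)
        (fun i => hq0 i t) fun i => hq1 i t
      have h4 : 0 ≤ 1 + (∑ i, q i t) / b t := by
        have := sum_nonneg fun i (_ : i ∈ univ) => hq0 i t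
        positivity
      calc (1 / 2 : ℝ) ^ (t : ℕ) / a * f (fun i => q i t)
          ≤ (1 / 2 : ℝ) ^ (t : ℕ) / a * ((1 + (∑ i, q i t) / b t) * fund f (b t)) := by gcongr
        _ = ((1 / 2 : ℝ) ^ (t : ℕ) / a * fund f (b t)) * (1 + (∑ i, q i t) / b t) := by ring
        _ ≤ _ := by gcongr; exact hbs t
    refine (sum_le_sum fun t _ => h2 t).trans (le_of_eq ?_)
    rw [← mul_sum, sum_add_distrib, sum_comm (s := (univ : Finset (Fin m)))]
    simp [div_eq_inv_mul, mul_sum]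

theorem geom_sum_le {δ : ℝ} (hδ : 0 ≤ δ) (n : ℕ) :
    ∑ t ∈ range n, (if (1 / 2 : ℝ) ^ (t + 1) ≤ δ then (1 / 2 : ℝ) ^ (t + 1) else 0) ≤ 2 * δ := by
  -- The slack `(1 / 2) ^ n` makes the induction close: it is halved exactly when the next term is
  -- added.
  have key : ∑ t ∈ range n, (if (1 / 2 : ℝ) ^ (t + 1) ≤ δ then (1 / 2 : ℝ) ^ (t + 1) else 0) = 0 ∨
      ∑ t ∈ range n, (if (1 / 2 : ℝ) ^ (t + 1) ≤ δ then (1 / 2 : ℝ) ^ (t + 1) else 0) +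
        (1 / 2) ^ n ≤ 2 * δ := by
    induction n with
    | zero => simp
    | succ n ih =>
      rw [sum_range_succ]
      have h0 : (1 / 2 : ℝ) ^ (n + 1) = (1 / 2) ^ n / 2 := by ring
      have h1 : (0 : ℝ) < (1 / 2) ^ n := by positivity
      split_ifs with h
      · right
        rcases ih with ih | ih
        · rw [ih]; linarith
        · linarith
      · rcases ih with ih | ih
        · left; rw [ih, add_zero]
        · right; linarith
  have h1 : (0 : ℝ) < (1 / 2) ^ n := by positivity
  rcases key with h | h <;> linarith

theorem geom_sum_fin_le {δ : ℝ} (hδ : 0 ≤ δ) (n : ℕ) :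
    ∑ t : Fin n, (if (1 / 2 : ℝ) ^ ((t : ℕ) + 1) ≤ δ then (1 / 2 : ℝ) ^ ((t : ℕ) + 1) else 0) ≤
      2 * δ := by
  rw [Fin.sum_univ_eq_sum_range
    (fun t => if (1 / 2 : ℝ) ^ (t + 1) ≤ δ then (1 / 2 : ℝ) ^ (t + 1) else 0)]
  exact geom_sum_le hδ n

/-- Let `X` be the sum on the left. Levels of size `s ≤ X / 4` contribute at most `X / 2`, as the
sizes are geometric and `q ≤ 1`. The others carry at least `X / 2` and satisfy `s ^ p ≥ s * (X / 4)
^ (p - 1)`. -/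
theorem rpow_sum_levels_le {n : ℕ} {p : ℝ} (hp : 1 ≤ p) (q : Fin n → ℝ) (hq0 : ∀ t, 0 ≤ q t)
    (hq1 : ∀ t, q t ≤ 1) :
    ((∑ t, q t * (1 / 2) ^ ((t : ℕ) + 1)) / 4) ^ p ≤
      ∑ t, q t * ((1 / 2 : ℝ) ^ ((t : ℕ) + 1)) ^ p := by
  set s : Fin n → ℝ := fun t => (1 / 2) ^ ((t : ℕ) + 1) with hs
  have hs0 : ∀ t, 0 < s t := fun t => by positivity
  set X := ∑ t, q t * s t with hX
  have hX0 : 0 ≤ X := sum_nonneg fun t _ => mul_nonneg (hq0 t) (hs0 t).le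
  rcases hX0.eq_or_lt with h0 | hpos
  · rw [← h0, zero_div,
      Real.zero_rpow (by linarith)]
    exact sum_nonneg fun t _ => mul_nonneg (hq0 t) (Real.rpow_nonneg (hs0 t).le _)
  have h1 := geom_sum_fin_le (δ := X / 4) (by positivity) n
  have h2 : ∀ t, q t * s t * (X / 4) ^ (p - 1) -
      (if s t ≤ X / 4 then s t else 0) * (X / 4) ^ (p - 1) ≤ q t * s t ^ p := by
    intro t
    have hq := hq0 t
    have hst := hs0 t
    have hx : 0 ≤ (X / 4) ^ (p - 1) := by positivity
    split_ifs with h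
    · have : q t * s t ≤ s t := mul_le_of_le_one_left hst.le (hq1 t)
      have h3 : 0 ≤ q t * s t ^ p := by positivity
      nlinarith
    · push Not at h
      have h3 : s t ^ p = s t * s t ^ (p - 1) := by
        rw [← Real.rpow_one_add' hst.le (by linarith)]; congr 1; ring
      rw [h3, zero_mul, sub_zero, mul_assoc]
      gcongr
  have h4 := sum_le_sum fun t (_ : t ∈ univ) => h2 t
  rw [sum_sub_distrib, ← sum_mul, ← sum_mul] at h4
  have h5 : (X / 4) ^ p = X / 4 * (X / 4) ^ (p - 1) := by
    rw [← Real.rpow_one_add' (by positivity) (by linarith)]; congr 1; ring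
  have hx : 0 ≤ (X / 4) ^ (p - 1) := by positivity
  change (X / 4) ^ p ≤ ∑ t, q t * s t ^ p
  rw [h5]
  refine le_trans ?_ h4
  rw [← hX, ← sub_mul]
  gcongr
  change ∑ t, (if s t ≤ X / 4 then s t else 0) ≤ _ at h1
  linarith

/-- For finite `p`, pricing a level by the `p`-th power of its size turns the total price into a sum
of `p`-th powers, so no factor for the number of levels is lost. The floor `1 / m` adds at most `1`,
whence `K = 2`. For `p = ∞` the price `1 / m` is enough. -/
theorem exists_discretization_ellNorm {m : ℕ} (hm : 2 ≤ m) {p : ℝ≥0∞} (hp : 1 ≤ p) {L : ℕ}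
    (hL : m ≤ 2 ^ L) : ∃ a cst, Discretization (ellNorm m p) L a cst 2 8 := by
  have hm0 : (0 : ℝ) < m := by exact_mod_cast (by omega : 0 < m)
  have hm1 : (1 : ℝ) / m ≤ 1 := by
    rw [div_le_one hm0]; exact_mod_cast (by omega : 1 ≤ m)
  have : Nonempty (Fin m) := ⟨⟨0, by omega⟩⟩
  by_cases hp' : p = ∞
  · subst hp'
    refine ⟨1, fun _ => 1 / m, one_pos, fun _ => le_rfl, fun _ => hm1, ?_, ?_⟩
    · intro x hx hfx
      refine ⟨fun _ => 0, fun i => ?_, ?_⟩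
      · rw [ellNorm_top] at hfx
        have := le_ciSup (f := fun i => |x i|) (Set.finite_range _).bddAbove i
        simpa using (le_abs_self _).trans (this.trans hfx)
      · simp [hm0.ne']
    · intro q hq0 hq1
      have h0 : 0 ≤ ∑ i, ∑ t, 1 / (m : ℝ) * q i t := sum_nonneg fun i _ => sum_nonneg fun t _ =>
        mul_nonneg (by positivity) (hq0 i t)
      rw [ellNorm_top]
      refine ciSup_le fun i => ?_
      rw [abs_of_nonneg (sum_nonneg fun t _ => mul_nonneg (hq0 i t) (by positivity))]
      have h1 := geom_sum_fin_le (δ := 1) zero_le_one (L + 1)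
      have h2 : ∑ t : Fin (L + 1), q i t * ((1 / 2 : ℝ) ^ (t : ℕ) / 1) ≤ 2 *
          ∑ t : Fin (L + 1), (if (1 / 2 : ℝ) ^ ((t : ℕ) + 1) ≤ 1 then
            (1 / 2 : ℝ) ^ ((t : ℕ) + 1) else 0) := by
        rw [mul_sum]
        refine sum_le_sum fun t _ => ?_
        rw [if_pos (pow_le_one₀ (by norm_num) (by norm_num)), pow_succ]
        have : (0 : ℝ) < (1 / 2) ^ (t : ℕ) := by positivity
        have := mul_le_of_le_one_left this.le (hq1 i t)
        linarith
      linarith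
  · set P := p.toReal with hP
    have hP1 : 1 ≤ P := by
      rw [hP, ← ENNReal.toReal_one]; exact ENNReal.toReal_mono hp' hp
    refine ⟨1, fun t => max (((1 / 2 : ℝ) ^ ((t : ℕ) + 1)) ^ P) (1 / m), one_pos,
      fun _ => le_max_right _ _, fun t => max_le ?_ hm1, ?_, ?_⟩
    · exact Real.rpow_le_one (by positivity) (pow_le_one₀ (by norm_num) (by norm_num)) (by linarith)
    · intro x hx hfx
      rw [ellNorm_toReal hp hp', ← hP] at hfx
      have hxx : ∀ i, |x i| = x i := fun i => abs_of_nonneg (hx i)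
      simp only [hxx] at hfx
      have hS0 : 0 ≤ ∑ i, x i ^ P := sum_nonneg fun i _ => Real.rpow_nonneg (hx i) _
      have hsum : ∑ i, x i ^ P ≤ 1 := by
        have := Real.rpow_le_rpow (Real.rpow_nonneg hS0 _) hfx (by linarith : 0 ≤ P)
        rwa [Real.one_rpow, ← Real.rpow_mul hS0, one_div_mul_cancel (by linarith),
          Real.rpow_one] at this
      have hx1 : ∀ i, x i ≤ 1 := by
        intro i
        have h1 : x i ^ P ≤ 1 := (single_le_sum (f := fun i => x i ^ P)
          (fun i _ => Real.rpow_nonneg (hx i) _) (mem_univ i)).trans hsum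
        by_contra hcon
        push Not at hcon
        have := Real.one_lt_rpow hcon (by linarith : 0 < P)
        linarith
      choose t ht1 ht2 using fun i => exists_level L (hx1 i)
      refine ⟨t, fun i => by simpa using ht1 i, ?_⟩
      have h1 : ∀ i, max (((1 / 2 : ℝ) ^ ((t i : ℕ) + 1)) ^ P) (1 / (m : ℝ)) ≤ x i ^ P + 1 / m := by
        intro i
        have hxi : 0 ≤ x i ^ P := Real.rpow_nonneg (hx i) _
        have hmi : 0 ≤ 1 / (m : ℝ) := by positivity
        refine max_le ?_ (by linarith)
        rcases ht2 i with h | h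
        · have h3 : (1 / 2 : ℝ) ^ ((t i : ℕ) + 1) ≤ 1 / m := by
            rw [h, pow_succ]
            have := half_pow_le_inv (by omega) hL
            have h4 : (0 : ℝ) < (1 / 2) ^ L := by positivity
            linarith
          have h4 := Real.rpow_le_rpow_of_exponent_ge (by positivity)
            (h3.trans hm1) hP1
          rw [Real.rpow_one] at h4
          linarith
        · have := Real.rpow_le_rpow (by positivity) h.le (by linarith : 0 ≤ P)
          linarith
      refine (sum_le_sum fun i _ => h1 i).trans ?_
      rw [sum_add_distrib]
      have : ∑ i : Fin m, 1 / (m : ℝ) = 1 := by simp [hm0.ne']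
      rw [this]
      linarith
    · intro q hq0 hq1
      set cst : Fin (L + 1) → ℝ :=
        fun t => max (((1 / 2 : ℝ) ^ ((t : ℕ) + 1)) ^ P) (1 / m) with hcst
      have hc0 : ∀ t, 0 ≤ cst t := fun t => le_trans (by positivity) (le_max_right _ _)
      set W := ∑ i, ∑ t, cst t * q i t with hW
      have hW0 : 0 ≤ W := sum_nonneg fun i _ => sum_nonneg fun t _ => mul_nonneg (hc0 t) (hq0 i t)
      rw [ellNorm_toReal hp hp', ← hP]
      set X : Fin m → ℝ := fun i => (∑ t, q i t * (1 / 2) ^ ((t : ℕ) + 1)) / 4 with hX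
      have hX0 : ∀ i, 0 ≤ X i := fun i => div_nonneg
        (sum_nonneg fun t _ => mul_nonneg (hq0 i t) (by positivity)) (by norm_num)
      have h1 : ∀ i, |∑ t : Fin (L + 1), q i t * ((1 / 2 : ℝ) ^ (t : ℕ) / 1)| = 8 * X i := by
        intro i
        rw [abs_of_nonneg (sum_nonneg fun t _ => mul_nonneg (hq0 i t) (by positivity))]
        simp only [hX]
        rw [mul_div_assoc', mul_sum, sum_div]
        refine sum_congr rfl fun t _ => ?_
        rw [pow_succ]; ring
      have h2 : ∑ i, X i ^ P ≤ W := by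
        refine sum_le_sum fun i _ => ?_
        refine (rpow_sum_levels_le hP1 (q i) (hq0 i) (hq1 i)).trans ?_
        refine sum_le_sum fun t _ => ?_
        rw [mul_comm]
        exact mul_le_mul_of_nonneg_right (le_max_left _ _) (hq0 i t)
      have h3 : (∑ i, (8 * X i) ^ P) ^ (1 / P) = 8 * (∑ i, X i ^ P) ^ (1 / P) := by
        have : ∀ i, (8 * X i) ^ P = 8 ^ P * X i ^ P := fun i =>
          Real.mul_rpow (by norm_num) (hX0 i)
        simp only [this]
        rw [← mul_sum, Real.mul_rpow (by positivity)
          (sum_nonneg fun i _ => Real.rpow_nonneg (hX0 i) _), ← Real.rpow_mul (by norm_num),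
          mul_one_div_cancel (by linarith), Real.rpow_one]
      simp only [h1]
      rw [h3]
      -- The root may exceed its argument below `1`; passing to `1 + W` avoids this.
      have h4 : (∑ i, X i ^ P) ^ (1 / P) ≤ 1 + W := by
        refine (Real.rpow_le_rpow (sum_nonneg fun i _ => Real.rpow_nonneg (hX0 i) _)
          (h2.trans (by linarith : W ≤ 1 + W)) (by positivity)).trans ?_
        have := Real.rpow_le_rpow_of_exponent_le (by linarith : 1 ≤ 1 + W)
          (by rw [div_le_one (by linarith)]; exact hP1 : 1 / P ≤ 1)
        rwa [Real.rpow_one] at this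
      linarith

/-- Loads of order `1 / k` are harmless in a sum of `k` terms and get the floor price `1 / m`;
larger ones are priced linearly. At most `k` coordinates of a vector in the unit ball exceed `1 /
k`, so their sum is at most the norm. -/
theorem exists_discretization_topKNorm {m k : ℕ} (hm : 2 ≤ m) (hk1 : 1 ≤ k) (hk : k ≤ m) {L : ℕ}
    (hL : m ≤ 2 ^ L) : ∃ a cst, Discretization (topKNorm m k) L a cst 2 8 := by
  have hm0 : (0 : ℝ) < m := by exact_mod_cast (by omega : 0 < m)
  have hk0 : (0 : ℝ) < k := by exact_mod_cast hk1
  have hm1 : (1 : ℝ) / m ≤ 1 := by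
    rw [div_le_one hm0]; exact_mod_cast (by omega : 1 ≤ m)
  have hmk : (1 : ℝ) / m ≤ 1 / k := by
    have : (k : ℝ) ≤ m := by exact_mod_cast hk
    gcongr
  set big : Fin (L + 1) → ℝ := fun t =>
    if 1 / (k : ℝ) ≤ (1 / 2 : ℝ) ^ ((t : ℕ) + 1) then (1 / 2 : ℝ) ^ ((t : ℕ) + 1) else 0 with hbig
  refine ⟨1, fun t => max (1 / m) (big t), one_pos, fun _ => le_max_left _ _,
    fun t => max_le hm1 ?_, ?_, ?_⟩
  · simp only [hbig]
    split_ifs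
    · exact pow_le_one₀ (by norm_num) (by norm_num)
    · norm_num
  · intro x hx hfx
    have hxx : ∀ i, |x i| = x i := fun i => abs_of_nonneg (hx i)
    have hx1 : ∀ i, x i ≤ 1 := fun i => (hxx i ▸ abs_le_topKNorm x hk1 hk i).trans hfx
    choose t ht1 ht2 using fun i => exists_level L (hx1 i)
    refine ⟨t, fun i => by simpa using ht1 i, ?_⟩
    have hcard : (univ.filter fun i => 1 / (k : ℝ) < x i).card ≤ k := by
      by_contra hcon
      push Not at hcon
      obtain ⟨S, hS, hSk⟩ := exists_subset_card_eq hcon.le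
      have h1 := sum_le_topKNorm x S hSk.le hk
      have h2 : ∑ i ∈ S, 1 / (k : ℝ) < ∑ i ∈ S, |x i| := by
        refine sum_lt_sum_of_nonempty (card_pos.1 (by omega)) fun i hi => ?_
        rw [hxx]
        exact (mem_filter.1 (hS hi)).2
      rw [sum_const, hSk, nsmul_eq_mul, mul_one_div_cancel hk0.ne'] at h2
      linarith
    have h1 : ∀ i, max (1 / (m : ℝ)) (big (t i)) ≤ 1 / m + if 1 / (k : ℝ) < x i then |x i| else 0 := by
      intro i
      have hmi : 0 ≤ 1 / (m : ℝ) := by positivity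
      have h0 : 0 ≤ if 1 / (k : ℝ) < x i then |x i| else 0 := by
        split_ifs
        · exact abs_nonneg _
        · exact le_rfl
      refine max_le (by linarith) ?_
      simp only [hbig]
      split_ifs with h2 h3 h3
      · rcases ht2 i with h | h
        · exfalso
          rw [h, pow_succ] at h2
          have := half_pow_le_inv (by omega) hL
          have h4 : (0 : ℝ) < (1 / 2) ^ L := by positivity
          linarith
        · rw [hxx]; linarith
      · exfalso
        rcases ht2 i with h | h
        · rw [h, pow_succ] at h2
          have := half_pow_le_inv (by omega) hL
          have h4 : (0 : ℝ) < (1 / 2) ^ L := by positivity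
          linarith
        · linarith
      · have := abs_nonneg (x i); linarith
      · linarith
    refine (sum_le_sum fun i _ => h1 i).trans ?_
    rw [sum_add_distrib, ← sum_filter]
    have h2 : ∑ i : Fin m, 1 / (m : ℝ) = 1 := by simp [hm0.ne']
    have h3 := sum_le_topKNorm x _ hcard hk
    linarith
  · intro q hq0 hq1
    set W := ∑ i, ∑ t, max (1 / (m : ℝ)) (big t) * q i t with hW
    have hc0 : ∀ t, 0 ≤ max (1 / (m : ℝ)) (big t) := fun t =>
      le_trans (by positivity) (le_max_left _ _)
    have hrow : ∀ i, 0 ≤ ∑ t, max (1 / (m : ℝ)) (big t) * q i t := fun i =>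
      sum_nonneg fun t _ => mul_nonneg (hc0 t) (hq0 i t)
    have hW0 : 0 ≤ W := sum_nonneg fun i _ => hrow i
    have h1 : ∀ i, |∑ t : Fin (L + 1), q i t * ((1 / 2 : ℝ) ^ (t : ℕ) / 1)| ≤
        4 / k + 2 * ∑ t, max (1 / (m : ℝ)) (big t) * q i t := by
      intro i
      rw [abs_of_nonneg (sum_nonneg fun t _ => mul_nonneg (hq0 i t) (by positivity))]
      have h2 := geom_sum_fin_le (δ := 1 / (k : ℝ)) (by positivity) (L + 1)
      have h3 : ∑ t : Fin (L + 1), q i t * ((1 / 2 : ℝ) ^ (t : ℕ) / 1) ≤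
          ∑ t : Fin (L + 1), (2 * (if (1 / 2 : ℝ) ^ ((t : ℕ) + 1) ≤ 1 / k then
            (1 / 2 : ℝ) ^ ((t : ℕ) + 1) else 0) + 2 * (max (1 / (m : ℝ)) (big t) * q i t)) := by
        refine sum_le_sum fun t _ => ?_
        have hs : (0 : ℝ) < (1 / 2) ^ ((t : ℕ) + 1) := by positivity
        have h4 : (1 / 2 : ℝ) ^ (t : ℕ) / 1 = 2 * (1 / 2) ^ ((t : ℕ) + 1) := by rw [pow_succ]; ring
        have h5 := mul_nonneg (hc0 t) (hq0 i t)
        rw [h4]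
        split_ifs with h
        · have := mul_le_of_le_one_left hs.le (hq1 i t)
          linarith
        · push Not at h
          have h6 : (1 / 2 : ℝ) ^ ((t : ℕ) + 1) ≤ max (1 / (m : ℝ)) (big t) := by
            refine le_trans ?_ (le_max_right _ _)
            simp only [hbig]
            rw [if_pos h.le]
          have := mul_le_mul_of_nonneg_right h6 (hq0 i t)
          linarith
      rw [sum_add_distrib, ← mul_sum, ← mul_sum] at h3
      have h4 : 2 * (2 * (1 / (k : ℝ))) = 4 / k := by ring
      linarith
    refine topKNorm_le _ hk fun S hS => ?_
    refine (sum_le_sum fun i _ => h1 i).trans ?_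
    rw [sum_add_distrib, sum_const, hS, nsmul_eq_mul, mul_div_cancel₀ _ hk0.ne', ← mul_sum]
    have : ∑ i ∈ S, ∑ t, max (1 / (m : ℝ)) (big t) * q i t ≤ W :=
      sum_le_sum_of_subset_of_nonneg (subset_univ S) fun i _ _ => hrow i
    linarith

end Discretization

theorem coord_mul_fund_le {ι : Type} {N : (ι → ℝ) → ℝ} [Fintype ι] [DecidableEq ι]
    (h : IsMonotoneSymmetricNorm N) (w : ι → ℝ) (hw : ∀ x, 0 ≤ w x) (x : ι) :
    w x * fund N 1 ≤ N w := by
  rw [← card_singleton x, ← norm_indicatorVec h, ← h.smul_of_nonneg (hw x)]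
  apply h.monotone
  · intro y
    exact mul_nonneg (hw x) (indicatorVec_nonneg _ y)
  · intro y
    simp only [Pi.smul_apply, indicatorVec, smul_eq_mul, mem_singleton]
    split_ifs with hy
    · rw [hy, mul_one]
    · rw [mul_zero]; exact hw y

theorem sum_half_pow_le {κ : Type*} (s : Finset κ) (lev : κ → ℕ) (D : ℕ) (hlev : ∀ k ∈ s, lev k < D)
    (hcard : ∀ l < D, (s.filter fun k => lev k = l).card ≤ 2 ^ (l + 1)) :
    ∑ k ∈ s, (1 / 2 : ℝ) ^ lev k ≤ 2 * D := by
  rw [← sum_fiberwise_of_maps_to (t := range D) (g := lev) fun k hk => mem_range.2 (hlev k hk)]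
  refine (sum_le_card_nsmul (range D) _ 2 fun l hl => ?_).trans
    (by rw [card_range, nsmul_eq_mul, mul_comm])
  have h1 : ∑ k ∈ s with lev k = l, (1 / 2 : ℝ) ^ lev k = ∑ k ∈ s with lev k = l, (1 / 2 : ℝ) ^ l :=
    sum_congr rfl fun k hk => by rw [(mem_filter.1 hk).2]
  rw [h1, sum_const, nsmul_eq_mul]
  have h2 : ((s.filter fun k => lev k = l).card : ℝ) ≤ 2 ^ (l + 1) := by
    exact_mod_cast hcard l (mem_range.1 hl)
  calc _ ≤ (2 : ℝ) ^ (l + 1) * (1 / 2) ^ l := by gcongr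
    _ = 2 := by rw [pow_succ, mul_right_comm, ← mul_pow]; norm_num

theorem sum_two_zpow_le (s : Finset ℤ) (w : ℤ) (h : ∀ z ∈ s, z ≤ w) :
    ∑ z ∈ s, (2 : ℝ) ^ z ≤ 2 * 2 ^ w := by
  induction s using Finset.induction_on_max generalizing w with
  | empty => simp only [sum_empty]; positivity
  | insert z s hz ih =>
    rw [sum_insert fun hmem => lt_irrefl _ (hz z hmem)]
    have h1 := ih (z - 1) fun x hx => by have := hz x hx; omega
    have h2 : (2 : ℝ) ^ z ≤ 2 ^ w := zpow_le_zpow_right₀ (by norm_num) (h z (mem_insert_self _ _))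
    rw [zpow_sub_one₀ two_ne_zero] at h1
    linarith

/-! ### Optima of prefixes of the job sequence -/

section Costs

variable {m n r : ℕ} {f : (Fin m → ℝ) → ℝ} {N : Fin m → (Fin n × Fin r → ℝ) → ℝ}

theorem machineVector_nonneg (p : JobSeq m n r) (x : Allocation m n r) (i : Fin m) :
    0 ≤ machineVector p x i := by
  intro jk
  simp only [machineVector, Pi.zero_apply]
  split_ifs
  · exact ENNReal.toReal_nonneg
  · exact le_rfl

theorem loadVector_nonneg (hN : ∀ i, IsMonotoneSymmetricNorm (N i)) (p : JobSeq m n r)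
    (x : Allocation m n r) : 0 ≤ loadVector N p x :=
  fun i => (hN i).nonneg _

theorem cost_mono (hf : IsMonotoneSymmetricNorm f) (hN : ∀ i, IsMonotoneSymmetricNorm (N i))
    {p p' : JobSeq m n r} (h : ∀ j i k, p j i k ≤ p' j i k) (x : Allocation m n r) :
    cost f N p x ≤ cost f N p' x := by
  unfold cost
  by_cases hp' : ∀ j, p' j (x j).1 (x j).2 ≠ ∞
  · have hp : ∀ j, p j (x j).1 (x j).2 ≠ ∞ := fun j => ne_top_of_le_ne_top (hp' j) (h _ _ _)
    rw [if_pos hp, if_pos hp']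
    apply ENNReal.ofReal_le_ofReal
    apply hf.monotone _ _ (loadVector_nonneg hN p x)
    intro i
    apply (hN i).monotone _ _ (machineVector_nonneg p x i)
    intro jk
    simp only [machineVector]
    split_ifs with hx
    · refine ENNReal.toReal_mono ?_ (h _ _ _)
      have := hp' jk.1
      rwa [hx] at this
    · exact le_rfl
  · rw [if_neg hp']
    exact le_top

theorem opt_mono (hf : IsMonotoneSymmetricNorm f) (hN : ∀ i, IsMonotoneSymmetricNorm (N i))
    {p p' : JobSeq m n r} (h : ∀ j i k, p j i k ≤ p' j i k) : opt f N p ≤ opt f N p' :=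
  iInf_mono fun x => cost_mono hf hN h x

theorem exists_optimal (hf : IsMonotoneSymmetricNorm f) [NeZero m] [NeZero r] {p : JobSeq m n r}
    (h : opt f N p ≠ ∞) :
    ∃ x : Allocation m n r, (∀ j, p j (x j).1 (x j).2 ≠ ∞) ∧
      f (loadVector N p x) = (opt f N p).toReal := by
  obtain ⟨x, hx⟩ := exists_eq_ciInf_of_finite (f := fun x : Allocation m n r => cost f N p x)
  change cost f N p x = opt f N p at hx
  refine ⟨x, ?_⟩
  rw [← hx] at h ⊢
  unfold cost at h ⊢
  by_cases hp : ∀ j, p j (x j).1 (x j).2 ≠ ∞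
  · rw [if_pos hp]
    exact ⟨hp, (ENNReal.toReal_ofReal (hf.nonneg _)).symm⟩
  · rw [if_neg hp] at h
    exact absurd rfl h

/-- The instance in which all jobs after `j` are replaced by jobs without loads. -/
def truncate (p : JobSeq m n r) (j : Fin n) : JobSeq m n r := fun j' => if j' ≤ j then p j' else 0

theorem truncate_of_le (p : JobSeq m n r) {j j' : Fin n} (h : j' ≤ j) : truncate p j j' = p j' :=
  if_pos h

theorem truncate_le (p : JobSeq m n r) (j j' : Fin n) (i : Fin m) (k : Fin r) :
    truncate p j j' i k ≤ p j' i k := by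
  unfold truncate
  split_ifs
  · exact le_rfl
  · exact zero_le

theorem truncate_congr {p q : JobSeq m n r} {j : Fin n} (h : ∀ j' ≤ j, p j' = q j') :
    truncate p j = truncate q j := by
  funext j'
  unfold truncate
  split_ifs with h1
  · exact h j' h1
  · rfl

/-- A way of least load on machine `i`. -/
noncomputable def bestWay [NeZero r] (J : Job m r) (i : Fin m) : Fin r :=
  (Finite.exists_min (J i)).choose

/-- The least load on machine `i`. -/
noncomputable def bestLoad [NeZero r] (J : Job m r) (i : Fin m) : ℝ≥0∞ := J i (bestWay J i)

theorem bestLoad_le [NeZero r] (J : Job m r) (i : Fin m) (k : Fin r) : bestLoad J i ≤ J i k :=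
  (Finite.exists_min (J i)).choose_spec k

/-- A way without load, if there is one. -/
noncomputable def freeWay [NeZero m] [NeZero r] (J : Job m r) : Fin m × Fin r :=
  open Classical in if h : ∃ v : Fin m × Fin r, J v.1 v.2 = 0 then h.choose else (0, 0)

theorem freeWay_spec [NeZero m] [NeZero r] (J : Job m r) (h : ∃ v : Fin m × Fin r, J v.1 v.2 = 0) :
    J (freeWay J).1 (freeWay J).2 = 0 := by
  unfold freeWay
  rw [dif_pos h]
  exact h.choose_spec

/-- By definiteness of `f` and of the machine norms, an optimal allocation of cost `0` uses only
zero loads. -/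
theorem exists_free_of_opt_truncate_eq_zero [NeZero m] [NeZero r] (hf : IsMonotoneSymmetricNorm f)
    (hN : ∀ i, IsMonotoneSymmetricNorm (N i)) (p : JobSeq m n r) (j : Fin n)
    (h : opt f N (truncate p j) = 0) : ∃ v : Fin m × Fin r, p j v.1 v.2 = 0 := by
  obtain ⟨x, hx1, hx2⟩ := exists_optimal hf (h.symm ▸ ENNReal.zero_ne_top)
  rw [h, ENNReal.toReal_zero] at hx2
  have h1 : N (x j).1 (machineVector (truncate p j) x (x j).1) = 0 :=
    congrFun (hf.definite _ hx2) (x j).1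
  have h2 := congrFun ((hN _).definite _ h1) (j, (x j).2)
  simp only [machineVector, if_true, Prod.mk.eta, Pi.zero_apply] at h2
  have h3 := (ENNReal.toReal_eq_zero_iff _).1 h2
  refine ⟨x j, ?_⟩
  rw [← truncate_of_le p le_rfl]
  exact h3.resolve_right (hx1 j)

end Costs

/-! ### The online algorithm on jobs -/

/-- The data on which the online algorithm depends. -/
structure Setup (m n r : ℕ) where
  agg : (Fin m → ℝ) → ℝ
  norm : Fin m → (Fin n × Fin r → ℝ) → ℝ
  levels : ℕ
  scale : ℝ
  price : Fin (levels + 1) → ℝ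
  classes : ℕ
  slots : ℕ

namespace Setup

variable {m n r : ℕ} (S : Setup m n r)

/-- The pairs of a machine and a level of its load target. -/
abbrev Loc : Type := Fin m × Fin (S.levels + 1)

/-- The random thresholds. -/
abbrev Seed : Type := S.Loc × Fin S.classes → Fin S.slots

/-- `2 ^ (classes - 1) ≤ n` keeps the block sizes within the dimension, and `n ≤ 2 ^ classes` bounds
the number of jobs in the top class. `slots` is the `M` of the rounding. -/
structure Valid (K B : ℝ) : Prop where
  agg : IsMonotoneSymmetricNorm S.agg
  norm : ∀ i, IsMonotoneSymmetricNorm (S.norm i)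
  disc : Discretization S.agg S.levels S.scale S.price K B
  classes_pos : 0 < S.classes
  le_two_pow : n ≤ 2 ^ S.classes
  two_pow_le : 2 ^ (S.classes - 1) ≤ n
  two_le_slots : 2 ≤ S.slots
  le_slots : m ≤ S.slots
  mul_le_slots : m * (S.levels + 1) ≤ S.slots
  one_le : 1 ≤ K
  budget_le : K ≤ S.slots
  factor_nonneg : 0 ≤ B

/-- The price of a location. -/
def locPrice (u : S.Loc) : ℝ := S.price u.2

/-- The load target of a location when the optimum is at most `G`. -/
noncomputable def target (G : ℝ) (u : S.Loc) : ℝ := G * ((1 / 2) ^ (u.2 : ℕ) / S.scale)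

variable [NeZero m] [NeZero r]

/-- The request of a job when the optimum is at most `G`. -/
noncomputable def request (G : ℝ) (J : Job m r) : Request S.Loc where
  elig := open Classical in univ.filter fun u =>
    bestLoad J u.1 ≠ ∞ ∧ (bestLoad J u.1).toReal * fund (S.norm u.1) (2 ^ 0) ≤ S.target G u
  lev u := open Classical in Nat.findGreatest
    (fun l => (bestLoad J u.1).toReal * fund (S.norm u.1) (2 ^ l) ≤ S.target G u) (S.classes - 1)

/-- The optimum for the jobs up to `j`. -/
noncomputable def prefOpt (p : JobSeq m n r) (j : Fin n) : ℝ≥0∞ := opt S.agg S.norm (truncate p j)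

/-- The optimum for the jobs up to `j` is of the order `2 ^ z`. -/
def InPhase (p : JobSeq m n r) (z : ℤ) (j : Fin n) : Prop :=
  S.prefOpt p j ≠ 0 ∧ S.prefOpt p j ≠ ∞ ∧ Int.clog 2 (S.prefOpt p j).toReal = z

/-- The requests of the jobs of a phase. -/
noncomputable def requests (p : JobSeq m n r) (z : ℤ) (k : ℕ) : Request S.Loc :=
  open Classical in
  -- Requests keep the index of their job. A job outside the phase has no eligible unit and leaves
  -- the state unchanged.
  if h : ∃ hk : k < n, S.InPhase p z ⟨k, hk⟩ then S.request (2 ^ z) (p ⟨k, h.1⟩) else ⟨∅, 0⟩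

/-- The allocation that the algorithm computes. -/
noncomputable def allocate (t : S.Seed) (p : JobSeq m n r) : Allocation m n r := fun j =>
  open Classical in
  if S.prefOpt p j = 0 then freeWay (p j) else
    -- For valid parameters the default `(0, 0)` occurs only if the prefix has no allocation of
    -- finite cost.
    (served S.locPrice t (S.requests p (Int.clog 2 (S.prefOpt p j).toReal)) j).elim (0, 0)
      fun v => (v.1.1, bestWay (p j) v.1.1)

variable {S}

theorem prefOpt_congr {p q : JobSeq m n r} {j : Fin n} (h : ∀ j' ≤ j, p j' = q j') :
    S.prefOpt p j = S.prefOpt q j := by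
  unfold prefOpt
  rw [truncate_congr h]

theorem requests_congr {p q : JobSeq m n r} {j : Fin n} (h : ∀ j' ≤ j, p j' = q j') (z : ℤ) {k : ℕ}
    (hk : k ≤ j) : S.requests p z k = S.requests q z k := by
  have hkn : k < n := by omega
  have h1 : S.prefOpt p ⟨k, hkn⟩ = S.prefOpt q ⟨k, hkn⟩ :=
    prefOpt_congr fun j' hj' => h j' (hj'.trans hk)
  have h2 : p ⟨k, hkn⟩ = q ⟨k, hkn⟩ := h _ hk
  have h3 : S.InPhase p z ⟨k, hkn⟩ ↔ S.InPhase q z ⟨k, hkn⟩ := by simp only [InPhase, h1]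
  unfold requests
  by_cases h4 : S.InPhase q z ⟨k, hkn⟩
  · rw [dif_pos ⟨hkn, h3.2 h4⟩, dif_pos ⟨hkn, h4⟩, h2]
  · rw [dif_neg fun h => h4 (h3.1 h.2), dif_neg fun h => h4 h.2]

theorem allocate_congr (t : S.Seed) {p q : JobSeq m n r} {j : Fin n} (h : ∀ j' ≤ j, p j' = q j') :
    S.allocate t p j = S.allocate t q j := by
  unfold allocate
  rw [prefOpt_congr h, h j le_rfl]
  have h1 := fun z => served_congr (c := S.locPrice) (t := t) (e := S.requests p z)
    (e' := S.requests q z) (k := (j : ℕ)) fun k hk => requests_congr h z hk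
  rw [h1]

/-- The online algorithm with fixed thresholds. -/
noncomputable def algorithm (S : Setup m n r) (t : S.Seed) : OnlineAlgorithm m n r where
  assign := S.allocate t
  online _ _ _ h := allocate_congr t h

theorem requests_of_inPhase {p : JobSeq m n r} {z : ℤ} {j : Fin n} (h : S.InPhase p z j) :
    S.requests p z j = S.request (2 ^ z) (p j) := by
  unfold requests
  rw [dif_pos ⟨j.2, h⟩]

theorem inPhase_of_elig_nonempty {p : JobSeq m n r} {z : ℤ} {k : ℕ}
    (h : (S.requests p z k).elig.Nonempty) : ∃ hk : k < n, S.InPhase p z ⟨k, hk⟩ := by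
  by_contra hcon
  unfold requests at h
  rw [dif_neg hcon] at h
  exact not_nonempty_empty h

section Valid

variable {K B : ℝ}

theorem two_pow_le_card (hS : S.Valid K B) {l : ℕ} (hl : l ≤ S.classes - 1) : 2 ^ l ≤ Fintype.card (Fin n × Fin r) := by
  rw [Fintype.card_prod, Fintype.card_fin, Fintype.card_fin]
  calc 2 ^ l ≤ 2 ^ (S.classes - 1) := Nat.pow_le_pow_right (by norm_num) hl
    _ ≤ n := hS.two_pow_le
    _ ≤ n * r := Nat.le_mul_of_pos_right _ (Nat.pos_of_neZero r)

theorem lev_request_lt (hS : S.Valid K B) (G : ℝ) (J : Job m r) (u : S.Loc) : (S.request G J).lev u < S.classes := by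
  have h1 : (S.request G J).lev u ≤ S.classes - 1 := Nat.findGreatest_le _
  have := hS.classes_pos
  omega

theorem mul_fund_le_target (hS : S.Valid K B) {G : ℝ} {J : Job m r} {u : S.Loc} (hu : u ∈ (S.request G J).elig) {l : ℕ}
    (hl : l ≤ (S.request G J).lev u) :
    (bestLoad J u.1).toReal * fund (S.norm u.1) (2 ^ l) ≤ S.target G u := by
  classical
  have h1 := (mem_filter.1 hu).2.2
  have h2 : (bestLoad J u.1).toReal * fund (S.norm u.1) (2 ^ (S.request G J).lev u) ≤
      S.target G u := Nat.findGreatest_spec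
    (P := fun l => (bestLoad J u.1).toReal * fund (S.norm u.1) (2 ^ l) ≤ S.target G u)
    (Nat.zero_le _) h1
  refine le_trans ?_ h2
  refine mul_le_mul_of_nonneg_left ?_ ENNReal.toReal_nonneg
  exact fund_mono (hS.norm u.1) (Nat.pow_le_pow_right (by norm_num) hl)
    (two_pow_le_card hS (Nat.findGreatest_le _))

theorem target_lt_mul_fund {G : ℝ} {J : Job m r} {u : S.Loc} {l : ℕ}
    (hl : (S.request G J).lev u < l) (hl' : l ≤ S.classes - 1) :
    S.target G u < (bestLoad J u.1).toReal * fund (S.norm u.1) (2 ^ l) := by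
  classical
  exact not_le.1 (Nat.findGreatest_is_greatest
    (P := fun l => (bestLoad J u.1).toReal * fund (S.norm u.1) (2 ^ l) ≤ S.target G u) hl hl')

end Valid

end Setup

/-! ### Analysis of the phases -/

namespace Setup

variable {m n r : ℕ} {S : Setup m n r} [NeZero m] [NeZero r] {K B : ℝ}

theorem prefOpt_le_zpow {p : JobSeq m n r} {z : ℤ} {j : Fin n} (h : S.InPhase p z j) :
    (S.prefOpt p j).toReal ≤ 2 ^ z := by
  obtain ⟨-, -, rfl⟩ := h
  exact_mod_cast Int.self_le_zpow_clog (b := 2) (by norm_num) (S.prefOpt p j).toReal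

theorem zpow_le_prefOpt {p : JobSeq m n r} {z : ℤ} {j : Fin n} (h : S.InPhase p z j) :
    (2 : ℝ) ^ z ≤ 2 * (S.prefOpt p j).toReal := by
  obtain ⟨h0, h1, rfl⟩ := h
  have := Int.zpow_pred_clog_lt_self (b := 2) (by norm_num) (ENNReal.toReal_pos h0 h1)
  rw [Nat.cast_ofNat, zpow_sub_one₀ two_ne_zero] at this
  linarith

theorem prefOpt_le (hS : S.Valid K B) (p : JobSeq m n r) (j : Fin n) :
    S.prefOpt p j ≤ opt S.agg S.norm p :=
  opt_mono hS.agg hS.norm (truncate_le p j)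

/-- One optimal allocation, for the prefix ending with the last job of the phase, serves the whole
phase at cost at most `2 ^ z`. `cover` turns its machine loads into a level for each machine. -/
theorem exists_reference (hS : S.Valid K B) (p : JobSeq m n r) (z : ℤ) (hz : ∃ j, S.InPhase p z j) :
    ∃ (y : Fin n → Fin m × Fin r) (s : Fin m → Fin (S.levels + 1)),
      (∀ j, S.InPhase p z j → p j (y j).1 (y j).2 ≠ ∞) ∧ ∑ i, S.price (s i) ≤ K ∧
      ∃ w : Fin m → Fin n × Fin r → ℝ, (∀ i jk, 0 ≤ w i jk) ∧
        (∀ j, S.InPhase p z j → w (y j).1 (j, (y j).2) = (p j (y j).1 (y j).2).toReal) ∧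
        ∀ i, S.norm i (w i) ≤ S.target (2 ^ z) (i, s i) := by
  classical
  set P := univ.filter fun j => S.InPhase p z j with hP
  have hPn : P.Nonempty := by
    obtain ⟨j, hj⟩ := hz
    exact ⟨j, mem_filter.2 ⟨mem_univ _, hj⟩⟩
  set j₀ := P.max' hPn with hj₀
  have hin : S.InPhase p z j₀ := (mem_filter.1 (P.max'_mem hPn)).2
  have hle : ∀ j, S.InPhase p z j → j ≤ j₀ := fun j hj =>
    P.le_max' j (mem_filter.2 ⟨mem_univ _, hj⟩)
  obtain ⟨x, hx1, hx2⟩ := exists_optimal hS.agg hin.2.1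
  have h2z : (0 : ℝ) < 2 ^ z := by positivity
  set lam := loadVector S.norm (truncate p j₀) x with hlam
  have hlam0 : 0 ≤ lam := loadVector_nonneg hS.norm _ _
  have hf : S.agg (((2 : ℝ) ^ z)⁻¹ • lam) ≤ 1 := by
    rw [hS.agg.smul_of_nonneg (by positivity), inv_mul_le_iff₀ h2z, mul_one, hx2]
    exact prefOpt_le_zpow hin
  obtain ⟨s, hs1, hs2⟩ := hS.disc.cover _ (fun i => mul_nonneg (by positivity) (hlam0 i)) hf
  refine ⟨x, s, fun j hj => ?_, hs2, machineVector (truncate p j₀) x,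
    fun i jk => machineVector_nonneg _ _ i jk, fun j hj => ?_, fun i => ?_⟩
  · rw [← truncate_of_le p (hle j hj)]
    exact hx1 j
  · simp only [machineVector, Prod.mk.eta, if_true]
    rw [truncate_of_le p (hle j hj)]
  · have := hs1 i
    change ((2 : ℝ) ^ z)⁻¹ * lam i ≤ _ at this
    rw [inv_mul_le_iff₀ h2z] at this
    exact this

/-- A single entry has norm at most that of the whole vector, hence at most the target, so class `0`
fits. -/
theorem elig_of_reference {p : JobSeq m n r} {z : ℤ} {y : Fin n → Fin m × Fin r}
    {s : Fin m → Fin (S.levels + 1)} {w : Fin m → Fin n × Fin r → ℝ} (hS : S.Valid K B)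
    (hy : ∀ j, S.InPhase p z j → p j (y j).1 (y j).2 ≠ ∞) (hw0 : ∀ i jk, 0 ≤ w i jk)
    (hw : ∀ j, S.InPhase p z j → w (y j).1 (j, (y j).2) = (p j (y j).1 (y j).2).toReal)
    (hN : ∀ i, S.norm i (w i) ≤ S.target (2 ^ z) (i, s i)) {j : Fin n} (hj : S.InPhase p z j) :
    ((y j).1, s (y j).1) ∈ (S.request (2 ^ z) (p j)).elig := by
  have h1 := bestLoad_le (p j) (y j).1 (y j).2
  refine mem_filter.2 ⟨mem_univ _, ne_top_of_le_ne_top (hy j hj) h1, ?_⟩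
  refine le_trans ?_ (hN _)
  refine le_trans ?_ (coord_mul_fund_le (hS.norm _) _ (hw0 _) (j, (y j).2))
  rw [hw j hj, pow_zero]
  exact mul_le_mul_of_nonneg_right (ENNReal.toReal_mono (hy j hj) h1) (fund_nonneg (hS.norm _) 1)

theorem elig_nonempty (hS : S.Valid K B) {p : JobSeq m n r} {z : ℤ} {j : Fin n}
    (hj : S.InPhase p z j) : (S.requests p z j).elig.Nonempty := by
  obtain ⟨y, s, hy, -, w, hw0, hw, hN⟩ := exists_reference hS p z ⟨j, hj⟩
  rw [requests_of_inPhase hj]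
  exact ⟨_, elig_of_reference hS hy hw0 hw hN hj⟩

theorem price_pos (hS : S.Valid K B) (u : S.Loc) : 0 < S.locPrice u := by
  have hm : (0 : ℝ) < m := by exact_mod_cast Nat.pos_of_neZero m
  exact lt_of_lt_of_le (by positivity) (hS.disc.cost_ge u.2)

/-- How a job of a phase is served. -/
theorem served_of_inPhase (hS : S.Valid K B) (t : S.Seed) {p : JobSeq m n r} {z : ℤ} {j : Fin n}
    (hj : S.InPhase p z j) : ∃ (u : S.Loc) (l : Fin S.classes),
      served S.locPrice t (S.requests p z) j = some (u, (l : ℕ)) ∧ bestLoad (p j) u.1 ≠ ∞ ∧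
      (bestLoad (p j) u.1).toReal * fund (S.norm u.1) (2 ^ (l : ℕ)) ≤ S.target (2 ^ z) u ∧
      S.allocate t p j = (u.1, bestWay (p j) u.1) := by
  have hM : 0 < S.slots := by have := hS.two_le_slots; omega
  obtain ⟨u, hu, l, hl, h⟩ := served_spec (t := t) (price_pos hS) hM (elig_nonempty hS hj)
  rw [requests_of_inPhase hj] at hu hl
  have hlD := hl.trans_lt (lev_request_lt hS _ _ u)
  refine ⟨u, ⟨l, hlD⟩, h, (mem_filter.1 hu).2.1, mul_fund_le_target hS hu hl, ?_⟩
  unfold allocate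
  rw [if_neg hj.1, hj.2.2, h]
  rfl

theorem exists_inPhase {p : JobSeq m n r} {j : Fin n} (h0 : S.prefOpt p j ≠ 0)
    (h1 : S.prefOpt p j ≠ ∞) : S.InPhase p (Int.clog 2 (S.prefOpt p j).toReal) j :=
  ⟨h0, h1, rfl⟩

theorem allocate_of_prefOpt_eq_zero (hS : S.Valid K B) (t : S.Seed) {p : JobSeq m n r} {j : Fin n}
    (h : S.prefOpt p j = 0) : p j (S.allocate t p j).1 (S.allocate t p j).2 = 0 := by
  have h1 : S.allocate t p j = freeWay (p j) := by
    unfold allocate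
    rw [if_pos h]
  rw [h1]
  exact freeWay_spec _ (exists_free_of_opt_truncate_eq_zero hS.agg hS.norm p j h)

theorem available (hS : S.Valid K B) (t : S.Seed) {p : JobSeq m n r}
    (h : opt S.agg S.norm p ≠ ∞) (j : Fin n) :
    p j (S.allocate t p j).1 (S.allocate t p j).2 ≠ ∞ := by
  by_cases h0 : S.prefOpt p j = 0
  · rw [allocate_of_prefOpt_eq_zero hS t h0]
    exact ENNReal.zero_ne_top
  · obtain ⟨u, l, -, h2, -, h3⟩ := served_of_inPhase hS t
      (exists_inPhase h0 (ne_top_of_le_ne_top h (prefOpt_le hS p j)))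
    rw [h3]
    exact h2

/-- The bound on the loads of the locations. -/
noncomputable def loadBound (S : Setup m n r) : ℝ := 1000 * S.classes * Real.log S.slots

theorem totalLoad_phase (hS : S.Valid K B) (p : JobSeq m n r) (z : ℤ) (hz : ∃ j, S.InPhase p z j) :
    (∀ (t : S.Seed) u, totalLoad S.locPrice t (S.requests p z) n u ≤ S.loadBound) ∧
      ∑ t : S.Seed, ∑ u, S.locPrice u * totalLoad S.locPrice t (S.requests p z) n u ≤
        Fintype.card S.Seed * (S.loadBound * K) := by
  classical
  obtain ⟨y, s, hy, hsK, w, hw0, hw, hN⟩ := exists_reference hS p z hz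
  have hm : (0 : ℝ) < m := by exact_mod_cast Nat.pos_of_neZero m
  have hmM : (m : ℝ) ≤ S.slots := by exact_mod_cast hS.le_slots
  have hel : ∀ {j}, S.InPhase p z j → ((y j).1, s (y j).1) ∈ (S.request (2 ^ z) (p j)).elig :=
    fun hj => elig_of_reference hS hy hw0 hw hN hj
  obtain ⟨j₀, -⟩ := hz
  set v : ℕ → S.Loc := fun k => if hk : k < n then ((y ⟨k, hk⟩).1, s (y ⟨k, hk⟩).1) else (0, 0) with hv
  have hvk : ∀ j : Fin n, v j = ((y j).1, s (y j).1) := fun j => by simp [hv]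
  refine totalLoad_bounds (fun u => ?_) (fun u => hS.disc.cost_le u.2) hS.two_le_slots ?_
    hS.classes_pos hS.one_le hS.budget_le ?_ v (univ.image fun i => (i, s i)) ?_ ?_ ?_
  · refine le_trans ?_ (hS.disc.cost_ge u.2)
    gcongr
  · rw [Fintype.card_prod, Fintype.card_fin, Fintype.card_fin]
    exact hS.mul_le_slots
  · intro k u hu
    obtain ⟨hk, hj⟩ := inPhase_of_elig_nonempty ⟨u, hu⟩
    have := requests_of_inPhase hj
    simp only at this
    rw [this]
    exact lev_request_lt hS _ _ u
  · intro k _ hne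
    obtain ⟨hk, hj⟩ := inPhase_of_elig_nonempty hne
    have h1 := requests_of_inPhase hj
    have h2 := hvk ⟨k, hk⟩
    simp only at h1 h2
    rw [h1, h2]
    exact ⟨hel hj, mem_image.2 ⟨_, mem_univ _, rfl⟩⟩
  · rw [sum_image fun i _ i' _ h => congrArg Prod.fst h]
    exact hsK
  · intro u
    set Q := (range n).filter fun k => (S.requests p z k).elig.Nonempty ∧ v k = u with hQ
    have hQ1 : ∀ k ∈ Q, ∃ hk : k < n, S.InPhase p z ⟨k, hk⟩ ∧
        u = ((y ⟨k, hk⟩).1, s (y ⟨k, hk⟩).1) ∧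
        S.requests p z k = S.request (2 ^ z) (p ⟨k, hk⟩) := by
      intro k hk
      obtain ⟨-, hne, hvu⟩ := mem_filter.1 hk
      obtain ⟨hk, hj⟩ := inPhase_of_elig_nonempty hne
      exact ⟨hk, hj, hvu ▸ hvk ⟨k, hk⟩, requests_of_inPhase hj⟩
    refine sum_half_pow_le Q (fun k => (S.requests p z k).lev u) S.classes ?_ ?_
    · intro k hk
      obtain ⟨hk, -, -, h⟩ := hQ1 k hk
      rw [h]
      exact lev_request_lt hS _ _ u
    · intro l hl
      set Ql := Q.filter fun k => (S.requests p z k).lev u = l with hQl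
      -- Below the top class, these jobs do not fit class `l + 1` and `card_lt_of_class` counts
      -- them. In the top class `n ≤ 2 ^ classes` suffices.
      by_cases hl1 : l + 1 ≤ S.classes - 1
      · set g : ℕ → Fin n × Fin r := fun k => if hk : k < n then (⟨k, hk⟩, (y ⟨k, hk⟩).2) else (j₀, 0)
          with hg
        have hgk : ∀ j : Fin n, g j = (j, (y j).2) := fun j => by simp [hg]
        have hinj : Set.InjOn g Ql := by
          intro k hk k' hk' hkk
          obtain ⟨hk, -⟩ := hQ1 k (mem_filter.1 hk).1
          obtain ⟨hk', -⟩ := hQ1 k' (mem_filter.1 hk').1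
          have h1 := hgk ⟨k, hk⟩
          have h2 := hgk ⟨k', hk'⟩
          simp only at h1 h2
          rw [h1, h2] at hkk
          simpa using congrArg Prod.fst hkk
        rw [← card_image_of_injOn hinj]
        rcases Ql.eq_empty_or_nonempty with hemp | ⟨k₁, hk₁⟩
        · rw [hemp, image_empty, card_empty]; positivity
        have hus : u = (u.1, s u.1) := by
          obtain ⟨_, -, h, -⟩ := hQ1 k₁ (mem_filter.1 hk₁).1
          rw [h]
        refine (card_lt_of_class (hS.norm u.1) (w u.1) (hw0 _) (hN u.1) _ ?_ (by positivity)).le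
        intro x hx
        obtain ⟨k, hk, rfl⟩ := mem_image.1 hx
        obtain ⟨hkQ, hlev⟩ := mem_filter.1 hk
        obtain ⟨hkn, hj, hu, hreq⟩ := hQ1 k hkQ
        have h1 := hgk ⟨k, hkn⟩
        simp only at h1
        rw [h1, ← hus]
        rw [hreq] at hlev
        refine (target_lt_mul_fund (by rw [hlev]; exact Nat.lt_succ_self l) hl1).trans_le ?_
        refine mul_le_mul_of_nonneg_right ?_ (fund_nonneg (hS.norm _) _)
        have h2 := hw _ hj
        have h3 : u.1 = (y ⟨k, hkn⟩).1 := congrArg Prod.fst hu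
        rw [h3, h2]
        exact ENNReal.toReal_mono (hy _ hj) (bestLoad_le _ _ _)
      · have h1 : l + 1 = S.classes := by omega
        rw [h1]
        refine le_trans ?_ hS.le_two_pow
        calc Ql.card ≤ (range n).card :=
              card_le_card ((filter_subset _ _).trans (filter_subset _ _))
          _ = n := card_range n

/-- The loads that the jobs of a phase put on a machine. -/
noncomputable def phaseVector (S : Setup m n r) (t : S.Seed) (p : JobSeq m n r) (z : ℤ) (i : Fin m) :
    Fin n × Fin r → ℝ := fun jk =>
  open Classical in
  if S.InPhase p z jk.1 ∧ S.allocate t p jk.1 = (i, jk.2) then (p jk.1 i jk.2).toReal else 0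

theorem phaseVector_nonneg (t : S.Seed) (p : JobSeq m n r) (z : ℤ) (i : Fin m)
    (jk : Fin n × Fin r) : 0 ≤ S.phaseVector t p z i jk := by
  unfold phaseVector
  split_ifs
  · exact ENNReal.toReal_nonneg
  · exact le_rfl

theorem target_nonneg (hS : S.Valid K B) {G : ℝ} (hG : 0 ≤ G) (u : S.Loc) : 0 ≤ S.target G u := by
  have := hS.disc.scale_pos
  unfold target
  positivity

/-- Each job is served by one unit in one class and its way is then determined, so coordinates
inject into jobs. The weighted counts are thus part of the load, and nonempty classes `l ≥ 1` are
used classes. -/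
theorem sum_class_le (t : S.Seed) (p : JobSeq m n r) (z : ℤ) (u : S.Loc)
    (A : Fin S.classes → Finset (Fin n × Fin r))
    (hA : ∀ l, ∀ x ∈ A l, served S.locPrice t (S.requests p z) x.1 = some (u, (l : ℕ)) ∧
      x.2 = bestWay (p x.1) u.1) :
    ∑ l, (((A l).card : ℝ) * (1 / 2) ^ (l : ℕ) + if 1 ≤ (l : ℕ) ∧ (A l).Nonempty then 1 else 0) ≤
      totalLoad S.locPrice t (S.requests p z) n u := by
  classical
  set e := S.requests p z with he
  rw [sum_add_distrib]
  unfold totalLoad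
  refine add_le_add ?_ ?_
  · rw [loads_eq_sum]
    have h1 : ∀ l, ((A l).card : ℝ) ≤
        ∑ k ∈ range n, if served S.locPrice t e k = some (u, (l : ℕ)) then (1 : ℝ) else 0 := by
      intro l
      rw [sum_boole, Nat.cast_le]
      refine card_le_card_of_injOn (fun x => (x.1 : ℕ)) ?_ ?_
      · intro x hx
        exact mem_coe.2 (mem_filter.2 ⟨mem_range.2 x.1.2, (hA l x hx).1⟩)
      · intro x hx x' hx' h
        have h2 : x.1 = x'.1 := Fin.ext h
        refine Prod.ext h2 ?_
        rw [(hA l x hx).2, (hA l x' hx').2, h2]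
    refine (sum_le_sum fun l _ => mul_le_mul_of_nonneg_right (h1 l) (by positivity)).trans ?_
    simp only [sum_mul]
    rw [sum_comm]
    refine sum_le_sum fun k _ => ?_
    cases hsk : served S.locPrice t e k with
    | none => simp [useLoad]
    | some v =>
      rw [useLoad_some]
      by_cases hvu : v.1 = u
      · rw [if_pos hvu]
        have h2 : ∀ l : Fin S.classes,
            (if some v = some (u, (l : ℕ)) then (1 : ℝ) else 0) * (1 / 2) ^ (l : ℕ) =
              if (l : ℕ) = v.2 then (1 / 2) ^ v.2 else 0 := by
          intro l
          by_cases hl : (l : ℕ) = v.2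
          · rw [if_pos hl, if_pos (by rw [hl, ← hvu]), hl, one_mul]
          · rw [if_neg hl, if_neg (fun h => hl (by rw [Option.some.inj h])), zero_mul]
        simp only [h2]
        rw [← sum_filter, sum_const, nsmul_eq_mul]
        refine mul_le_of_le_one_left (by positivity) ?_
        rw [Nat.cast_le_one, card_le_one]
        intro a ha b hb
        exact Fin.ext ((mem_filter.1 ha).2.trans (mem_filter.1 hb).2.symm)
      · rw [if_neg hvu]
        refine (sum_eq_zero fun l _ => ?_).le
        rw [if_neg (fun h => hvu (by rw [Option.some.inj h])), zero_mul]
  · rw [sum_boole, Nat.cast_le]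
    refine card_le_card fun l hl => ?_
    obtain ⟨hl1, x, hx⟩ := (mem_filter.1 hl).2
    exact mem_filter.2 ⟨mem_univ _, hl1, x.1, x.1.2, (hA l x hx).1⟩

/-- The vector is dominated by the sum of its pieces by level and class, and `norm_le_of_class`
bounds each piece. -/
theorem norm_phaseVector_le (hS : S.Valid K B) (t : S.Seed) (p : JobSeq m n r) (z : ℤ) (i : Fin m) :
    S.norm i (S.phaseVector t p z i) ≤ ∑ s, S.target (2 ^ z) (i, s) *
      totalLoad S.locPrice t (S.requests p z) n (i, s) := by
  classical
  set A : Fin (S.levels + 1) → Fin S.classes → Finset (Fin n × Fin r) := fun s l =>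
    univ.filter fun x => S.InPhase p z x.1 ∧
      served S.locPrice t (S.requests p z) x.1 = some ((i, s), (l : ℕ)) ∧
      x.2 = bestWay (p x.1) i with hA
  set w : Fin (S.levels + 1) → Fin S.classes → Fin n × Fin r → ℝ := fun s l x =>
    if x ∈ A s l then (bestLoad (p x.1) i).toReal else 0 with hw
  have hw0 : ∀ s l x, 0 ≤ w s l x := by
    intro s l x
    simp only [hw]
    split_ifs
    · exact ENNReal.toReal_nonneg
    · exact le_rfl
  have h1 : S.norm i (S.phaseVector t p z i) ≤ S.norm i (∑ s, ∑ l, w s l) := by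
    apply (hS.norm i).monotone _ _ fun x => phaseVector_nonneg t p z i x
    intro x
    simp only [Finset.sum_apply]
    have hsum : ∀ s, 0 ≤ ∑ l, w s l x := fun s => sum_nonneg fun l _ => hw0 s l x
    unfold phaseVector
    split_ifs with hx
    · obtain ⟨u, l, h2, h3, h4, h5⟩ := served_of_inPhase hS t hx.1
      rw [hx.2, Prod.mk.injEq] at h5
      obtain ⟨u1, u2⟩ := u
      obtain ⟨rfl, h6⟩ := h5
      have hmem : x ∈ A u2 l := mem_filter.2 ⟨mem_univ _, hx.1, h2, h6⟩
      have h7 : w u2 l x = (p x.1 i x.2).toReal := by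
        simp only [hw]
        rw [if_pos hmem, h6]
        rfl
      rw [← h7]
      exact (single_le_sum (f := fun l => w u2 l x) (fun l _ => hw0 u2 l x) (mem_univ l)).trans
        (single_le_sum (f := fun s => ∑ l, w s l x) (fun s _ => hsum s) (mem_univ u2))
    · exact sum_nonneg fun s _ => hsum s
  refine h1.trans (((hS.norm i).sum_le _ _).trans (sum_le_sum fun s _ => ?_))
  refine ((hS.norm i).sum_le _ _).trans ?_
  have h2 : ∀ l, S.norm i (w s l) ≤ S.target (2 ^ z) (i, s) * ((A s l).card * (1 / 2) ^ (l : ℕ) +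
      if 1 ≤ (l : ℕ) ∧ (A s l).Nonempty then 1 else 0) := by
    intro l
    refine norm_le_of_class (hS.norm i) (two_pow_le_card hS (by have := l.2; omega)) _ _
      (hw0 s l) (fun x hx => if_neg hx) ?_
    intro x hx
    obtain ⟨-, hx1, hx2, -⟩ := mem_filter.1 hx
    obtain ⟨u, l', h2, -, h4, -⟩ := served_of_inPhase hS t hx1
    rw [hx2, Option.some.injEq, Prod.mk.injEq] at h2
    obtain ⟨rfl, h3⟩ := h2
    rw [← h3] at h4
    simp only [hw]
    rw [if_pos hx]
    exact h4
  refine (sum_le_sum fun l _ => h2 l).trans ?_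
  rw [← mul_sum]
  refine mul_le_mul_of_nonneg_left ?_ (target_nonneg hS (by positivity) _)
  exact sum_class_le t p z (i, s) (A s) fun l x hx => (mem_filter.1 hx).2.2

theorem loadBound_pos (hS : S.Valid K B) : 0 < S.loadBound := by
  have h1 : (0 : ℝ) < S.classes := by exact_mod_cast hS.classes_pos
  have h2 : 0 < Real.log S.slots := Real.log_pos (by exact_mod_cast hS.two_le_slots)
  unfold loadBound
  positivity

theorem totalLoad_nonneg (t : S.Seed) (e : ℕ → Request S.Loc) (u : S.Loc) :
    0 ≤ totalLoad S.locPrice t e n u :=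
  add_nonneg (loads_nonneg _ _) (Nat.cast_nonneg _)

/-- The loads divided by `loadBound` lie in `[0, 1]`, so `Discretization.bound` applies. Scaling
back turns its constant `K` into `loadBound * K`, which also bounds the expected total price. -/
theorem agg_phaseVector_le (hS : S.Valid K B) (t : S.Seed) (p : JobSeq m n r) (z : ℤ)
    (hz : ∃ j, S.InPhase p z j) : S.agg (fun i => S.norm i (S.phaseVector t p z i)) ≤
      2 ^ z * B * (S.loadBound * K +
        ∑ u, S.locPrice u * totalLoad S.locPrice t (S.requests p z) n u) := by
  set R := S.loadBound with hR
  have hR0 : 0 < R := loadBound_pos hS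
  have h2z : (0 : ℝ) < 2 ^ z := by positivity
  set X : S.Loc → ℝ := fun u => totalLoad S.locPrice t (S.requests p z) n u with hX
  have hX0 : ∀ u, 0 ≤ X u := fun u => totalLoad_nonneg t _ u
  have hXR : ∀ u, X u ≤ R := (totalLoad_phase hS p z hz).1 t
  have h1 := hS.disc.bound (fun i s => X (i, s) / R) (fun i s => div_nonneg (hX0 _) hR0.le)
    fun i s => by rw [div_le_one hR0]; exact hXR _
  have h2 : S.agg (fun i => S.norm i (S.phaseVector t p z i)) ≤
      S.agg ((R * 2 ^ z) • fun i => ∑ s, X (i, s) / R * ((1 / 2) ^ (s : ℕ) / S.scale)) := by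
    apply hS.agg.monotone _ _ fun i => (hS.norm i).nonneg _
    intro i
    refine (norm_phaseVector_le hS t p z i).trans (le_of_eq ?_)
    simp only [Pi.smul_apply, smul_eq_mul, mul_sum, target]
    refine sum_congr rfl fun s _ => ?_
    simp only [hX]
    field_simp
  refine h2.trans ?_
  rw [hS.agg.smul_of_nonneg (by positivity)]
  refine (mul_le_mul_of_nonneg_left h1 (by positivity)).trans (le_of_eq ?_)
  rw [Fintype.sum_prod_type]
  have h3 : ∑ i, ∑ s, S.price s * (X (i, s) / R) = (∑ i, ∑ s, S.price s * X (i, s)) / R := by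
    simp only [sum_div, mul_div_assoc]
  rw [h3]
  change _ = 2 ^ z * B * (R * K + ∑ i, ∑ s, S.price s * X (i, s))
  field_simp

theorem sum_agg_phaseVector_le (hS : S.Valid K B) (p : JobSeq m n r) (z : ℤ)
    (hz : ∃ j, S.InPhase p z j) :
    ∑ t : S.Seed, S.agg (fun i => S.norm i (S.phaseVector t p z i)) ≤
      Fintype.card S.Seed * (2 * S.loadBound * B * K) * 2 ^ z := by
  refine (sum_le_sum fun t _ => agg_phaseVector_le hS t p z hz).trans ?_
  have h1 := (totalLoad_phase hS p z hz).2
  have hB := hS.factor_nonneg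
  rw [← mul_sum, sum_add_distrib, sum_const, card_univ, nsmul_eq_mul]
  calc _ ≤ (2 : ℝ) ^ z * B * (Fintype.card S.Seed * (S.loadBound * K) +
        Fintype.card S.Seed * (S.loadBound * K)) := by gcongr
    _ = _ := by ring

/-- The phases that occur. -/
noncomputable def phases (S : Setup m n r) (p : JobSeq m n r) : Finset ℤ :=
  open Classical in
  (univ.filter fun j => S.prefOpt p j ≠ 0).image fun j => Int.clog 2 (S.prefOpt p j).toReal

theorem exists_inPhase_of_mem_phases (hS : S.Valid K B) {p : JobSeq m n r}
    (h : opt S.agg S.norm p ≠ ∞) {z : ℤ} (hz : z ∈ S.phases p) : ∃ j, S.InPhase p z j := by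
  obtain ⟨j, hj, rfl⟩ := mem_image.1 hz
  exact ⟨j, (mem_filter.1 hj).2, ne_top_of_le_ne_top h (prefOpt_le hS p j), rfl⟩

theorem agg_loadVector_le (hS : S.Valid K B) (t : S.Seed) {p : JobSeq m n r}
    (h : opt S.agg S.norm p ≠ ∞) : S.agg (loadVector S.norm p (S.allocate t p)) ≤
      ∑ z ∈ S.phases p, S.agg (fun i => S.norm i (S.phaseVector t p z i)) := by
  classical
  refine le_trans ?_ (hS.agg.sum_le _ _)
  apply hS.agg.monotone _ _ (loadVector_nonneg hS.norm _ _)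
  intro i
  simp only [Finset.sum_apply]
  refine le_trans ?_ ((hS.norm i).sum_le _ _)
  apply (hS.norm i).monotone _ _ (machineVector_nonneg _ _ i)
  intro x
  simp only [Finset.sum_apply]
  have h0 : ∀ z, 0 ≤ S.phaseVector t p z i x := fun z => phaseVector_nonneg t p z i x
  unfold machineVector
  split_ifs with hx
  · by_cases hv : S.prefOpt p x.1 = 0
    · have h1 := allocate_of_prefOpt_eq_zero hS t hv
      rw [hx] at h1
      rw [h1, ENNReal.toReal_zero]
      exact sum_nonneg fun z _ => h0 z
    · have hin := exists_inPhase hv (ne_top_of_le_ne_top h (prefOpt_le hS p x.1))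
      have hmem : Int.clog 2 (S.prefOpt p x.1).toReal ∈ S.phases p :=
        mem_image.2 ⟨x.1, mem_filter.2 ⟨mem_univ _, hv⟩, rfl⟩
      refine le_trans (le_of_eq ?_) (single_le_sum (f := fun z => S.phaseVector t p z i x)
        (fun z _ => h0 z) hmem)
      unfold phaseVector
      rw [if_pos ⟨hin, hx⟩]
  · exact sum_nonneg fun z _ => h0 z

theorem sum_phases_le (hS : S.Valid K B) {p : JobSeq m n r} (h : opt S.agg S.norm p ≠ ∞) :
    ∑ z ∈ S.phases p, (2 : ℝ) ^ z ≤ 4 * (opt S.agg S.norm p).toReal := by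
  rcases (S.phases p).eq_empty_or_nonempty with he | hne
  · rw [he, sum_empty]; positivity
  obtain ⟨j, hj⟩ := exists_inPhase_of_mem_phases hS h ((S.phases p).max'_mem hne)
  have h1 := zpow_le_prefOpt hj
  have h2 := ENNReal.toReal_mono h (prefOpt_le hS p j)
  have h3 := sum_two_zpow_le (S.phases p) ((S.phases p).max' hne) fun z hz => (S.phases p).le_max' z hz
  linarith

/-- Each phase costs `2 * loadBound * B * K` times `2 ^ z` in expectation, and the sum of the `2 ^
z` is at most four times the optimum. -/
theorem sum_cost_le (hS : S.Valid K B) {p : JobSeq m n r} (h : opt S.agg S.norm p ≠ ∞) :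
    ∑ t : S.Seed, cost S.agg S.norm p (S.allocate t p) ≤ Fintype.card S.Seed *
      (ENNReal.ofReal (8 * S.loadBound * B * K) * opt S.agg S.norm p) := by
  have h1 : ∀ t : S.Seed, cost S.agg S.norm p (S.allocate t p) =
      ENNReal.ofReal (S.agg (loadVector S.norm p (S.allocate t p))) := fun t => by
    unfold cost
    rw [if_pos fun j => available hS t h j]
  have hR := loadBound_pos hS
  have hB := hS.factor_nonneg
  have hK := hS.one_le
  have hC : 0 ≤ 2 * S.loadBound * B * K := by positivity
  simp only [h1]
  rw [← ENNReal.ofReal_sum_of_nonneg fun t _ => hS.agg.nonneg _]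
  have h2 : ∑ t : S.Seed, S.agg (loadVector S.norm p (S.allocate t p)) ≤
      Fintype.card S.Seed * ((8 * S.loadBound * B * K) * (opt S.agg S.norm p).toReal) := by
    refine (sum_le_sum fun t _ => agg_loadVector_le hS t h).trans ?_
    rw [sum_comm]
    refine (sum_le_sum fun z hz => sum_agg_phaseVector_le hS p z
      (exists_inPhase_of_mem_phases hS h hz)).trans ?_
    rw [← mul_sum]
    calc _ ≤ Fintype.card S.Seed * (2 * S.loadBound * B * K) *
          (4 * (opt S.agg S.norm p).toReal) := by gcongr; exact sum_phases_le hS h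
      _ = _ := by ring
  refine (ENNReal.ofReal_le_ofReal h2).trans (le_of_eq ?_)
  rw [ENNReal.ofReal_mul (by positivity), ENNReal.ofReal_natCast,
    ENNReal.ofReal_mul (by positivity), ENNReal.ofReal_toReal h]

end Setup

/-! ### Averaging over seeds and choice of parameters -/

theorem hasCompetitiveAlgorithm_of_forall {m n r : ℕ} {f : (Fin m → ℝ) → ℝ}
    {N : Fin m → (Fin n × Fin r → ℝ) → ℝ} {ρ : ℝ} (hρ : 0 < ρ) {T : Type} [Fintype T] [Nonempty T]
    (A : T → OnlineAlgorithm m n r) (h : ∀ p : JobSeq m n r, opt f N p ≠ ∞ →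
      ∑ t, cost f N p ((A t).assign p) ≤ Fintype.card T * (ENNReal.ofReal ρ * opt f N p)) :
    HasCompetitiveAlgorithm f N ρ := by
  classical
  refine ⟨(PMF.uniformOfFintype T).map A, fun p => ?_⟩
  by_cases hp : opt f N p = ∞
  · rw [hp, ENNReal.mul_top (by simpa using hρ)]
    exact le_top
  have h1 : ∑' a : OnlineAlgorithm m n r,
      ((PMF.uniformOfFintype T).map A) a * cost f N p (a.assign p) =
      ∑ t, (Fintype.card T : ℝ≥0∞)⁻¹ * cost f N p ((A t).assign p) := by
    simp only [PMF.map_apply, ← ENNReal.tsum_mul_right]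
    rw [ENNReal.tsum_comm, tsum_fintype]
    refine sum_congr rfl fun t _ => ?_
    rw [tsum_eq_single (A t) fun a ha => by rw [if_neg ha, zero_mul], if_pos rfl,
      PMF.uniformOfFintype_apply]
  rw [h1, ← mul_sum]
  refine (mul_le_mul_right (h p hp) _).trans (le_of_eq ?_)
  rw [← mul_assoc, ENNReal.inv_mul_cancel (by simp) (by simp), one_mul]

theorem HasCompetitiveAlgorithm.mono {m n r : ℕ} {f : (Fin m → ℝ) → ℝ}
    {N : Fin m → (Fin n × Fin r → ℝ) → ℝ} {ρ ρ' : ℝ} (h : HasCompetitiveAlgorithm f N ρ)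
    (hρ : ρ ≤ ρ') : HasCompetitiveAlgorithm f N ρ' := by
  obtain ⟨P, hP⟩ := h
  refine ⟨P, fun p => (hP p).trans ?_⟩
  gcongr

theorem log_bounds {n : ℕ} (hn : 2 ≤ n) : (Nat.clog 2 n : ℝ) ≤ 3 * Real.log n ∧
    (Nat.clog 2 n : ℝ) + 1 ≤ 5 * Real.log n := by
  have hpos : 0 < Nat.clog 2 n := Nat.clog_pos (by norm_num) hn
  have h1 : 2 ^ (Nat.clog 2 n - 1) < n := Nat.pow_pred_clog_lt_self (by norm_num) (by omega)
  have h2 : ((Nat.clog 2 n - 1 : ℕ) : ℝ) * Real.log 2 ≤ Real.log n := by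
    rw [← Real.log_pow]
    exact Real.log_le_log (by positivity) (by exact_mod_cast h1.le)
  rw [Nat.cast_sub hpos, Nat.cast_one] at h2
  have h3 : Real.log 2 ≤ Real.log n := Real.log_le_log (by norm_num) (by exact_mod_cast hn)
  have h4 := Real.log_two_gt_d9
  have h5 : (1 : ℝ) ≤ Nat.clog 2 n := by exact_mod_cast hpos
  constructor <;> nlinarith

theorem clog_two_add_one_le {m : ℕ} (hm : 2 ≤ m) : Nat.clog 2 m + 1 ≤ m := by
  have h1 : 2 ^ (Nat.clog 2 m - 1) < m := Nat.pow_pred_clog_lt_self (by norm_num) (by omega)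
  have h2 : Nat.clog 2 m - 1 < 2 ^ (Nat.clog 2 m - 1) := Nat.lt_two_pow_self
  omega

theorem hasCompetitiveAlgorithm_of_discretization {m n r : ℕ} (hm : 2 ≤ m) (hn : 2 ≤ n) (hr : 1 ≤ r)
    {N : Fin m → (Fin n × Fin r → ℝ) → ℝ} (hN : ∀ i, IsMonotoneSymmetricNorm (N i))
    {f : (Fin m → ℝ) → ℝ} (hf : IsMonotoneSymmetricNorm f) {a K B : ℝ}
    {cst : Fin (Nat.clog 2 m + 1) → ℝ} (hd : Discretization f (Nat.clog 2 m) a cst K B) (hK : 1 ≤ K)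
    (hKm : K ≤ m) (hB : 0 < B) :
    HasCompetitiveAlgorithm f N (48000 * B * K * Real.log m * Real.log n) := by
  have : NeZero m := ⟨by omega⟩
  have : NeZero r := ⟨by omega⟩
  have hmm : m ≤ m ^ 2 := Nat.le_self_pow (by norm_num) m
  have hcn : 0 < Nat.clog 2 n := Nat.clog_pos (by norm_num) hn
  -- `m ^ 2` slots suffice for the `m * (Nat.clog 2 m + 1)` locations and only double the logarithm.
  -- The constant is `48000 = 8 * 1000 * 3 * 2`, with `3` from `log_bounds`.
  set S : Setup m n r := ⟨f, N, Nat.clog 2 m, a, cst, Nat.clog 2 n, m ^ 2⟩ with hSdef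
  have hS : S.Valid K B :=
    { agg := hf
      norm := hN
      disc := hd
      classes_pos := hcn
      le_two_pow := Nat.le_pow_clog (by norm_num) n
      two_pow_le := (Nat.pow_pred_clog_lt_self (by norm_num) (by omega)).le
      two_le_slots := hm.trans hmm
      le_slots := hmm
      mul_le_slots := by
        change m * (Nat.clog 2 m + 1) ≤ m ^ 2
        rw [sq]
        exact Nat.mul_le_mul_left m (clog_two_add_one_le hm)
      one_le := hK
      budget_le := hKm.trans (by exact_mod_cast hmm)
      factor_nonneg := hB.le }
  have hR := Setup.loadBound_pos hS
  have : Nonempty S.Seed := ⟨fun _ => ⟨0, by have := hS.two_le_slots; omega⟩⟩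
  refine (hasCompetitiveAlgorithm_of_forall (ρ := 8 * S.loadBound * B * K) (by positivity)
    S.algorithm fun p hp => Setup.sum_cost_le hS hp).mono ?_
  have h1 : S.loadBound = 1000 * (Nat.clog 2 n : ℝ) * (2 * Real.log m) := by
    change 1000 * (Nat.clog 2 n : ℝ) * Real.log ((m ^ 2 : ℕ) : ℝ) = _
    rw [Nat.cast_pow, Real.log_pow]
    norm_num
  have h2 := (log_bounds hn).1
  have h3 : 0 < Real.log m := Real.log_pos (by exact_mod_cast hm)
  rw [h1]
  calc 8 * (1000 * (Nat.clog 2 n : ℝ) * (2 * Real.log m)) * B * K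
      ≤ 8 * (1000 * (3 * Real.log n) * (2 * Real.log m)) * B * K := by gcongr
    _ = _ := by ring

end GenSched

theorem theorem4 :
    ∃ C : ℝ, 0 < C ∧
      ∀ (m n r : ℕ), 2 ≤ m → 2 ≤ n → 1 ≤ r →
        ∀ N : Fin m → (Fin n × Fin r → ℝ) → ℝ,
          (∀ i, GenSched.IsMonotoneSymmetricNorm (N i)) →
          (∀ f : (Fin m → ℝ) → ℝ, GenSched.IsMonotoneSymmetricNorm f →
            GenSched.HasCompetitiveAlgorithm f N (C * Real.log m ^ 2 * Real.log n)) ∧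
          (∀ p : ENNReal, 1 ≤ p →
            GenSched.HasCompetitiveAlgorithm (GenSched.ellNorm m p) N
              (C * Real.log m * Real.log n)) ∧
          (∀ k : ℕ, 1 ≤ k → k ≤ m →
            GenSched.HasCompetitiveAlgorithm (GenSched.topKNorm m k) N
              (C * Real.log m * Real.log n)) := by
  -- A general norm needs `48000 * 2 * 5`, using `K ≤ 5 * log m`; `ℓ_p` and Top-`k` need `48000 * 8
  -- * 2`.
  refine ⟨1000000, by norm_num, fun m n r hm hn hr N hN => ?_⟩
  have hL : m ≤ 2 ^ Nat.clog 2 m := Nat.le_pow_clog (by norm_num) m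
  have hm2 : (2 : ℝ) ≤ m := by exact_mod_cast hm
  have hlm : 0 < Real.log m := Real.log_pos (by linarith)
  have hln : 0 < Real.log n := Real.log_pos (by exact_mod_cast hn)
  have hll := mul_pos hlm hln
  refine ⟨fun f hf => ?_, fun p hp => ?_, fun k hk1 hk => ?_⟩
  · obtain ⟨a, cst, hd⟩ := GenSched.exists_discretization hm hf hL
    refine (GenSched.hasCompetitiveAlgorithm_of_discretization hm hn hr hN hf hd (by simp)
      (by exact_mod_cast GenSched.clog_two_add_one_le hm) (by norm_num)).mono ?_
    have h1 := mul_le_mul_of_nonneg_right (GenSched.log_bounds hm).2 hll.le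
    have h2 : 0 < Real.log m * (Real.log m * Real.log n) := mul_pos hlm hll
    nlinarith
  · obtain ⟨a, cst, hd⟩ := GenSched.exists_discretization_ellNorm hm hp hL
    refine (GenSched.hasCompetitiveAlgorithm_of_discretization hm hn hr hN
      (GenSched.isMonotoneSymmetricNorm_ellNorm (by omega) hp) hd (by norm_num) hm2
      (by norm_num)).mono ?_
    nlinarith
  · obtain ⟨a, cst, hd⟩ := GenSched.exists_discretization_topKNorm hm hk1 hk hL
    refine (GenSched.hasCompetitiveAlgorithm_of_discretization hm hn hr hN
      (GenSched.isMonotoneSymmetricNorm_topKNorm hk1 hk) hd (by norm_num) hm2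
      (by norm_num)).mono ?_
    nlinarith
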